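/- For $n\in\mathbb{N}=\{0,1,2,\dots\}$ let $h_n(x)=e^{\pi x^2}\frac{d^n}{dx^n}\bigl(e^{-2\pi x^2}\bigr)$, $x\in\mathbb{R}$, be the $n$-th Hermite function, and for $\alpha,\beta>0$ let $$\mathcal{G}(h_n,\alpha,\beta)=\{e^{2\pi i\beta l x}h_n(x-\alpha k):k,l\in\mathbb{Z}\}.$$ For $m\ge 0$ let $A^2_m$ be the space of all functions $f:\mathbb{C}\to\mathbb{C}$ of class $C^m$ (in the real sense) with $\bar\partial^m f=0$ and $\int_{\mathbb{C}}|f(z)|^2e^{-\pi|z|^2}\,dA(z)<\infty$, where $\bar\partial=\frac12(\partial_x+i\partial_y)$ and $dA$ is area measure (so $A^2_0=\{0\}$ and $A^2_1$ is the Bargmann-Fock space of entire functions). For $m\ge1$ let $\delta A^2_m=A^2_m\ominus A^2_{m-1}$ be the true polyanalytic Bargmann-Fock space, i.e. the set of $f\in A^2_m$ with $\int_{\mathbb{C}} f\,\bar g\,e^{-\pi|z|^2}\,dA=0$ for all $g\in A^2_{m-1}$. Let $n\in\mathbb{N}$ and $\alpha,\beta>0$. (1) If $\alpha\beta\in\mathbb{Q}$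 and $\alpha\beta\le1$, then $\mathcal{G}(h_n,\alpha,\beta)$ is complete in $L^2(\mathbb{R})$, i.e. its complex linear span is dense in $L^2(\mathbb{R})$; and the lattice $\alpha\mathbb{Z}+i\beta\mathbb{Z}\subset\mathbb{C}$ is a uniqueness set for $\delta A^2_{n+1}$, i.e. the only $F\in\delta A^2_{n+1}$ vanishing at every point of the lattice is $F=0$. (2) For arbitrary $\alpha,\beta>0$ (with no condition on $\alpha\beta$) the two properties are equivalent: $\mathcal{G}(h_n,\alpha,\beta)$ is complete in $L^2(\mathbb{R})$ if and only if $\alpha\mathbb{Z}+i\beta\mathbb{Z}$ is a uniqueness set for $\delta A^2_{n+1}$. -/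

import Mathlib

open MeasureTheory

namespace GaborHermite

/-- Translation `T_a f (x) = f (x - a)`. -/
def translation (a : ℝ) (f : ℝ → ℂ) : ℝ → ℂ := fun x => f (x - a)

/-- Modulation `M_b f (x) = e^{2 π i b x} f (x)`. -/
noncomputable def modulation (b : ℝ) (f : ℝ → ℂ) : ℝ → ℂ :=
  fun x => Complex.exp (2 * Real.pi * Complex.I * b * x) * f x

/-- The Gabor system `{M_{β l} T_{α k} g : k, l ∈ ℤ}`. -/
def gaborSystem (g : ℝ → ℂ) (α β : ℝ) : Set (ℝ → ℂ) :=
  {f | ∃ k l : ℤ, f = modulation (β * l) (translation (α * k) g)}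

/-- A set of functions is complete in `L²(ℝ)` if it consists of square-integrable functions and
the complex linear span of their classes is dense in `L²(ℝ)`. -/
def IsCompleteL2 (S : Set (ℝ → ℂ)) : Prop :=
  (∀ f ∈ S, MemLp f 2 (volume : Measure ℝ)) ∧
    Dense (Submodule.span ℂ
      {F : Lp ℂ 2 (volume : Measure ℝ) | ∃ f ∈ S, F =ᵐ[volume] f} :
        Set (Lp ℂ 2 (volume : Measure ℝ)))

/-- The Hermite function `h_n (x) = e^{π x²} (d/dx)^n e^{-2 π x²}`. -/
noncomputable def hermiteFun (n : ℕ) : ℝ → ℂ := fun x =>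
  ((Real.exp (Real.pi * x ^ 2) *
    iteratedDeriv n (fun t : ℝ => Real.exp (-2 * Real.pi * t ^ 2)) x : ℝ) : ℂ)

/-- The Wirtinger operator `∂̄ = (∂_x + i ∂_y) / 2`. -/
noncomputable def dbar (f : ℂ → ℂ) : ℂ → ℂ := fun z =>
  (1 / 2 : ℂ) * (fderiv ℝ f z 1 + Complex.I * fderiv ℝ f z Complex.I)

/-- The polyanalytic Bargmann-Fock space `A²_n`: the functions `f` of class `C^n` on the plane
with `∂̄^n f = 0` and `∫ |f(z)|² e^{-π |z|²} dA(z) < ∞`. -/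
def polyFock (n : ℕ) : Set (ℂ → ℂ) :=
  {f | ContDiff ℝ n f ∧ dbar^[n] f = 0 ∧
    Integrable (fun z : ℂ => ‖f z‖ ^ 2 * Real.exp (-Real.pi * ‖z‖ ^ 2)) volume}

/-- The true polyanalytic Bargmann-Fock space `δA²_n = A²_n ⊖ A²_{n-1}` for `n ≥ 1`: the
elements of `A²_n` orthogonal to `A²_{n-1}` for the inner product
`⟨f, g⟩ = ∫ f(z) conj(g(z)) e^{-π |z|²} dA(z)`. -/
def truePolyFock (n : ℕ) : Set (ℂ → ℂ) :=
  {f | f ∈ polyFock n ∧ ∀ g ∈ polyFock (n - 1),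
    ∫ z : ℂ, f z * (starRingEnd ℂ) (g z) * (Real.exp (-Real.pi * ‖z‖ ^ 2) : ℂ) = 0}

/-- The lattice `α ℤ × β ℤ`, as the subset `α ℤ + i β ℤ` of the complex plane. -/
def rectLattice (α β : ℝ) : Set ℂ :=
  {z | ∃ k l : ℤ, z = ((α * k : ℝ) : ℂ) + Complex.I * ((β * l : ℝ) : ℂ)}

/-- `Λ` is a uniqueness set for the linear space `V` of functions: the only element of `V`
that vanishes on `Λ` is zero. -/
def IsUniquenessSet (Λ : Set ℂ) (V : Set (ℂ → ℂ)) : Prop :=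
  ∀ F ∈ V, (∀ z ∈ Λ, F z = 0) → F = 0

end GaborHermite

namespace GaborHermite
open Polynomial

/-! ### Gaussian domination -/

/-! The equivalence. Up to a zero-free factor, the order `n` polyanalytic Bargmann transform
`polyBargmann n f` is the short-time Fourier transform of `f` with window `h_n`. Hence `f` is
orthogonal to the Gabor system iff its transform vanishes on the lattice (`isCompleteL2_iff`). By
Plancherel the transforms of different orders have orthogonal ranges, and each is a multiple of an
isometry (`integral_polyBargmann_mul_conj`). An element of `A²_m` orthogonal to the ranges of orders
`< m` is orthogonal to all `conj z ^ j * z ^ k` with `j < m`, hence zero by integration in polar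
coordinates (`IsPolyanalytic.eq_zero_of_orthogonal`). So the transform of order `n` maps `L²(ℝ)`
onto `δA²_{n+1}` (`mem_truePolyFock_iff`), and completeness is the same as uniqueness.

Completeness for `αβ = p/q ≤ 1`. Put `b = 1/β`, so `α = b p / q`. Vanishing at all modulations says
that, for each `k` and almost every `t`, `∑ j, f(b(t+j)) h_n(b(t+j) - αk) = 0`. Splitting `j` modulo
`p` and `k` modulo `q` makes this a convolution system on `ℓ²(ℤ)` whose symbol is the `q × p` matrix
`zakMatrix` at `x = b t`. It suffices that this symbol is injective for almost all `(x, ξ)`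
(`ae_ae_zakMatrix_injective`).

Let `A` be the adjoint of the matrix of the pure Gaussian at `x = 0`. The determinant of `A *
zakMatrix` is entire in `x`, so one nonzero value suffices. Along suitable points `x = i/ε`, `ε →
0`, the polynomial factor is dominated by its leading term and the renormalized matrix tends to a
nonzero multiple of the Gaussian one. The Gaussian matrix is injective by
`eq_zero_of_gaussian_series`: a bounded sequence on `ℤ` annihilated by the Gaussians centred at
`θk`, `θ ≤ 1`, is zero. There, finitely many equations are combined to cancel the terms at distance
`1, ..., N` from a given index, and the growth of the remaining central coefficient beats the tails.
-/

lemma pow_mul_exp_le_exp_sq (a : ℕ) (R : ℝ) {ε : ℝ} (hε : 0 < ε) :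
    ∃ C : ℝ, 0 < C ∧ ∀ t : ℝ, 0 ≤ t → t ^ a * Real.exp (R * t) ≤ C * Real.exp (ε * t ^ 2) := by
  -- The factor `a!` comes from `t ^ a ≤ a! * exp t`, the exponential from completing the square in
  -- `(R + 1) t - ε t²`.
  refine ⟨a.factorial * Real.exp ((R + 1) ^ 2 / (4 * ε)), by positivity, fun t ht => ?_⟩
  have h1 : t ^ a ≤ a.factorial * Real.exp t := by
    have := Real.pow_div_factorial_le_exp t ht a
    rw [div_le_iff₀ (by positivity)] at this
    linarith
  have h2 : (R + 1) * t ≤ (R + 1) ^ 2 / (4 * ε) + ε * t ^ 2 := by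
    have : 0 ≤ (2 * ε * t - (R + 1)) ^ 2 / (4 * ε) := by positivity
    have h3 : (2 * ε * t - (R + 1)) ^ 2 / (4 * ε)
        = (R + 1) ^ 2 / (4 * ε) + ε * t ^ 2 - (R + 1) * t := by
      field_simp; ring
    linarith
  calc t ^ a * Real.exp (R * t) ≤ a.factorial * Real.exp t * Real.exp (R * t) := by gcongr
    _ = a.factorial * Real.exp ((R + 1) * t) := by
      rw [mul_assoc, ← Real.exp_add]; ring_nf
    _ ≤ a.factorial * Real.exp ((R + 1) ^ 2 / (4 * ε) + ε * t ^ 2) := by gcongr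
    _ = _ := by rw [Real.exp_add]; ring

lemma norm_eval_le_exp_sq (P : ℂ[X]) {ε : ℝ} (hε : 0 < ε) :
    ∃ C : ℝ, 0 < C ∧ ∀ z : ℂ, ‖P.eval z‖ ≤ C * Real.exp (ε * ‖z‖ ^ 2) := by
  induction P using Polynomial.induction_on' with
  | add p q hp hq =>
    obtain ⟨C, hC, h⟩ := hp
    obtain ⟨D, hD, h'⟩ := hq
    refine ⟨C + D, by positivity, fun z => ?_⟩
    rw [eval_add, add_mul]
    exact (norm_add_le _ _).trans (add_le_add (h z) (h' z))
  | monomial n a =>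
    obtain ⟨C, hC, h⟩ := pow_mul_exp_le_exp_sq n 0 hε
    refine ⟨(‖a‖ + 1) * C, by positivity, fun z => ?_⟩
    have := h ‖z‖ (norm_nonneg _)
    simp only [zero_mul, Real.exp_zero, mul_one] at this
    rw [eval_monomial, norm_mul, norm_pow, mul_assoc]
    gcongr
    linarith

/-! ### Hermite polynomials for the weight `exp (-2 π x ^ 2)` -/

/-- The real polynomials `H` with `(d/dx)^n exp (-2 π x²) = H_n(x) exp (-2 π x²)`. -/
noncomputable def hermiteR : ℕ → ℝ[X]
  | 0 => 1
  | n + 1 => derivative (hermiteR n) - C (4 * Real.pi) * X * hermiteR n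

/-- The polynomials `hermiteR`, with complex coefficients. -/
noncomputable def hermiteC (n : ℕ) : ℂ[X] := (hermiteR n).map (algebraMap ℝ ℂ)

lemma iteratedDeriv_gaussian (n : ℕ) :
    iteratedDeriv n (fun t : ℝ => Real.exp (-2 * Real.pi * t ^ 2)) =
      fun x => (hermiteR n).eval x * Real.exp (-2 * Real.pi * x ^ 2) := by
  induction n with
  | zero => ext x; simp [hermiteR]
  | succ n ih =>
    rw [iteratedDeriv_succ, ih]
    ext x
    have h1 : HasDerivAt (fun x : ℝ => Real.exp (-2 * Real.pi * x ^ 2))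
        (Real.exp (-2 * Real.pi * x ^ 2) * (-2 * Real.pi * (2 * x))) x := by
      have := ((hasDerivAt_pow 2 x).const_mul (-2 * Real.pi)).exp
      simpa using this
    refine ((hermiteR n).hasDerivAt x |>.mul h1).deriv.trans ?_
    simp [hermiteR]
    ring

lemma hermiteFun_eq_ofReal (n : ℕ) (x : ℝ) :
    hermiteFun n x = (((hermiteR n).eval x * Real.exp (-Real.pi * x ^ 2) : ℝ) : ℂ) := by
  rw [hermiteFun, iteratedDeriv_gaussian]
  congr 1
  rw [mul_left_comm, ← Real.exp_add]
  ring_nf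

lemma hermiteC_eval_ofReal (n : ℕ) (x : ℝ) :
    (hermiteC n).eval (x : ℂ) = (((hermiteR n).eval x : ℝ) : ℂ) := by
  have := Polynomial.eval_map_apply (algebraMap ℝ ℂ) x (p := hermiteR n)
  simpa [hermiteC] using this

lemma hermiteFun_eq (n : ℕ) (x : ℝ) :
    hermiteFun n x = (hermiteC n).eval (x : ℂ) * Complex.exp (-Real.pi * x ^ 2) := by
  rw [hermiteFun_eq_ofReal, hermiteC_eval_ofReal]
  push_cast
  rfl

lemma conj_hermiteFun (n : ℕ) (x : ℝ) :
    (starRingEnd ℂ) (hermiteFun n x) = hermiteFun n x := Complex.conj_ofReal _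

/-- The degree bound gives orthogonality of the Hermite functions. The nonzero leading coefficient
isolates the `conj z ^ n` term of the Bargmann transform and survives in the limit of the Zak
matrices. -/
lemma natDegree_hermiteR (n : ℕ) :
    (hermiteR n).natDegree ≤ n ∧ (hermiteR n).coeff n = (-(4 * Real.pi)) ^ n := by
  induction n with
  | zero => simp [hermiteR]
  | succ n ih =>
    obtain ⟨h1, h2⟩ := ih
    constructor
    · rw [hermiteR]
      refine (natDegree_sub_le _ _).trans (max_le ?_ ?_)
      · exact (natDegree_derivative_le _).trans (by omega)
      · refine natDegree_mul_le.trans ?_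
        have : (C (4 * Real.pi) * X : ℝ[X]).natDegree ≤ 1 := (natDegree_C_mul_le _ _).trans natDegree_X_le
        omega
    · rw [hermiteR, coeff_sub, mul_assoc, coeff_C_mul, coeff_X_mul, h2, coeff_derivative,
        coeff_eq_zero_of_natDegree_lt (by omega : (hermiteR n).natDegree < n + 1 + 1)]
      ring

lemma hermiteC_natDegree_le (n : ℕ) : (hermiteC n).natDegree ≤ n :=
  natDegree_map_le.trans (natDegree_hermiteR n).1

lemma hermiteC_coeff (n : ℕ) : (hermiteC n).coeff n = (-(4 * Real.pi)) ^ n := by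
  rw [hermiteC, coeff_map, (natDegree_hermiteR n).2]; simp

lemma hermiteC_coeff_ne_zero (n : ℕ) : (hermiteC n).coeff n ≠ 0 := by
  rw [hermiteC_coeff]
  exact pow_ne_zero _ (by simp [Real.pi_ne_zero])

lemma continuous_hermiteFun (n : ℕ) : Continuous (hermiteFun n) := by
  have : hermiteFun n = fun x : ℝ =>
      (((hermiteR n).eval x * Real.exp (-Real.pi * x ^ 2) : ℝ) : ℂ) :=
    funext (hermiteFun_eq_ofReal n)
  rw [this]
  fun_prop

lemma norm_hermiteFun_le (n : ℕ) : ∃ C : ℝ, 0 < C ∧ ∀ x : ℝ,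
    ‖hermiteFun n x‖ ≤ C * Real.exp (-(Real.pi / 2) * x ^ 2) := by
  obtain ⟨C, hC, h⟩ := norm_eval_le_exp_sq (hermiteC n) (half_pos Real.pi_pos)
  refine ⟨C, hC, fun x => ?_⟩
  rw [hermiteFun_eq, norm_mul]
  have h1 : ‖Complex.exp (-Real.pi * x ^ 2)‖ = Real.exp (-Real.pi * x ^ 2) := by
    rw [Complex.norm_exp]; congr 1
    norm_cast
  rw [h1]
  refine (mul_le_mul_of_nonneg_right (h x) (Real.exp_pos _).le).trans_eq ?_
  rw [mul_assoc, ← Real.exp_add, Complex.norm_real, Real.norm_eq_abs, sq_abs]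
  ring_nf

lemma memLp_exp_neg_mul_sq {c : ℝ} (hc : 0 < c) :
    MemLp (fun t : ℝ => Real.exp (-c * t ^ 2)) 2 volume := by
  rw [memLp_two_iff_integrable_sq (by fun_prop)]
  refine (integrable_exp_neg_mul_sq (mul_pos two_pos hc)).congr (.of_forall fun t => ?_)
  simp only
  rw [← Real.exp_nat_mul]
  push_cast; ring_nf

lemma memLp_hermiteFun (n : ℕ) : MemLp (hermiteFun n) 2 volume := by
  obtain ⟨C, hC, h⟩ := norm_hermiteFun_le n
  refine ((memLp_exp_neg_mul_sq (half_pos Real.pi_pos)).const_mul C).mono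
    (continuous_hermiteFun n).aestronglyMeasurable (.of_forall fun x => ?_)
  rw [Real.norm_of_nonneg (by positivity)]
  exact h x

lemma integrable_polynomial_mul_gaussian (P : ℝ[X]) {c : ℝ} (hc : 0 < c) :
    Integrable (fun x : ℝ => P.eval x * Real.exp (-c * x ^ 2)) := by
  induction P using Polynomial.induction_on' with
  | add p q hp hq =>
    refine (hp.add hq).congr (.of_forall fun x => ?_)
    simp [add_mul]
  | monomial n a =>
    have := (integrable_rpow_mul_exp_neg_mul_sq hc (s := n)
      (by have := n.cast_nonneg (α := ℝ); linarith)).const_mul a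
    refine this.congr (.of_forall fun x => ?_)
    simp [mul_assoc]

/-- Integration by parts: `hermiteR (n + 1)` times the weight is the derivative of `hermiteR n`
times the weight. -/
lemma integral_hermiteR_step (P : ℝ[X]) (n : ℕ) :
    ∫ x : ℝ, (P * hermiteR (n + 1)).eval x * Real.exp (-(2 * Real.pi) * x ^ 2) =
      - ∫ x : ℝ, (derivative P * hermiteR n).eval x * Real.exp (-(2 * Real.pi) * x ^ 2) := by
  have hpi : 0 < 2 * Real.pi := by positivity
  rw [eq_neg_iff_add_eq_zero, ← integral_add (integrable_polynomial_mul_gaussian _ hpi)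
    (integrable_polynomial_mul_gaussian _ hpi)]
  refine integral_eq_zero_of_hasDerivAt_of_integrable
    (f := fun x : ℝ => (P * hermiteR n).eval x * Real.exp (-(2 * Real.pi) * x ^ 2)) (fun x => ?_)
    ((integrable_polynomial_mul_gaussian _ hpi).add (integrable_polynomial_mul_gaussian _ hpi))
    (integrable_polynomial_mul_gaussian _ hpi)
  have h1 : HasDerivAt (fun x : ℝ => Real.exp (-(2 * Real.pi) * x ^ 2))
      (Real.exp (-(2 * Real.pi) * x ^ 2) * (-(2 * Real.pi) * (2 * x))) x := by
    have := ((hasDerivAt_pow 2 x).const_mul (-(2 * Real.pi))).exp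
    simpa using this
  refine ((P * hermiteR n).hasDerivAt x |>.mul h1).congr_deriv ?_
  simp [hermiteR]
  ring

lemma integral_hermiteR_eq_zero (n : ℕ) (P : ℝ[X]) (hP : derivative^[n] P = 0) :
    ∫ x : ℝ, (P * hermiteR n).eval x * Real.exp (-(2 * Real.pi) * x ^ 2) = 0 := by
  induction n generalizing P with
  | zero =>
    simp only [Function.iterate_zero, id_eq] at hP
    simp [hP]
  | succ n ih =>
    rw [integral_hermiteR_step, ih _ (by simpa using hP), neg_zero]

lemma hermiteFun_mul (n m : ℕ) (x : ℝ) : hermiteFun n x * hermiteFun m x =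
    (((hermiteR n * hermiteR m).eval x * Real.exp (-(2 * Real.pi) * x ^ 2) : ℝ) : ℂ) := by
  rw [hermiteFun_eq_ofReal, hermiteFun_eq_ofReal, ← Complex.ofReal_mul]
  congr 1
  rw [eval_mul, mul_mul_mul_comm, ← Real.exp_add]
  ring_nf

lemma integral_hermiteFun_mul_of_ne {n m : ℕ} (hnm : n ≠ m) :
    ∫ x : ℝ, hermiteFun n x * hermiteFun m x = 0 := by
  wlog h : n < m generalizing n m
  · simp_rw [mul_comm (hermiteFun n _)]
    exact this hnm.symm (by omega)
  simp_rw [hermiteFun_mul]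
  rw [integral_complex_ofReal, integral_hermiteR_eq_zero, Complex.ofReal_zero]
  exact iterate_derivative_eq_zero ((natDegree_hermiteR n).1.trans_lt h)

lemma integral_hermiteFun_sq_ne_zero (n : ℕ) :
    ∫ x : ℝ, hermiteFun n x * hermiteFun n x ≠ 0 := by
  simp_rw [hermiteFun_mul]
  rw [integral_complex_ofReal, Complex.ofReal_ne_zero]
  refine (integral_pos_of_integrable_nonneg_nonzero (x := ?_) (by fun_prop)
    (integrable_polynomial_mul_gaussian _ (by positivity)) (fun x => ?_) ?_).ne'
  -- A real number that is not a root; the integrand is strictly positive there.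
  · exact (Infinite.exists_notMem_finset (hermiteR n).roots.toFinset).choose
  · have := mul_self_nonneg ((hermiteR n).eval x)
    simp only [eval_mul, Pi.zero_apply]
    positivity
  · have h := (Infinite.exists_notMem_finset (hermiteR n).roots.toFinset).choose_spec
    have h0 : hermiteR n ≠ 0 := fun h0 => by
      have := (natDegree_hermiteR n).2
      rw [h0, coeff_zero] at this
      exact pow_ne_zero n (neg_ne_zero.mpr (by positivity)) this.symm
    rw [Multiset.mem_toFinset, mem_roots h0] at h
    have h2 : (hermiteR n).eval
      (Infinite.exists_notMem_finset (hermiteR n).roots.toFinset).choose ≠ 0 := h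
    rw [eval_mul]
    positivity

end GaborHermite

namespace GaborHermite
open ComplexConjugate

/-! ### Polyanalytic functions -/

/-- `f` is polyanalytic of order `m`: a polynomial of degree `< m` in `conj z` with entire
coefficients. -/
def IsPolyanalytic (m : ℕ) (f : ℂ → ℂ) : Prop :=
  ∃ φ : ℕ → ℂ → ℂ, (∀ j, Differentiable ℂ (φ j)) ∧
    f = fun z => ∑ j ∈ Finset.range m, conj z ^ j * φ j z

lemma dbar_sub {f g : ℂ → ℂ} {z : ℂ} (hf : DifferentiableAt ℝ f z) (hg : DifferentiableAt ℝ g z) :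
    dbar (fun w => f w - g w) z = dbar f z - dbar g z := by
  simp only [dbar, fderiv_fun_sub hf hg, _root_.sub_apply]
  ring

lemma dbar_sum {ι : Type*} (s : Finset ι) {f : ι → ℂ → ℂ} {z : ℂ}
    (hf : ∀ i ∈ s, DifferentiableAt ℝ (f i) z) :
    dbar (fun w => ∑ i ∈ s, f i w) z = ∑ i ∈ s, dbar (f i) z := by
  simp only [dbar, fderiv_fun_sum hf, _root_.sum_apply]
  rw [Finset.mul_sum, ← Finset.sum_add_distrib, Finset.mul_sum]

lemma dbar_mul {f g : ℂ → ℂ} {z : ℂ} (hf : DifferentiableAt ℝ f z) (hg : DifferentiableAt ℝ g z) :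
    dbar (fun w => f w * g w) z = f z * dbar g z + dbar f z * g z := by
  simp only [dbar, fderiv_fun_mul hf hg, _root_.add_apply,
    _root_.smul_apply, smul_eq_mul]
  ring

lemma dbar_of_differentiableAt {f : ℂ → ℂ} {z : ℂ} (hf : DifferentiableAt ℂ f z) :
    dbar f z = 0 := by
  have h := (differentiableAt_complex_iff_differentiableAt_real.1 hf).2
  rw [dbar, h, smul_eq_mul, ← mul_assoc, Complex.I_mul_I]
  ring

lemma differentiableAt_of_dbar {f : ℂ → ℂ} {z : ℂ} (hf : DifferentiableAt ℝ f z)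
    (h : dbar f z = 0) : DifferentiableAt ℂ f z := by
  refine differentiableAt_complex_iff_differentiableAt_real.2 ⟨hf, ?_⟩
  have h1 : fderiv ℝ f z 1 + Complex.I * fderiv ℝ f z Complex.I = 0 := by
    simpa [dbar] using h
  have h2 := congrArg (fun w => -Complex.I * w) h1
  simp only [mul_add, ← mul_assoc, mul_zero, neg_mul, Complex.I_mul_I] at h2
  rw [smul_eq_mul]
  linear_combination h2

lemma contDiff_conj_complex {n : WithTop ℕ∞} : ContDiff ℝ n (fun z : ℂ => conj z) :=
  Complex.conjCLE.contDiff

lemma dbar_conj (z : ℂ) : dbar (fun w => conj w) z = 1 := by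
  have : fderiv ℝ (fun w : ℂ => conj w) z = (Complex.conjCLE : ℂ →L[ℝ] ℂ) :=
    Complex.conjCLE.hasFDerivAt.fderiv
  rw [dbar, this]
  simp
  norm_num

lemma dbar_conj_pow (n : ℕ) (z : ℂ) :
    dbar (fun w => conj w ^ (n + 1)) z = (n + 1) * conj z ^ n := by
  have hd : ∀ k : ℕ, DifferentiableAt ℝ (fun w : ℂ => conj w ^ k) z := fun k =>
    ((contDiff_conj_complex (n := 1)).pow k).differentiable one_ne_zero z
  induction n with
  | zero => simpa using dbar_conj z
  | succ n ih =>
    simp_rw [pow_succ _ (n + 1)]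
    rw [dbar_mul (hd _) (by simpa using hd 1), ih, dbar_conj]
    push_cast; ring

lemma contDiff_conj_pow_mul {φ : ℂ → ℂ} (hφ : Differentiable ℂ φ) (j : ℕ) {n : WithTop ℕ∞} :
    ContDiff ℝ n (fun z => conj z ^ j * φ z) :=
  (contDiff_conj_complex.pow j).mul (hφ.contDiff.restrict_scalars ℝ)

lemma dbar_conj_pow_mul {φ : ℂ → ℂ} (hφ : Differentiable ℂ φ) (j : ℕ) (z : ℂ) :
    dbar (fun z => conj z ^ (j + 1) * φ z) z = conj z ^ j * ((j + 1) * φ z) := by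
  rw [dbar_mul (((contDiff_conj_complex (n := 1)).pow _).differentiable one_ne_zero z)
    ((hφ z).restrictScalars ℝ), dbar_of_differentiableAt (hφ z), dbar_conj_pow]
  ring

namespace IsPolyanalytic

lemma contDiff {m : ℕ} {f : ℂ → ℂ} (hf : IsPolyanalytic m f) {n : WithTop ℕ∞} :
    ContDiff ℝ n f := by
  obtain ⟨φ, hφ, rfl⟩ := hf
  exact ContDiff.sum fun j _ => contDiff_conj_pow_mul (hφ j) j

lemma continuous {m : ℕ} {f : ℂ → ℂ} (hf : IsPolyanalytic m f) : Continuous f :=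
  (hf.contDiff (n := 0)).continuous

lemma dbar {m : ℕ} {f : ℂ → ℂ} (hf : IsPolyanalytic (m + 1) f) : IsPolyanalytic m (dbar f) := by
  obtain ⟨φ, hφ, rfl⟩ := hf
  refine ⟨fun j z => (j + 1) * φ (j + 1) z, fun j => (hφ _).const_mul _, ?_⟩
  ext z
  have hd : ∀ j, DifferentiableAt ℝ (fun z => conj z ^ j * φ j z) z := fun j =>
    (contDiff_conj_pow_mul (n := 1) (hφ j) j).differentiable one_ne_zero z
  rw [dbar_sum _ fun j _ => hd j, Finset.sum_range_succ']
  have h0 : GaborHermite.dbar (fun w => conj w ^ 0 * φ 0 w) z = 0 := by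
    simpa using dbar_of_differentiableAt (hφ 0 z)
  rw [h0, add_zero]
  exact Finset.sum_congr rfl fun j _ => dbar_conj_pow_mul (hφ _) j z

lemma dbar_iterate {m : ℕ} {f : ℂ → ℂ} (hf : IsPolyanalytic m f) :
    GaborHermite.dbar^[m] f = 0 := by
  induction m generalizing f with
  | zero =>
    obtain ⟨φ, -, rfl⟩ := hf
    ext z; simp
  | succ m ih => exact ih hf.dbar

/-- Integrate the representation of `dbar f` once in `conj z`: the resulting `G` satisfies `dbar G =
dbar f`, so `f - G` is entire and becomes the coefficient of `conj z ^ 0`. -/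
lemma of_dbar_iterate {m : ℕ} {f : ℂ → ℂ} (hf : ContDiff ℝ m f)
    (h : GaborHermite.dbar^[m] f = 0) : IsPolyanalytic m f := by
  induction m generalizing f with
  | zero =>
    refine ⟨fun _ _ => 0, fun _ => differentiable_const _, ?_⟩
    simp only [Function.iterate_zero, id_eq] at h
    ext z; simp [h]
  | succ m ih =>
    have hfd : Differentiable ℝ f := hf.differentiable (by simp)
    have h1 : ContDiff ℝ m (GaborHermite.dbar f) := by
      have h2 : ContDiff ℝ m (fderiv ℝ f) := hf.fderiv_right (by simp)
      exact contDiff_const.mul ((h2.clm_apply contDiff_const).add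
        (contDiff_const.mul (h2.clm_apply contDiff_const)))
    obtain ⟨φ, hφ, hfφ⟩ := ih h1 h
    have hψ : ∀ j : ℕ, Differentiable ℂ (fun z => ((j : ℂ) + 1)⁻¹ * φ j z) :=
      fun j => (hφ j).const_mul _
    set G : ℂ → ℂ := fun z => ∑ j ∈ Finset.range m, conj z ^ (j + 1) * (((j : ℂ) + 1)⁻¹ * φ j z)
      with hG
    have hd : ∀ (j : ℕ) (z : ℂ), DifferentiableAt ℝ
        (fun z => conj z ^ (j + 1) * (((j : ℂ) + 1)⁻¹ * φ j z)) z := fun j z =>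
      (contDiff_conj_pow_mul (n := 1) (hψ j) (j + 1)).differentiable one_ne_zero z
    have hGd : Differentiable ℝ G := fun z => DifferentiableAt.fun_sum fun j _ => hd j z
    have hdG : ∀ z, GaborHermite.dbar G z = GaborHermite.dbar f z := fun z => by
      rw [hG, dbar_sum _ fun j _ => hd j z, hfφ]
      simp only
      refine Finset.sum_congr rfl fun j _ => ?_
      rw [dbar_conj_pow_mul (hψ j)]
      have : (j : ℂ) + 1 ≠ 0 := by exact_mod_cast j.succ_ne_zero
      field_simp
    have hent : Differentiable ℂ (fun z => f z - G z) := fun z =>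
      differentiableAt_of_dbar ((hfd z).sub (hGd z)) (by
        rw [dbar_sub (hfd z) (hGd z), hdG, sub_self])
    refine ⟨fun j => Nat.casesOn j (fun z => f z - G z)
      (fun j z => ((j : ℂ) + 1)⁻¹ * φ j z), fun j => ?_, ?_⟩
    · cases j
      · exact hent
      · exact hψ _
    · ext z
      rw [Finset.sum_range_succ']
      simp [hG]

lemma add {m : ℕ} {f g : ℂ → ℂ} (hf : IsPolyanalytic m f) (hg : IsPolyanalytic m g) :
    IsPolyanalytic m (fun z => f z + g z) := by
  obtain ⟨φ, hφ, rfl⟩ := hf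
  obtain ⟨ψ, hψ, rfl⟩ := hg
  refine ⟨fun j z => φ j z + ψ j z, fun j => (hφ j).add (hψ j), ?_⟩
  ext z
  rw [← Finset.sum_add_distrib]
  exact Finset.sum_congr rfl fun j _ => by ring

lemma mul_differentiable {m : ℕ} {f g : ℂ → ℂ} (hf : IsPolyanalytic m f)
    (hg : Differentiable ℂ g) : IsPolyanalytic m (fun z => f z * g z) := by
  obtain ⟨φ, hφ, rfl⟩ := hf
  refine ⟨fun j z => φ j z * g z, fun j => (hφ j).mul hg, ?_⟩
  ext z
  rw [Finset.sum_mul]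
  exact Finset.sum_congr rfl fun j _ => by ring

lemma mono {m k : ℕ} (hmk : m ≤ k) {f : ℂ → ℂ} (hf : IsPolyanalytic m f) :
    IsPolyanalytic k f := by
  obtain ⟨φ, hφ, rfl⟩ := hf
  refine ⟨fun j z => if j < m then φ j z else 0, fun j => ?_, ?_⟩
  · by_cases h : j < m
    · simpa [h] using hφ j
    · simp [h]
  · ext z
    rw [← Finset.sum_subset (Finset.range_mono hmk)]
    · refine Finset.sum_congr rfl fun j hj => ?_
      simp [Finset.mem_range.1 hj]
    · intro j _ hj
      have : ¬ j < m := by simpa using hj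
      simp [this]

lemma zero (m : ℕ) : IsPolyanalytic m (fun _ => 0) :=
  ⟨fun _ _ => 0, fun _ => differentiable_const _, by ext z; simp⟩

lemma sum {ι : Type*} (s : Finset ι) {m : ℕ} {f : ι → ℂ → ℂ}
    (hf : ∀ i ∈ s, IsPolyanalytic m (f i)) : IsPolyanalytic m (fun z => ∑ i ∈ s, f i z) := by
  classical
  induction s using Finset.induction_on with
  | empty => simpa using zero m
  | insert a s ha ih =>
    simp_rw [Finset.sum_insert ha]
    exact (hf a (by simp)).add (ih fun i hi => hf i (by simp [hi]))

lemma conj_pow_mul {φ : ℂ → ℂ} (hφ : Differentiable ℂ φ) (j : ℕ) :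
    IsPolyanalytic (j + 1) (fun z => conj z ^ j * φ z) := by
  refine ⟨fun i z => if i = j then φ z else 0, fun i => ?_, ?_⟩
  · by_cases h : i = j
    · simpa [h] using hφ
    · simp [h]
  · ext z
    rw [Finset.sum_eq_single j]
    · simp
    · intro i _ hij; simp [hij]
    · simp

lemma const_mul {m : ℕ} {f : ℂ → ℂ} (c : ℂ) (hf : IsPolyanalytic m f) :
    IsPolyanalytic m (fun z => c * f z) := by
  simpa [mul_comm] using hf.mul_differentiable (differentiable_const c)

end IsPolyanalytic

lemma mem_polyFock_iff {m : ℕ} {f : ℂ → ℂ} : f ∈ polyFock m ↔ IsPolyanalytic m f ∧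
    Integrable (fun z : ℂ => ‖f z‖ ^ 2 * Real.exp (-Real.pi * ‖z‖ ^ 2)) volume :=
  ⟨fun h => ⟨.of_dbar_iterate h.1 h.2.1, h.2.2⟩,
    fun h => ⟨h.1.contDiff, h.1.dbar_iterate, h.2⟩⟩

end GaborHermite

namespace GaborHermite
open ComplexConjugate Polynomial

/-! ### Gaussian moments and the polyanalytic Bargmann transform -/

/-- `∫ f(t) t^a exp(-π t² + 2 π t z) dt`. -/
noncomputable def gaussMoment (a : ℕ) (f : ℝ → ℂ) (z : ℂ) : ℂ :=
  ∫ t : ℝ, f t * ((t : ℂ) ^ a * Complex.exp (-Real.pi * t ^ 2 + 2 * Real.pi * t * z))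

/-- The (true) polyanalytic Bargmann transform of order `n`. -/
noncomputable def polyBargmann (n : ℕ) (f : ℝ → ℂ) (z : ℂ) : ℂ :=
  ∫ t : ℝ, f t * ((hermiteC n).eval ((t : ℂ) - z.re) *
    Complex.exp (-Real.pi * t ^ 2 + 2 * Real.pi * t * z - Real.pi * z ^ 2 / 2))

lemma norm_cexp_moment (t : ℝ) (z : ℂ) :
    ‖Complex.exp (-Real.pi * t ^ 2 + 2 * Real.pi * t * z)‖ =
      Real.exp (-Real.pi * t ^ 2 + 2 * Real.pi * t * z.re) := by
  rw [Complex.norm_exp]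
  congr 1
  have : (-Real.pi * t ^ 2 + 2 * Real.pi * t * z : ℂ) =
    ((-Real.pi * t ^ 2 : ℝ) : ℂ) + ((2 * Real.pi * t : ℝ) : ℂ) * z := by push_cast; ring
  rw [this, Complex.add_re, Complex.re_ofReal_mul, Complex.ofReal_re]

/-- Since the bound is uniform for `z` in a disc, it serves both for integrability and for
differentiation under the integral sign. -/
lemma exists_moment_bound (a : ℕ) (R : ℝ) : ∃ C : ℝ, 0 < C ∧ ∀ (t : ℝ) (z : ℂ), ‖z‖ ≤ R →
    ‖(t : ℂ) ^ a * Complex.exp (-Real.pi * t ^ 2 + 2 * Real.pi * t * z)‖ ≤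
      C * Real.exp (-(Real.pi / 2) * t ^ 2) := by
  obtain ⟨C, hC, h⟩ := pow_mul_exp_le_exp_sq a (2 * Real.pi * R) (half_pos Real.pi_pos)
  refine ⟨C, hC, fun t z hz => ?_⟩
  rw [norm_mul, norm_pow, Complex.norm_real, norm_cexp_moment, Real.norm_eq_abs]
  have h1 := h |t| (abs_nonneg t)
  have h2 : 2 * Real.pi * t * z.re ≤ 2 * Real.pi * R * |t| := by
    have : t * z.re ≤ |t| * R := (le_abs_self _).trans (by
      rw [abs_mul]; gcongr; exact (Complex.abs_re_le_norm z).trans hz)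
    have hpi := Real.pi_pos
    nlinarith
  calc |t| ^ a * Real.exp (-Real.pi * t ^ 2 + 2 * Real.pi * t * z.re)
      ≤ |t| ^ a * Real.exp (-Real.pi * t ^ 2 + 2 * Real.pi * R * |t|) := by gcongr
    _ = (|t| ^ a * Real.exp (2 * Real.pi * R * |t|)) * Real.exp (-Real.pi * t ^ 2) := by
      rw [Real.exp_add]; ring
    _ ≤ (C * Real.exp (Real.pi / 2 * |t| ^ 2)) * Real.exp (-Real.pi * t ^ 2) := by gcongr
    _ = _ := by
      rw [mul_assoc, ← Real.exp_add, sq_abs]; ring_nf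

lemma integrable_norm_mul_gaussian {f : ℝ → ℂ} (hf : MemLp f 2 volume) (C : ℝ) :
    Integrable (fun t : ℝ => ‖f t‖ * (C * Real.exp (-(Real.pi / 2) * t ^ 2))) := by
  have := (hf.norm).integrable_mul
    ((memLp_exp_neg_mul_sq (half_pos Real.pi_pos)).const_mul C)
  exact this

lemma integrable_moment {f : ℝ → ℂ} (hf : MemLp f 2 volume) (a : ℕ) (z : ℂ) :
    Integrable (fun t : ℝ =>
      f t * ((t : ℂ) ^ a * Complex.exp (-Real.pi * t ^ 2 + 2 * Real.pi * t * z))) := by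
  obtain ⟨C, hC, h⟩ := exists_moment_bound a ‖z‖
  refine (integrable_norm_mul_gaussian hf C).mono'
    (hf.aestronglyMeasurable.mul (Continuous.aestronglyMeasurable (by fun_prop)))
    (.of_forall fun t => ?_)
  rw [norm_mul]
  gcongr
  exact h t z le_rfl

/-- Differentiating under the integral brings down `2πt`. This makes the moments entire, and it also
produces the recursion for `gaussMomentPoly`. -/
lemma hasDerivAt_gaussMoment {f : ℝ → ℂ} (hf : MemLp f 2 volume) (a : ℕ) (z : ℂ) :
    HasDerivAt (gaussMoment a f) (2 * Real.pi * gaussMoment (a + 1) f z) z := by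
  obtain ⟨C, hC, h⟩ := exists_moment_bound (a + 1) (‖z‖ + 1)
  have key := hasDerivAt_integral_of_dominated_loc_of_deriv_le (μ := volume) (x₀ := z)
    (s := Metric.ball z 1)
    (F := fun z (t : ℝ) =>
      f t * ((t : ℂ) ^ a * Complex.exp (-Real.pi * t ^ 2 + 2 * Real.pi * t * z)))
    (F' := fun z (t : ℝ) => 2 * Real.pi * (f t * ((t : ℂ) ^ (a + 1) *
      Complex.exp (-Real.pi * t ^ 2 + 2 * Real.pi * t * z))))
    (bound := fun t => 2 * Real.pi * (‖f t‖ * (C * Real.exp (-(Real.pi / 2) * t ^ 2))))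
    (Metric.ball_mem_nhds z one_pos)
    (.of_forall fun w => (integrable_moment hf a w).aestronglyMeasurable)
    (integrable_moment hf a z)
    ((integrable_moment hf (a + 1) z).const_mul _).aestronglyMeasurable
    (.of_forall fun t w hw => ?_) ((integrable_norm_mul_gaussian hf C).const_mul _)
    (.of_forall fun t w hw => ?_)
  · have := key.2
    rw [integral_const_mul] at this
    exact this
  · have hw' : ‖w‖ ≤ ‖z‖ + 1 := by
      have h1 := norm_add_le z (w - z)
      rw [add_sub_cancel] at h1
      rw [mem_ball_iff_norm] at hw
      linarith
    rw [norm_mul, norm_mul (f t)]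
    have h2 : ‖(2 * Real.pi : ℂ)‖ = 2 * Real.pi := by
      have : (2 * Real.pi : ℂ) = ((2 * Real.pi : ℝ) : ℂ) := by push_cast; rfl
      rw [this, Complex.norm_real, Real.norm_of_nonneg (by positivity)]
    rw [h2]
    gcongr
    exact h t w hw'
  · have h1 : HasDerivAt (fun w : ℂ => (-Real.pi * (t : ℂ) ^ 2 + 2 * Real.pi * t * w : ℂ))
        (2 * Real.pi * t : ℂ) w := by
      have h0 := (hasDerivAt_id w).const_mul (2 * Real.pi * t : ℂ)
      rw [mul_one] at h0
      exact h0.const_add _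
    refine ((h1.cexp.const_mul ((t : ℂ) ^ a)).const_mul (f t)).congr_deriv ?_
    ring

lemma differentiable_gaussMoment {f : ℝ → ℂ} (hf : MemLp f 2 volume) (a : ℕ) :
    Differentiable ℂ (gaussMoment a f) :=
  fun z => (hasDerivAt_gaussMoment hf a z).differentiableAt

/-! ### The transform as a polynomial in `conj z`. -/

/-- The span of the functions `conj z ^ j * g z` with `j < m` and `g ∈ S`. -/
def conjPolySpan (S : Submodule ℂ (ℂ → ℂ)) (m : ℕ) : Submodule ℂ (ℂ → ℂ) :=
  Submodule.span ℂ {h | ∃ j < m, ∃ g ∈ S, h = fun z => conj z ^ j * g z}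

lemma conjPolySpan_mono (S : Submodule ℂ (ℂ → ℂ)) {m k : ℕ} (h : m ≤ k) :
    conjPolySpan S m ≤ conjPolySpan S k :=
  Submodule.span_mono fun _ ⟨j, hj, g, hg, e⟩ => ⟨j, hj.trans_le h, g, hg, e⟩

lemma conj_pow_mul_mem (S : Submodule ℂ (ℂ → ℂ)) {m j : ℕ} (hj : j < m) {g : ℂ → ℂ}
    (hg : g ∈ S) : (fun z => conj z ^ j * g z) ∈ conjPolySpan S m :=
  Submodule.subset_span ⟨j, hj, g, hg, rfl⟩

/-- Expand `(2 Re z)^k = (conj z + z)^k`: only one term has full degree `k` in `conj z`, and the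
powers of `z` in the others are absorbed by `S`. -/
lemma two_re_pow_mul_sub_mem {S : Submodule ℂ (ℂ → ℂ)}
    (hS : ∀ g ∈ S, (fun z => z * g z) ∈ S) {g : ℂ → ℂ} (hg : g ∈ S) (k : ℕ) :
    (fun z : ℂ => (2 * (z.re : ℂ)) ^ k * g z - conj z ^ k * g z) ∈ conjPolySpan S k := by
  have hpow : ∀ i : ℕ, (fun z => z ^ i * g z) ∈ S := fun i => by
    induction i with
    | zero => simpa using hg
    | succ i ih =>
      have := hS _ ih
      convert this using 2
      ring
  have : (fun z : ℂ => (2 * (z.re : ℂ)) ^ k * g z - conj z ^ k * g z) =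
      ∑ j ∈ Finset.range k, (k.choose j : ℂ) • fun z => conj z ^ j * (z ^ (k - j) * g z) := by
    ext z
    have h2 : (2 * (z.re : ℂ)) = conj z + z := by
      rw [add_comm, Complex.add_conj]; push_cast; rfl
    rw [h2, add_pow, Finset.sum_range_succ, Finset.sum_apply, add_mul, Finset.sum_mul]
    simp only [Nat.sub_self, pow_zero, mul_one, Nat.choose_self, Nat.cast_one, Pi.smul_apply,
      smul_eq_mul, add_sub_cancel_right]
    exact Finset.sum_congr rfl fun j _ => by ring
  rw [this]
  exact Submodule.sum_mem _ fun j hj => Submodule.smul_mem _ _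
    (conj_pow_mul_mem S (Finset.mem_range.1 hj) (hpow _))

lemma two_re_pow_mul_mem {S : Submodule ℂ (ℂ → ℂ)}
    (hS : ∀ g ∈ S, (fun z => z * g z) ∈ S) {g : ℂ → ℂ} (hg : g ∈ S) (k : ℕ) :
    (fun z : ℂ => (2 * (z.re : ℂ)) ^ k * g z) ∈ conjPolySpan S (k + 1) := by
  have := Submodule.add_mem _ (conjPolySpan_mono S k.le_succ (two_re_pow_mul_sub_mem hS hg k))
    (conj_pow_mul_mem S k.lt_succ_self hg)
  convert this using 2
  simp

/-- Binomial expansion of `H_n(t - Re z)`. The factors `-1/2` are there to produce powers of `2 Re z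
= z + conj z`. -/
lemma polyBargmann_eq_sum {f : ℝ → ℂ} (hf : MemLp f 2 volume) (n : ℕ) (z : ℂ) :
    polyBargmann n f z = ∑ i ∈ Finset.range (n + 1), ∑ l ∈ Finset.range (i + 1),
      ((hermiteC n).coeff i * (i.choose l) * (-1 / 2) ^ (i - l)) *
        ((2 * (z.re : ℂ)) ^ (i - l) *
          (Complex.exp (-Real.pi * z ^ 2 / 2) * gaussMoment l f z)) := by
  have h1 : ∀ t : ℝ, f t * ((hermiteC n).eval ((t : ℂ) - z.re) *
      Complex.exp (-Real.pi * t ^ 2 + 2 * Real.pi * t * z - Real.pi * z ^ 2 / 2)) =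
      ∑ i ∈ Finset.range (n + 1), ∑ l ∈ Finset.range (i + 1),
      (((hermiteC n).coeff i * (i.choose l) * (-1 / 2) ^ (i - l)) *
        ((2 * (z.re : ℂ)) ^ (i - l) * Complex.exp (-Real.pi * z ^ 2 / 2))) *
        (f t * ((t : ℂ) ^ l * Complex.exp (-Real.pi * t ^ 2 + 2 * Real.pi * t * z))) := fun t => by
    rw [eval_eq_sum_range' (n := n + 1) (Nat.lt_succ_of_le (hermiteC_natDegree_le n)),
      Finset.sum_mul, Finset.mul_sum]
    refine Finset.sum_congr rfl fun i _ => ?_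
    rw [sub_eq_add_neg (t : ℂ), add_pow, Finset.mul_sum, Finset.sum_mul, Finset.mul_sum]
    refine Finset.sum_congr rfl fun l _ => ?_
    have e1 : (-(z.re : ℂ)) ^ (i - l) = (-1 / 2) ^ (i - l) * (2 * (z.re : ℂ)) ^ (i - l) := by
      rw [← mul_pow]; ring_nf
    have e2 : Complex.exp (-Real.pi * t ^ 2 + 2 * Real.pi * t * z - Real.pi * z ^ 2 / 2) =
        Complex.exp (-Real.pi * z ^ 2 / 2) *
          Complex.exp (-Real.pi * t ^ 2 + 2 * Real.pi * t * z) := by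
      rw [← Complex.exp_add]; ring_nf
    rw [e1, e2]
    ring
  unfold polyBargmann
  simp_rw [h1]
  rw [integral_finsetSum _ fun i _ => integrable_finsetSum _ fun l _ =>
    (integrable_moment hf l z).const_mul _]
  refine Finset.sum_congr rfl fun i _ => ?_
  rw [integral_finsetSum _ fun l _ => (integrable_moment hf l z).const_mul _]
  refine Finset.sum_congr rfl fun l _ => ?_
  rw [integral_const_mul, gaussMoment]
  ring

/-- Degree `n` in `conj z` arises only from the term `(-Re z)^n` of `H_n(t - Re z)`. The space `S`
stays abstract because two choices are needed: entire functions for polyanalyticity, polynomials for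
the totality of monomials. -/
lemma polyBargmann_sub_mem {S : Submodule ℂ (ℂ → ℂ)} (hS : ∀ g ∈ S, (fun z => z * g z) ∈ S)
    {f : ℝ → ℂ} (hf : MemLp f 2 volume)
    (hfS : ∀ l, (fun z : ℂ => Complex.exp (-Real.pi * z ^ 2 / 2) * gaussMoment l f z) ∈ S)
    (n : ℕ) :
    (fun z : ℂ => polyBargmann n f z - ((hermiteC n).coeff n * (-1 / 2) ^ n) *
      (conj z ^ n * (Complex.exp (-Real.pi * z ^ 2 / 2) * gaussMoment 0 f z))) ∈
        conjPolySpan S n := by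
  have : (fun z : ℂ => polyBargmann n f z - ((hermiteC n).coeff n * (-1 / 2) ^ n) *
      (conj z ^ n * (Complex.exp (-Real.pi * z ^ 2 / 2) * gaussMoment 0 f z))) =
      (∑ i ∈ Finset.range n, ∑ l ∈ Finset.range (i + 1),
        ((hermiteC n).coeff i * (i.choose l) * (-1 / 2) ^ (i - l)) • fun z : ℂ =>
          ((2 * (z.re : ℂ)) ^ (i - l) *
            (Complex.exp (-Real.pi * z ^ 2 / 2) * gaussMoment l f z))) +
      (∑ l ∈ Finset.range n,
        ((hermiteC n).coeff n * (n.choose (l + 1)) * (-1 / 2) ^ (n - (l + 1))) • fun z : ℂ =>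
          ((2 * (z.re : ℂ)) ^ (n - (l + 1)) *
            (Complex.exp (-Real.pi * z ^ 2 / 2) * gaussMoment (l + 1) f z))) +
      ((hermiteC n).coeff n * (-1 / 2) ^ n) • (fun z : ℂ =>
        (2 * (z.re : ℂ)) ^ n * (Complex.exp (-Real.pi * z ^ 2 / 2) * gaussMoment 0 f z) -
          conj z ^ n * (Complex.exp (-Real.pi * z ^ 2 / 2) * gaussMoment 0 f z)) := by
    ext z
    rw [polyBargmann_eq_sum hf, Finset.sum_range_succ, Finset.sum_range_succ' _ n]
    simp only [Pi.add_apply, Finset.sum_apply, Pi.smul_apply, smul_eq_mul, Nat.choose_zero_right,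
      Nat.cast_one, mul_one, Nat.sub_zero]
    ring
  rw [this]
  refine Submodule.add_mem _ (Submodule.add_mem _ ?_ ?_) ?_
  · refine Submodule.sum_mem _ fun i hi => Submodule.sum_mem _ fun l _ =>
      Submodule.smul_mem _ _ (conjPolySpan_mono S ?_ (two_re_pow_mul_mem hS (hfS l) _))
    have := Finset.mem_range.1 hi
    omega
  · refine Submodule.sum_mem _ fun l hl =>
      Submodule.smul_mem _ _ (conjPolySpan_mono S ?_ (two_re_pow_mul_mem hS (hfS _) _))
    have := Finset.mem_range.1 hl
    omega
  · exact Submodule.smul_mem _ _ (two_re_pow_mul_sub_mem hS (hfS 0) n)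

/-- Entire functions as a submodule. -/
def entireSubmodule : Submodule ℂ (ℂ → ℂ) where
  carrier := {g | Differentiable ℂ g}
  add_mem' := fun ha hb => Differentiable.add ha hb
  zero_mem' := differentiable_const (0 : ℂ)
  smul_mem' := fun c _ hg => Differentiable.const_smul hg c

lemma isPolyanalytic_of_mem_conjPolySpan {m : ℕ} {f : ℂ → ℂ}
    (hf : f ∈ conjPolySpan entireSubmodule m) : IsPolyanalytic m f := by
  induction hf using Submodule.span_induction with
  | mem x h =>
    obtain ⟨j, hj, g, hg, rfl⟩ := h
    exact (IsPolyanalytic.conj_pow_mul hg j).mono hj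
  | zero => exact IsPolyanalytic.zero m
  | add x y _ _ hx hy => exact hx.add hy
  | smul a x _ hx => exact hx.const_mul a

lemma isPolyanalytic_polyBargmann {f : ℝ → ℂ} (hf : MemLp f 2 volume) (n : ℕ) :
    IsPolyanalytic (n + 1) (polyBargmann n f) := by
  have hfS : ∀ l, Differentiable ℂ
      (fun z : ℂ => Complex.exp (-Real.pi * z ^ 2 / 2) * gaussMoment l f z) := fun l =>
    (Differentiable.cexp (by fun_prop)).mul (differentiable_gaussMoment hf l)
  have h1 := polyBargmann_sub_mem (S := entireSubmodule)
    (fun g hg => differentiable_id.mul hg) hf hfS n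
  have h2 := (isPolyanalytic_of_mem_conjPolySpan h1).mono n.le_succ |>.add
    ((IsPolyanalytic.conj_pow_mul (hfS 0) n).const_mul ((hermiteC n).coeff n * (-1 / 2) ^ n))
  convert h2 using 2
  ring

/-- The short-time Fourier transform form of the polyanalytic Bargmann transform. -/
lemma polyBargmann_eq_stft (n : ℕ) (f : ℝ → ℂ) (z : ℂ) :
    polyBargmann n f z = Complex.exp (Real.pi * (‖z‖ ^ 2 : ℝ) / 2 - Complex.I * Real.pi * z.re * z.im) *
      ∫ t : ℝ, f t * hermiteFun n (t - z.re) * Complex.exp (2 * Real.pi * Complex.I * z.im * t) := by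
  rw [← integral_const_mul, polyBargmann]
  refine integral_congr_ae (.of_forall fun t => ?_)
  simp only
  rw [hermiteFun_eq]
  push_cast
  -- Complete the square around `t = x` for `z = x + iy`; what remains is `-πx² + π|z|²/2 - iπxy =
  -- -πz²/2`.
  have : Complex.exp (-Real.pi * t ^ 2 + 2 * Real.pi * t * z - Real.pi * z ^ 2 / 2) =
      Complex.exp (Real.pi * (‖z‖ : ℂ) ^ 2 / 2 - Complex.I * Real.pi * z.re * z.im) *
      Complex.exp (-Real.pi * ((t : ℂ) - z.re) ^ 2) *
      Complex.exp (2 * Real.pi * Complex.I * z.im * t) := by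
    rw [← Complex.exp_add, ← Complex.exp_add]
    congr 1
    have h1 : ((‖z‖ : ℂ)) ^ 2 = (z.re : ℂ) ^ 2 + (z.im : ℂ) ^ 2 := by
      rw [← Complex.ofReal_pow, Complex.sq_norm, Complex.normSq_apply]; push_cast; ring
    have h2 : z = z.re + z.im * Complex.I := (Complex.re_add_im z).symm
    rw [h1]
    generalize (z.re : ℂ) = x at *
    generalize (z.im : ℂ) = y at *
    rw [h2]
    linear_combination (-(Real.pi : ℂ) / 2 * y ^ 2) * Complex.I_sq
  rw [this]
  ring

/-! ### Transforms of polynomials times a Gaussian -/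

/-- `t ^ k * exp (-π t²)`. -/
noncomputable def monoGauss (k : ℕ) (t : ℝ) : ℂ := (t : ℂ) ^ k * Complex.exp (-Real.pi * t ^ 2)

lemma memLp_monoGauss (k : ℕ) : MemLp (monoGauss k) 2 volume := by
  obtain ⟨C, hC, h⟩ := exists_moment_bound k 0
  refine ((memLp_exp_neg_mul_sq (half_pos Real.pi_pos)).const_mul C).mono
    (Continuous.aestronglyMeasurable (by unfold monoGauss; fun_prop)) (.of_forall fun x => ?_)
  rw [Real.norm_of_nonneg (by positivity)]
  simpa [monoGauss] using h x 0 (by simp)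

lemma gaussMoment_monoGauss (k l : ℕ) (z : ℂ) :
    gaussMoment l (monoGauss k) z = gaussMoment (k + l) (monoGauss 0) z := by
  unfold gaussMoment monoGauss
  refine integral_congr_ae (.of_forall fun t => ?_)
  simp only [pow_zero, pow_add]
  ring

/-- The polynomials `P_a` with `∫ t^a exp(-2πt²+2πtz) dt = P_a(z) exp(πz²/2)`. -/
noncomputable def gaussMomentPoly : ℕ → ℂ[X]
  | 0 => C ((Real.pi / (2 * Real.pi) : ℂ) ^ (1 / 2 : ℂ))
  | a + 1 => C ((2 * Real.pi : ℂ)⁻¹) *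
      (derivative (gaussMomentPoly a) + C (Real.pi : ℂ) * X * gaussMomentPoly a)

/-- The base case is the Gaussian integral. For the step, differentiate the formula of order `a` and
compare with `hasDerivAt_gaussMoment`. -/
lemma gaussMoment_monoGauss_zero (a : ℕ) (z : ℂ) :
    gaussMoment a (monoGauss 0) z =
      (gaussMomentPoly a).eval z * Complex.exp (Real.pi * z ^ 2 / 2) := by
  induction a generalizing z with
  | zero =>
    have h := integral_cexp_quadratic (b := -(2 * Real.pi)) (by simp [Real.pi_pos])
      (2 * Real.pi * z) 0
    have h2 : gaussMoment 0 (monoGauss 0) z = ∫ x : ℝ,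
        Complex.exp (-(2 * Real.pi) * x ^ 2 + 2 * Real.pi * z * x + 0) := by
      unfold gaussMoment monoGauss
      refine integral_congr_ae (.of_forall fun t => ?_)
      simp only [pow_zero, one_mul]
      rw [← Complex.exp_add]
      ring_nf
    rw [h2, h, gaussMomentPoly, eval_C, neg_neg]
    congr 2
    have : (Real.pi : ℂ) ≠ 0 := by exact_mod_cast Real.pi_ne_zero
    field_simp
    ring
  | succ a ih =>
    have h1 := hasDerivAt_gaussMoment (memLp_monoGauss 0) a z
    have h2 : HasDerivAt (gaussMoment a (monoGauss 0))
        ((derivative (gaussMomentPoly a)).eval z * Complex.exp (Real.pi * z ^ 2 / 2) +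
          (gaussMomentPoly a).eval z * (Complex.exp (Real.pi * z ^ 2 / 2) * (Real.pi * z))) z := by
      rw [funext ih]
      refine ((gaussMomentPoly a).hasDerivAt z).mul (HasDerivAt.cexp ?_)
      refine (((hasDerivAt_pow 2 z).const_mul (Real.pi : ℂ)).div_const 2).congr_deriv ?_
      push_cast; ring
    have h3 := h1.unique h2
    have hpi : (Real.pi : ℂ) ≠ 0 := by exact_mod_cast Real.pi_ne_zero
    have h4 : gaussMoment (a + 1) (monoGauss 0) z = (2 * Real.pi : ℂ)⁻¹ *
        (2 * Real.pi * gaussMoment (a + 1) (monoGauss 0) z) := by field_simp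
    rw [h4, h3, gaussMomentPoly]
    simp
    ring

/-- Exact degree makes these polynomials triangular with respect to the monomials, so each `z ^ k`
can be recovered from them. -/
lemma gaussMomentPoly_degree (a : ℕ) :
    (gaussMomentPoly a).natDegree ≤ a ∧ (gaussMomentPoly a).coeff a ≠ 0 := by
  have hpi : (Real.pi : ℂ) ≠ 0 := by exact_mod_cast Real.pi_ne_zero
  induction a with
  | zero =>
    refine ⟨by simp [gaussMomentPoly], ?_⟩
    rw [gaussMomentPoly, coeff_C_zero, Complex.cpow_def]
    have : (Real.pi / (2 * Real.pi) : ℂ) ≠ 0 := div_ne_zero hpi (mul_ne_zero two_ne_zero hpi)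
    rw [if_neg this]
    exact Complex.exp_ne_zero _
  | succ a ih =>
    obtain ⟨h1, h2⟩ := ih
    constructor
    · rw [gaussMomentPoly]
      refine (natDegree_C_mul_le _ _).trans ((natDegree_add_le _ _).trans (max_le ?_ ?_))
      · exact (natDegree_derivative_le _).trans (by omega)
      · refine natDegree_mul_le.trans ?_
        have : (C (Real.pi : ℂ) * X : ℂ[X]).natDegree ≤ 1 :=
          (natDegree_C_mul_le _ _).trans natDegree_X_le
        omega
    · rw [gaussMomentPoly, coeff_C_mul, coeff_add, mul_assoc, coeff_C_mul, coeff_X_mul,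
        coeff_derivative, coeff_eq_zero_of_natDegree_lt (by omega), zero_mul, zero_add]
      exact mul_ne_zero (inv_ne_zero (by simp [hpi])) (mul_ne_zero hpi h2)

/-- Polynomial functions as a submodule. -/
def polyFunSubmodule : Submodule ℂ (ℂ → ℂ) where
  carrier := {g | ∃ P : ℂ[X], g = fun z => P.eval z}
  add_mem' := by
    rintro _ _ ⟨P, rfl⟩ ⟨Q, rfl⟩
    exact ⟨P + Q, by ext z; simp⟩
  zero_mem' := ⟨0, by ext z; simp⟩
  smul_mem' := by
    rintro c _ ⟨P, rfl⟩
    exact ⟨C c * P, by ext z; simp⟩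

lemma exp_mul_gaussMoment_monoGauss (k l : ℕ) :
    (fun z : ℂ => Complex.exp (-Real.pi * z ^ 2 / 2) * gaussMoment l (monoGauss k) z) =
      fun z => (gaussMomentPoly (k + l)).eval z := by
  ext z
  rw [gaussMoment_monoGauss, gaussMoment_monoGauss_zero, mul_left_comm, ← Complex.exp_add]
  ring_nf
  simp

/-- A submodule containing the transforms of all `t^k exp(-πt²)` of orders `< m` contains all the
monomials `conj z ^ j * z ^ k` with `j < m`. -/
lemma monomial_mem_of_polyBargmann_mem (V : Submodule ℂ (ℂ → ℂ)) (m : ℕ)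
    (hV : ∀ n < m, ∀ k, polyBargmann n (monoGauss k) ∈ V) (j : ℕ) (hj : j < m) (k : ℕ) :
    (fun z => conj z ^ j * z ^ k) ∈ V := by
  -- Triangular elimination in both variables: the outer induction removes lower powers of `conj z`,
  -- the inner one lower powers of `z`.
  induction j using Nat.strong_induction_on generalizing k with
  | _ n ihn =>
  have hspan : conjPolySpan polyFunSubmodule n ≤ V := by
    refine Submodule.span_le.2 ?_
    rintro _ ⟨j, hj', _, ⟨P, rfl⟩, rfl⟩
    have : (fun z : ℂ => conj z ^ j * P.eval z) =
        ∑ i ∈ Finset.range (P.natDegree + 1), P.coeff i • fun z : ℂ => conj z ^ j * z ^ i := by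
      ext z
      rw [eval_eq_sum_range, Finset.mul_sum, Finset.sum_apply]
      exact Finset.sum_congr rfl fun i _ => by simp; ring
    rw [this]
    exact Submodule.sum_mem _ fun i _ => Submodule.smul_mem _ _ (ihn j hj' (hj'.trans hj) i)
  -- Modulo lower powers of `conj z`, the transform of `monoGauss k` is a nonzero multiple of this
  -- function.
  have htop : ∀ k, (fun z : ℂ => conj z ^ n * (gaussMomentPoly k).eval z) ∈ V := fun k => by
    have h1 := polyBargmann_sub_mem (S := polyFunSubmodule)
      (by rintro _ ⟨P, rfl⟩; exact ⟨X * P, by ext z; simp⟩) (memLp_monoGauss k)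
      (fun l => ⟨gaussMomentPoly (k + l), exp_mul_gaussMoment_monoGauss k l⟩) n
    have h2 := V.sub_mem (hV n hj k) (hspan h1)
    have hc : (hermiteC n).coeff n * (-1 / 2) ^ n ≠ 0 :=
      mul_ne_zero (hermiteC_coeff_ne_zero n) (pow_ne_zero _ (by norm_num))
    have h3 := V.smul_mem ((hermiteC n).coeff n * (-1 / 2) ^ n)⁻¹ h2
    convert h3 using 1
    ext z
    have h4 := congrFun (exp_mul_gaussMoment_monoGauss k 0) z
    simp only [add_zero] at h4
    simp only [Pi.smul_apply, Pi.sub_apply, smul_eq_mul, h4]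
    rw [sub_sub_cancel, inv_mul_cancel_left₀ hc]
  induction k using Nat.strong_induction_on with
  | _ k ihk =>
  obtain ⟨hd, hc⟩ := gaussMomentPoly_degree k
  have : (fun z : ℂ => conj z ^ n * z ^ k) = ((gaussMomentPoly k).coeff k)⁻¹ •
      ((fun z : ℂ => conj z ^ n * (gaussMomentPoly k).eval z) -
        ∑ i ∈ Finset.range k, (gaussMomentPoly k).coeff i • fun z : ℂ => conj z ^ n * z ^ i) := by
    ext z
    simp only [Pi.smul_apply, Pi.sub_apply, smul_eq_mul, Finset.sum_apply]
    rw [eval_eq_sum_range' (n := k + 1) (by omega), Finset.sum_range_succ, mul_add, Finset.mul_sum]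
    have : ∑ i ∈ Finset.range k, conj z ^ n * ((gaussMomentPoly k).coeff i * z ^ i) =
        ∑ i ∈ Finset.range k, (gaussMomentPoly k).coeff i * (conj z ^ n * z ^ i) :=
      Finset.sum_congr rfl fun i _ => by ring
    rw [this]
    field_simp
    ring
  rw [this]
  exact V.smul_mem _ (V.sub_mem (htop k) (Submodule.sum_mem _ fun i hi =>
    Submodule.smul_mem _ _ (ihk i (Finset.mem_range.1 hi))))

end GaborHermite

namespace GaborHermite
open ComplexConjugate Polynomial

/-! ### The Gaussian weighted plane -/

/-- The measure `exp(-π|z|²) dA`. -/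
noncomputable def fockMeasure : Measure ℂ :=
  (volume : Measure ℂ).withDensity fun z => ENNReal.ofReal (Real.exp (-Real.pi * ‖z‖ ^ 2))

lemma measurable_fockWeight :
    Measurable fun z : ℂ => ENNReal.ofReal (Real.exp (-Real.pi * ‖z‖ ^ 2)) := by fun_prop

lemma integrable_fockMeasure_iff {E : Type*} [NormedAddCommGroup E] [NormedSpace ℝ E] {g : ℂ → E} :
    Integrable g fockMeasure ↔
      Integrable (fun z => Real.exp (-Real.pi * ‖z‖ ^ 2) • g z) volume := by
  rw [fockMeasure, integrable_withDensity_iff_integrable_smul' measurable_fockWeight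
    (.of_forall fun _ => ENNReal.ofReal_lt_top)]
  simp_rw [ENNReal.toReal_ofReal (Real.exp_pos _).le]

lemma integral_fockMeasure {E : Type*} [NormedAddCommGroup E] [NormedSpace ℝ E] (g : ℂ → E) :
    ∫ z, g z ∂fockMeasure = ∫ z, Real.exp (-Real.pi * ‖z‖ ^ 2) • g z := by
  rw [fockMeasure, integral_withDensity_eq_integral_toReal_smul measurable_fockWeight
    (.of_forall fun _ => ENNReal.ofReal_lt_top)]
  simp_rw [ENNReal.toReal_ofReal (Real.exp_pos _).le]

lemma memLp_fockMeasure_iff {f : ℂ → ℂ} (hf : Continuous f) : MemLp f 2 fockMeasure ↔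
    Integrable (fun z : ℂ => ‖f z‖ ^ 2 * Real.exp (-Real.pi * ‖z‖ ^ 2)) volume := by
  rw [memLp_two_iff_integrable_sq_norm hf.aestronglyMeasurable, integrable_fockMeasure_iff]
  simp_rw [smul_eq_mul, mul_comm]

lemma integrable_exp_neg_mul_sq_complex {c : ℝ} (hc : 0 < c) :
    Integrable (fun z : ℂ => Real.exp (-c * ‖z‖ ^ 2)) := by
  have h := (GaussianFourier.integrable_cexp_neg_mul_sq_norm_add (V := ℂ) (b := c)
    (by simpa using hc) 0 0).norm
  refine h.congr (.of_forall fun z => ?_)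
  simp only [zero_mul, add_zero, Complex.norm_exp]
  congr 1
  norm_cast

lemma memLp_monomial (j k : ℕ) : MemLp (fun z : ℂ => conj z ^ j * z ^ k) 2 fockMeasure := by
  rw [memLp_fockMeasure_iff (by fun_prop)]
  obtain ⟨C, hC, h⟩ := pow_mul_exp_le_exp_sq ((j + k) * 2) 0 (half_pos Real.pi_pos)
  refine ((integrable_exp_neg_mul_sq_complex (half_pos Real.pi_pos)).const_mul C).mono'
    (Continuous.aestronglyMeasurable (by fun_prop)) (.of_forall fun z => ?_)
  have h1 := h ‖z‖ (norm_nonneg z)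
  rw [zero_mul, Real.exp_zero, mul_one] at h1
  rw [Real.norm_of_nonneg (by positivity), norm_mul, norm_pow, norm_pow, Complex.norm_conj,
    ← pow_add, ← pow_mul]
  refine (mul_le_mul_of_nonneg_right h1 (Real.exp_pos _).le).trans_eq ?_
  rw [mul_assoc, ← Real.exp_add]
  ring_nf

lemma integral_complex_polar {G : ℂ → ℂ} (hGc : Continuous G) (hG : Integrable G) :
    ∫ z, G z = ∫ r in Set.Ioi (0 : ℝ), ∫ θ in (-Real.pi)..Real.pi,
      (r : ℂ) * G (r * Complex.exp (θ * Complex.I)) := by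
  have hsymm : ∀ p : ℝ × ℝ, Complex.polarCoord.symm p =
      (p.1 : ℂ) * Complex.exp (p.2 * Complex.I) := fun p => by
    rw [Complex.polarCoord_symm_apply, Complex.exp_mul_I]; push_cast; rfl
  have hint : IntegrableOn (fun p : ℝ × ℝ => p.1 • G (Complex.polarCoord.symm p))
      polarCoord.target := by
    refine ⟨Continuous.aestronglyMeasurable ?_, ?_⟩
    · simp_rw [hsymm]; fun_prop
    · have h1 := Complex.lintegral_comp_polarCoord_symm (fun z => ‖G z‖ₑ)
      have h2 : (∫⁻ p in polarCoord.target, ‖p.1 • G (Complex.polarCoord.symm p)‖ₑ) =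
          ∫⁻ p in polarCoord.target, ENNReal.ofReal p.1 • ‖G (Complex.polarCoord.symm p)‖ₑ := by
        refine setLIntegral_congr_fun polarCoord.open_target.measurableSet fun p hp => ?_
        have hp1 : 0 < p.1 := hp.1
        rw [enorm_smul, Real.enorm_eq_ofReal hp1.le, smul_eq_mul]
      rw [HasFiniteIntegral, h2, h1]
      exact hG.2
  rw [← Complex.integral_comp_polarCoord_symm]
  rw [polarCoord_target] at hint ⊢
  rw [Measure.volume_eq_prod, setIntegral_prod _ hint]
  refine integral_congr_ae (.of_forall fun r => ?_)
  simp only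
  rw [intervalIntegral.integral_of_le (by linarith [Real.pi_pos]), ← integral_Ioc_eq_integral_Ioo]
  simp_rw [hsymm, Complex.real_smul]

lemma integral_exp_int_mul_I (n : ℤ) :
    ∫ θ in (-Real.pi)..Real.pi, Complex.exp (n * (θ * Complex.I)) =
      if n = 0 then (2 * Real.pi : ℂ) else 0 := by
  split_ifs with h
  · simp [h, two_mul]
  · have hc : (n : ℂ) * Complex.I ≠ 0 := mul_ne_zero (by exact_mod_cast h) Complex.I_ne_zero
    have h1 : ∀ θ : ℝ, Complex.exp (n * (θ * Complex.I)) = Complex.exp ((n * Complex.I) * θ) :=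
      fun θ => by ring_nf
    simp_rw [h1]
    rw [integral_exp_mul_complex hc]
    have h2 : Complex.exp (n * Complex.I * (Real.pi : ℂ)) =
        Complex.exp (n * Complex.I * ((-Real.pi : ℝ) : ℂ)) := by
      rw [Complex.exp_eq_exp_iff_exists_int]
      exact ⟨n, by push_cast; ring⟩
    rw [h2, sub_self, zero_div]

/-- The Taylor coefficients at `0`, extended by zero to negative indices. -/
noncomputable def taylorCoeffInt (φ : ℂ → ℂ) (k : ℤ) : ℂ :=
  if 0 ≤ k then (k.toNat.factorial : ℂ)⁻¹ * iteratedDeriv k.toNat φ 0 else 0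

lemma hasSum_taylor {φ : ℂ → ℂ} (hφ : Differentiable ℂ φ) (z : ℂ) :
    HasSum (fun n : ℕ => taylorCoeffInt φ n * z ^ n) (φ z) := by
  have := Complex.hasSum_taylorSeries_of_entire hφ 0 z
  have h : (fun n : ℕ => taylorCoeffInt φ n * z ^ n) =
      fun n : ℕ => (n.factorial : ℂ)⁻¹ • (z - 0) ^ n • iteratedDeriv n φ 0 := by
    funext n
    simp [taylorCoeffInt]
    ring
  rwa [h]

/-- The Taylor series is dominated on the circle by a summable sequence, so it integrates termwise
and the orthogonality of characters selects one term. For `k < 0` the value `k.toNat = 0` is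
harmless, the coefficient being zero. -/
lemma integral_circle_taylor {φ : ℂ → ℂ} (hφ : Differentiable ℂ φ) (r : ℝ) (k : ℤ) :
    ∫ θ in (-Real.pi)..Real.pi, φ (r * Complex.exp (θ * Complex.I)) *
      Complex.exp ((-k : ℤ) * (θ * Complex.I)) =
        2 * Real.pi * (taylorCoeffInt φ k * (r : ℂ) ^ k.toNat) := by
  have hs : Summable fun n : ℕ => ‖taylorCoeffInt φ n‖ * |r| ^ n := by
    have := (hasSum_taylor hφ (r : ℂ)).summable.norm
    simpa [norm_mul, norm_pow] using this
  have hnorm : ∀ (m : ℤ) (θ : ℝ), ‖Complex.exp (m * (θ * Complex.I))‖ = 1 := fun m θ => by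
    have : (m * (θ * Complex.I) : ℂ) = ((m * θ : ℝ) : ℂ) * Complex.I := by push_cast; ring
    rw [this, Complex.norm_exp_ofReal_mul_I]
  have h1 := intervalIntegral.hasSum_integral_of_dominated_convergence (μ := volume)
    (a := -Real.pi) (b := Real.pi)
    (F := fun (n : ℕ) (θ : ℝ) => taylorCoeffInt φ n * (r * Complex.exp (θ * Complex.I)) ^ n *
      Complex.exp ((-k : ℤ) * (θ * Complex.I)))
    (f := fun θ => φ (r * Complex.exp (θ * Complex.I)) *
      Complex.exp ((-k : ℤ) * (θ * Complex.I)))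
    (fun n _ => ‖taylorCoeffInt φ n‖ * |r| ^ n)
    (fun n => Continuous.aestronglyMeasurable (by fun_prop))
    (fun n => .of_forall fun θ _ => by
      rw [norm_mul, norm_mul, hnorm, mul_one, norm_pow, norm_mul, Complex.norm_exp_ofReal_mul_I,
        mul_one, Complex.norm_real, Real.norm_eq_abs])
    (.of_forall fun _ _ => hs) (by simp) (.of_forall fun θ _ => (hasSum_taylor hφ _).mul_right _)
  have h2 : ∀ n : ℕ, ∫ θ in (-Real.pi)..Real.pi, taylorCoeffInt φ n *
      (r * Complex.exp (θ * Complex.I)) ^ n * Complex.exp ((-k : ℤ) * (θ * Complex.I)) =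
      if (n : ℤ) = k then 2 * Real.pi * (taylorCoeffInt φ k * (r : ℂ) ^ k.toNat) else 0 := by
    intro n
    have h3 : ∀ θ : ℝ, taylorCoeffInt φ n * (r * Complex.exp (θ * Complex.I)) ^ n *
        Complex.exp ((-k : ℤ) * (θ * Complex.I)) = taylorCoeffInt φ n * (r : ℂ) ^ n *
        Complex.exp (((n - k : ℤ)) * (θ * Complex.I)) := fun θ => by
      rw [mul_pow, ← Complex.exp_nat_mul, mul_assoc, mul_assoc, mul_assoc, ← Complex.exp_add]
      congr 4
      push_cast; ring
    simp_rw [h3]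
    rw [intervalIntegral.integral_const_mul, integral_exp_int_mul_I]
    by_cases h : (n : ℤ) = k
    · subst h
      simp
      ring
    · rw [if_neg (by omega), if_neg h, mul_zero]
  simp_rw [h2] at h1
  refine h1.unique ?_
  by_cases hk : 0 ≤ k
  · lift k to ℕ using hk
    have := hasSum_ite_eq k (2 * Real.pi * (taylorCoeffInt φ k * (r : ℂ) ^ k))
    simpa [Nat.cast_inj] using this
  · have h4 : ∀ n : ℕ, (n : ℤ) ≠ k := fun n => by omega
    have h5 : taylorCoeffInt φ k = 0 := by rw [taylorCoeffInt, if_neg hk]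
    simp only [h4, if_false, h5, zero_mul, mul_zero]
    exact hasSum_zero

lemma eq_zero_of_taylorCoeffInt {φ : ℂ → ℂ} (hφ : Differentiable ℂ φ)
    (h : ∀ k, taylorCoeffInt φ k = 0) (z : ℂ) : φ z = 0 := by
  refine (hasSum_taylor hφ z).unique ?_
  simp only [h, zero_mul]
  exact hasSum_zero

/-- A square integrable polyanalytic function orthogonal to all monomials vanishes. -/
theorem IsPolyanalytic.eq_zero_of_orthogonal {m : ℕ} {F : ℂ → ℂ} (hF : IsPolyanalytic m F)
    (hF2 : MemLp F 2 fockMeasure)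
    (horth : ∀ j < m, ∀ k : ℕ, ∫ z, F z * conj (conj z ^ j * z ^ k) ∂fockMeasure = 0) :
    F = 0 := by
  have hFc := hF.continuous
  obtain ⟨φ, hφ, hFφ⟩ := hF
  -- The monomial `conj z ^ j * z ^ k` has angular frequency `k - j`, so the coefficients decouple
  -- according to `d = k - j`, possibly negative.
  suffices h : ∀ d : ℤ, ∀ j < m, taylorCoeffInt (φ j) (j + d) = 0 by
    rw [hFφ]
    ext z
    refine Finset.sum_eq_zero fun j hj => ?_
    rw [eq_zero_of_taylorCoeffInt (hφ j) (fun k => ?_) z, mul_zero]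
    have := h (k - j) j (Finset.mem_range.1 hj)
    rwa [add_sub_cancel] at this
  intro d
  set A : ℕ → ℂ := fun j => taylorCoeffInt (φ j) (j + d) with hA
  have hA0 : ∀ j : ℕ, (j : ℤ) + d < 0 → A j = 0 := fun j hj => by
    simp only [hA, taylorCoeffInt, if_neg (not_le.2 hj)]
  set e : ℕ → ℕ := fun j => ((j : ℤ) + d).toNat with he
  -- `P` is the part of `F` of angular frequency `d`. As a finite combination of monomials it is
  -- orthogonal to `F`, while pairing it with `F` gives its own squared norm. Truncation in `e` does
  -- not matter, since `A j = 0` when `j + d < 0`.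
  set P : ℂ → ℂ := fun z => ∑ j ∈ Finset.range m, A j * (conj z ^ j * z ^ e j) with hP
  have hPc : Continuous P := by fun_prop
  have hP2 : MemLp P 2 fockMeasure :=
    memLp_finsetSum _ fun j _ => (memLp_monomial j (e j)).const_mul (A j)
  have hFP : Integrable (fun z => F z * conj (P z)) fockMeasure :=
    hF2.integrable_mul (q := 2) (p := 2) hP2.star
  have horthP : ∫ z, F z * conj (P z) ∂fockMeasure = 0 := by
    have h1 : ∀ z, F z * conj (P z) = ∑ j ∈ Finset.range m,
        conj (A j) * (F z * conj (conj z ^ j * z ^ e j)) := fun z => by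
      simp only [hP, map_sum, map_mul, Finset.mul_sum]
      exact Finset.sum_congr rfl fun j _ => by ring
    simp_rw [h1]
    rw [integral_finsetSum]
    · refine Finset.sum_eq_zero fun j hj => ?_
      rw [integral_const_mul, horth j (Finset.mem_range.1 hj), mul_zero]
    · intro j _
      have : Integrable (fun z => F z * conj (conj z ^ j * z ^ e j)) fockMeasure :=
        hF2.integrable_mul (q := 2) (p := 2) (memLp_monomial j (e j)).star
      exact this.const_mul _
  rw [integral_fockMeasure] at horthP
  rw [integrable_fockMeasure_iff] at hFP
  have hcont : Continuous fun z => Real.exp (-Real.pi * ‖z‖ ^ 2) • (F z * conj (P z)) := by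
    fun_prop
  rw [integral_complex_polar hcont hFP] at horthP
  -- The radial profile: on the circle of radius `r`, `P` equals `q(r) * exp(i d θ)`.
  set q : ℂ[X] := ∑ j ∈ Finset.range m, C (A j) * X ^ (j + e j) with hq
  have hPq : ∀ r θ : ℝ, P (r * Complex.exp (θ * Complex.I)) =
      q.eval (r : ℂ) * Complex.exp (d * (θ * Complex.I)) := fun r θ => by
    simp only [hP, hq, eval_finsetSum, eval_mul, eval_C, eval_pow, eval_X, Finset.sum_mul]
    refine Finset.sum_congr rfl fun j _ => ?_
    by_cases hj : (j : ℤ) + d < 0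
    · simp [hA0 j hj]
    · have hej : ((e j : ℤ) : ℂ) = (j : ℂ) + d := by
        simp only [he]
        rw [Int.toNat_of_nonneg (not_lt.1 hj)]
        push_cast; ring
      have hconj : conj ((r : ℂ) * Complex.exp (θ * Complex.I)) =
          r * Complex.exp (-(θ * Complex.I)) := by
        rw [map_mul, Complex.conj_ofReal, ← Complex.exp_conj]
        simp
      rw [hconj, mul_pow, mul_pow, ← Complex.exp_nat_mul, ← Complex.exp_nat_mul]
      have : Complex.exp (d * (θ * Complex.I)) = Complex.exp (j * -(θ * Complex.I)) *
          Complex.exp (e j * (θ * Complex.I)) := by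
        rw [← Complex.exp_add]
        congr 1
        rw [Int.cast_natCast] at hej
        rw [hej]; ring
      rw [this]
      ring
  have hinner : ∀ r : ℝ, 0 < r → ∫ θ in (-Real.pi)..Real.pi,
      (r : ℂ) * (Real.exp (-Real.pi * ‖(r : ℂ) * Complex.exp (θ * Complex.I)‖ ^ 2) •
        (F (r * Complex.exp (θ * Complex.I)) * conj (P (r * Complex.exp (θ * Complex.I))))) =
      ((r * Real.exp (-Real.pi * r ^ 2) * (2 * Real.pi) * ‖q.eval (r : ℂ)‖ ^ 2 : ℝ) : ℂ) := by
    intro r hr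
    have h1 : ∀ θ : ℝ, (r : ℂ) * (Real.exp (-Real.pi * ‖(r : ℂ) * Complex.exp (θ * Complex.I)‖ ^ 2) •
        (F (r * Complex.exp (θ * Complex.I)) * conj (P (r * Complex.exp (θ * Complex.I))))) =
        ∑ j ∈ Finset.range m, (r * Real.exp (-Real.pi * r ^ 2) * conj (q.eval (r : ℂ)) * r ^ j) *
          (φ j (r * Complex.exp (θ * Complex.I)) *
            Complex.exp ((-(j + d) : ℤ) * (θ * Complex.I))) := by
      intro θ
      rw [norm_mul, Complex.norm_exp_ofReal_mul_I, mul_one, Complex.norm_real, Real.norm_eq_abs,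
        sq_abs, hPq, map_mul, ← Complex.exp_conj, hFφ, Complex.real_smul, Finset.sum_mul,
        Finset.mul_sum, Finset.mul_sum]
      refine Finset.sum_congr rfl fun j _ => ?_
      have hconj : conj ((r : ℂ) * Complex.exp (θ * Complex.I)) =
          r * Complex.exp (-(θ * Complex.I)) := by
        rw [map_mul, Complex.conj_ofReal, ← Complex.exp_conj]
        simp
      have : Complex.exp ((-(j + d) : ℤ) * (θ * Complex.I)) =
          Complex.exp (j * -(θ * Complex.I)) * Complex.exp (conj ((d : ℂ) * (θ * Complex.I))) := by
        rw [← Complex.exp_add]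
        congr 1
        simp only [map_mul, map_intCast, Complex.conj_ofReal, Complex.conj_I]
        push_cast; ring
      rw [this, hconj, mul_pow, ← Complex.exp_nat_mul]
      ring
    simp_rw [h1]
    rw [intervalIntegral.integral_finsetSum]
    · simp_rw [intervalIntegral.integral_const_mul]
      have h2 : ∀ j ∈ Finset.range m, (r * Real.exp (-Real.pi * r ^ 2) * conj (q.eval (r : ℂ)) * r ^ j) *
          (∫ θ in (-Real.pi)..Real.pi, φ j (r * Complex.exp (θ * Complex.I)) *
            Complex.exp ((-(j + d) : ℤ) * (θ * Complex.I))) =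
          (r * Real.exp (-Real.pi * r ^ 2) * conj (q.eval (r : ℂ)) * (2 * Real.pi)) *
            (A j * (r : ℂ) ^ (j + e j)) := fun j _ => by
        rw [integral_circle_taylor (hφ j), pow_add]
        ring
      rw [Finset.sum_congr rfl h2, ← Finset.mul_sum]
      have h3 : ∑ j ∈ Finset.range m, A j * (r : ℂ) ^ (j + e j) = q.eval (r : ℂ) := by
        simp [hq, eval_finsetSum]
      rw [h3]
      have h4 := Complex.conj_mul' (q.eval (r : ℂ))
      push_cast
      linear_combination (r * Complex.exp (-Real.pi * r ^ 2) * (2 * Real.pi)) * h4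
    · intro j _
      have := (hφ j).continuous
      exact Continuous.intervalIntegrable (by fun_prop) _ _
  rw [setIntegral_congr_fun measurableSet_Ioi fun r hr => hinner r hr,
    integral_complex_ofReal, Complex.ofReal_eq_zero] at horthP
  have hgc : Continuous fun r : ℝ =>
      r * Real.exp (-Real.pi * r ^ 2) * (2 * Real.pi) * ‖q.eval (r : ℂ)‖ ^ 2 := by fun_prop
  have hgint : IntegrableOn (fun r : ℝ =>
      r * Real.exp (-Real.pi * r ^ 2) * (2 * Real.pi) * ‖q.eval (r : ℂ)‖ ^ 2) (Set.Ioi 0) := by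
    obtain ⟨D, hD, hb⟩ := norm_eval_le_exp_sq (X * q * q) (half_pos Real.pi_pos)
    refine Integrable.integrableOn (((integrable_exp_neg_mul_sq (half_pos Real.pi_pos)).const_mul
      (D * (2 * Real.pi))).mono' hgc.aestronglyMeasurable (.of_forall fun r => ?_))
    have h1 := hb r
    simp only [eval_mul, eval_X, norm_mul, Complex.norm_real, Real.norm_eq_abs, sq_abs] at h1
    rw [norm_mul, norm_mul, norm_mul, norm_pow, norm_norm, Real.norm_eq_abs r,
      Real.norm_of_nonneg (Real.exp_pos _).le,
      Real.norm_of_nonneg (by positivity : 0 ≤ 2 * Real.pi)]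
    have h2 : Real.exp (-(Real.pi / 2) * r ^ 2) =
        Real.exp (Real.pi / 2 * r ^ 2) * Real.exp (-Real.pi * r ^ 2) := by
      rw [← Real.exp_add]; ring_nf
    rw [h2]
    calc |r| * Real.exp (-Real.pi * r ^ 2) * (2 * Real.pi) * ‖q.eval (r : ℂ)‖ ^ 2
        = (|r| * ‖q.eval (r : ℂ)‖ * ‖q.eval (r : ℂ)‖) *
          (Real.exp (-Real.pi * r ^ 2) * (2 * Real.pi)) := by ring
      _ ≤ (D * Real.exp (Real.pi / 2 * r ^ 2)) *
          (Real.exp (-Real.pi * r ^ 2) * (2 * Real.pi)) := by gcongr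
      _ = _ := by ring
  have hnn : 0 ≤ᵐ[volume.restrict (Set.Ioi (0 : ℝ))] fun r : ℝ =>
      r * Real.exp (-Real.pi * r ^ 2) * (2 * Real.pi) * ‖q.eval (r : ℂ)‖ ^ 2 := by
    filter_upwards [ae_restrict_mem measurableSet_Ioi] with r hr
    have : (0 : ℝ) < r := hr
    simp only [Pi.zero_apply]
    positivity
  have hae := (setIntegral_eq_zero_iff_of_nonneg_ae hnn hgint).1 horthP
  -- A nonzero polynomial has finitely many roots, but `q` vanishes almost everywhere on the
  -- half-line.
  have hq0 : q = 0 := by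
    by_contra hq0
    have hfin : (q.roots.toFinset : Set ℂ).Finite := Finset.finite_toSet _
    have hfin' : ((fun r : ℝ => (r : ℂ)) ⁻¹' (q.roots.toFinset : Set ℂ)).Finite :=
      hfin.preimage (Complex.ofReal_injective.injOn)
    have hnull := hfin'.measure_zero (volume : Measure ℝ)
    have h1 : ∀ᵐ r ∂(volume.restrict (Set.Ioi (0 : ℝ))), False := by
      filter_upwards [hae, ae_restrict_mem measurableSet_Ioi,
        ae_restrict_of_ae (measure_eq_zero_iff_ae_notMem.1 hnull)] with r h1 h2 h3
      have hr : (0 : ℝ) < r := h2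
      apply h3
      have hz : ‖q.eval (r : ℂ)‖ ^ 2 = 0 := by
        have hne : r * Real.exp (-Real.pi * r ^ 2) * (2 * Real.pi) ≠ 0 := by positivity
        exact (mul_eq_zero.1 h1).resolve_left hne
      simp only [Set.mem_preimage, Finset.mem_coe, Multiset.mem_toFinset]
      rw [mem_roots hq0]
      simpa using hz
    rw [ae_iff] at h1
    simp at h1
  intro j hj
  by_cases hjd : (j : ℤ) + d < 0
  · exact hA0 j hjd
  -- The exponents are `2j + d` wherever `A j` can be nonzero, so distinct `j` do not collide.
  have hcoef : q.coeff (j + e j) = A j := by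
    rw [hq, finsetSum_coeff, Finset.sum_eq_single j]
    · simp
    · intro i _ hij
      rw [coeff_C_mul, coeff_X_pow]
      by_cases hid : (i : ℤ) + d < 0
      · rw [hA0 i hid, zero_mul]
      · rw [if_neg, mul_zero]
        simp only [he]
        omega
    · intro h
      exact absurd (Finset.mem_range.2 hj) h
  rw [hq0, coeff_zero] at hcoef
  exact hcoef.symm

end GaborHermite

namespace GaborHermite
open ComplexConjugate
open scoped FourierTransform SchwartzMap ContDiff

/-! ### Plancherel for integrable square integrable functions -/

/-- The `L²` transform and the integral transform have the same pairing with every Schwartz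
function, and both are locally integrable, so they agree almost everywhere. -/
lemma fourier_toLp_ae_eq {u : ℝ → ℂ} (h1 : Integrable u) (h2 : MemLp u 2 volume) :
    (𝓕 (h2.toLp u) : Lp ℂ 2 (volume : Measure ℝ)) =ᵐ[volume] 𝓕 u := by
  have hcont : Continuous (𝓕 u) :=
    VectorFourier.fourierIntegral_continuous Real.continuous_fourierChar
      (L := innerₗ ℝ) continuous_inner h1
  have key : ∀ g : 𝓢(ℝ, ℂ), ∫ x, g x • (𝓕 (h2.toLp u) : Lp ℂ 2 (volume : Measure ℝ)) x =
      ∫ x, g x • 𝓕 u x := by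
    intro g
    rw [← Lp.toTemperedDistribution_apply, ← Lp.fourier_toTemperedDistribution_eq,
      TemperedDistribution.fourier_apply, Lp.toTemperedDistribution_apply]
    have e1 : ∫ x, 𝓕 g x • (h2.toLp u) x = ∫ x, 𝓕 g x • u x := by
      refine integral_congr_ae ?_
      filter_upwards [h2.coeFn_toLp] with x hx
      rw [hx]
    rw [e1]
    simpa using! (VectorFourier.integral_fourierIntegral_smul_eq_flip (L := innerₗ ℝ)
      Real.continuous_fourierChar continuous_inner g.integrable h1)
  have hloc : LocallyIntegrable
      (fun x => (𝓕 (h2.toLp u) : Lp ℂ 2 (volume : Measure ℝ)) x - 𝓕 u x) volume :=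
    ((Lp.memLp _).locallyIntegrable (by norm_num)).sub hcont.locallyIntegrable
  have := ae_eq_zero_of_integral_contDiff_smul_eq_zero hloc (fun g hg hgc => ?_)
  · filter_upwards [this] with x hx
    exact sub_eq_zero.1 hx
  · have hg' : ContDiff ℝ ∞ (fun x => (g x : ℂ)) := Complex.ofRealCLM.contDiff.comp hg
    have hgc' : HasCompactSupport (fun x => (g x : ℂ)) :=
      hgc.comp_left (g := fun x : ℝ => (x : ℂ)) rfl
    have h3 := key (hgc'.toSchwartzMap hg')
    have h4 : ∀ x, (hgc'.toSchwartzMap hg') x = (g x : ℂ) := fun x => rfl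
    simp_rw [h4] at h3
    simp_rw [smul_sub]
    rw [integral_sub]
    · simp_rw [Complex.real_smul]
      simp_rw [smul_eq_mul] at h3
      rw [h3, sub_self]
    · exact ((Lp.memLp _).locallyIntegrable (by norm_num)).integrable_smul_left_of_hasCompactSupport
        hg.continuous hgc
    · exact hcont.locallyIntegrable.integrable_smul_left_of_hasCompactSupport hg.continuous hgc

lemma memLp_fourier {u : ℝ → ℂ} (h1 : Integrable u) (h2 : MemLp u 2 volume) :
    MemLp (𝓕 u) 2 volume :=
  (memLp_congr_ae (fourier_toLp_ae_eq h1 h2)).1 (Lp.memLp _)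

lemma integral_fourier_mul_conj {u v : ℝ → ℂ} (hu1 : Integrable u) (hu2 : MemLp u 2 volume)
    (hv1 : Integrable v) (hv2 : MemLp v 2 volume) :
    ∫ y, 𝓕 u y * conj (𝓕 v y) = ∫ t, u t * conj (v t) := by
  have h := Lp.inner_fourier_eq (hv2.toLp v) (hu2.toLp u)
  rw [L2.inner_def, L2.inner_def] at h
  have e1 : ∫ y, 𝓕 u y * conj (𝓕 v y) = ∫ y, inner ℂ
      ((𝓕 (hv2.toLp v) : Lp ℂ 2 (volume : Measure ℝ)) y)
      ((𝓕 (hu2.toLp u) : Lp ℂ 2 (volume : Measure ℝ)) y) := by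
    refine integral_congr_ae ?_
    filter_upwards [fourier_toLp_ae_eq hu1 hu2, fourier_toLp_ae_eq hv1 hv2] with x h3 h4
    rw [h3, h4]
    rfl
  have e2 : ∫ t, u t * conj (v t) = ∫ t, inner ℂ ((hv2.toLp v) t) ((hu2.toLp u) t) := by
    refine integral_congr_ae ?_
    filter_upwards [hu2.coeFn_toLp, hv2.coeFn_toLp] with x h3 h4
    rw [h3, h4]
    rfl
  rw [e1, e2, h]

/-! ### Orthogonality relations -/

/-- The short-time Fourier transform of `f` with Hermite window, in the variables `(x, -ξ)`. -/
noncomputable def hermiteSTFT (n : ℕ) (f : ℝ → ℂ) (x y : ℝ) : ℂ :=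
  ∫ t : ℝ, f t * hermiteFun n (t - x) * Complex.exp (2 * Real.pi * Complex.I * y * t)

lemma integrable_mul_hermite {f : ℝ → ℂ} (hf : MemLp f 2 volume) (n : ℕ) (x : ℝ) :
    Integrable (fun t => f t * hermiteFun n (t - x)) :=
  hf.integrable_mul ((memLp_hermiteFun n).comp_measurePreserving (measurePreserving_sub_right _ x))

lemma memLp_mul_hermite {f : ℝ → ℂ} (hf : MemLp f 2 volume) (n : ℕ) (x : ℝ) :
    MemLp (fun t => f t * hermiteFun n (t - x)) 2 volume := by
  obtain ⟨C, hC, hb⟩ := norm_hermiteFun_le n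
  have hc := continuous_hermiteFun n
  refine (hf.norm.const_mul C).mono
    (hf.aestronglyMeasurable.mul (Continuous.aestronglyMeasurable (by fun_prop)))
    (.of_forall fun t => ?_)
  have h1 : ‖hermiteFun n (t - x)‖ ≤ C := (hb _).trans (by
    have : Real.exp (-(Real.pi / 2) * (t - x) ^ 2) ≤ 1 := Real.exp_le_one_iff.2 (by
      have := Real.pi_pos
      nlinarith [sq_nonneg (t - x)])
    nlinarith)
  rw [norm_mul, Real.norm_of_nonneg (by positivity), mul_comm C]
  gcongr

lemma hermiteSTFT_eq_fourier (n : ℕ) (f : ℝ → ℂ) (x y : ℝ) :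
    hermiteSTFT n f x y = 𝓕 (fun t => f t * hermiteFun n (t - x)) (-y) := by
  rw [Real.fourier_real_eq_integral_exp_smul, hermiteSTFT]
  refine integral_congr_ae (.of_forall fun t => ?_)
  simp only [smul_eq_mul]
  rw [mul_comm]
  congr 2
  push_cast; ring

lemma polyBargmann_eq (n : ℕ) (f : ℝ → ℂ) (z : ℂ) : polyBargmann n f z =
    Complex.exp (Real.pi * (‖z‖ ^ 2 : ℝ) / 2 - Complex.I * Real.pi * z.re * z.im) *
      hermiteSTFT n f z.re z.im := polyBargmann_eq_stft n f z

/-- The Fock weight cancels the squared modulus of the prefactor, which is the same for all orders.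
Fock inner products thus become unweighted ones of short-time Fourier transforms. -/
lemma exp_smul_polyBargmann_mul_conj (n m : ℕ) (f g : ℝ → ℂ) (z : ℂ) :
    Real.exp (-Real.pi * ‖z‖ ^ 2) • (polyBargmann n f z * conj (polyBargmann m g z)) =
      hermiteSTFT n f z.re z.im * conj (hermiteSTFT m g z.re z.im) := by
  rw [polyBargmann_eq, polyBargmann_eq, map_mul, Complex.real_smul]
  set E := Complex.exp (Real.pi * (‖z‖ ^ 2 : ℝ) / 2 - Complex.I * Real.pi * z.re * z.im)
  have h : ((Real.exp (-Real.pi * ‖z‖ ^ 2) : ℝ) : ℂ) * (E * conj E) = 1 := by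
    rw [Complex.ofReal_exp, ← Complex.exp_conj, ← Complex.exp_add, ← Complex.exp_add,
      Complex.exp_eq_one_iff]
    refine ⟨0, ?_⟩
    simp only [map_sub, map_mul, map_div₀, Complex.conj_ofReal, Complex.conj_I, map_ofNat]
    push_cast
    ring
  linear_combination (hermiteSTFT n f z.re z.im * conj (hermiteSTFT m g z.re z.im)) * h

/-- Inherited from the polyanalytic, hence continuous, Bargmann transform by dividing out the
prefactor. -/
lemma continuous_hermiteSTFT {f : ℝ → ℂ} (hf : MemLp f 2 volume) (n : ℕ) :
    Continuous fun p : ℝ × ℝ => hermiteSTFT n f p.1 p.2 := by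
  have h : (fun p : ℝ × ℝ => hermiteSTFT n f p.1 p.2) = fun p : ℝ × ℝ =>
      Complex.exp (-(Real.pi * (‖(⟨p.1, p.2⟩ : ℂ)‖ ^ 2 : ℝ) / 2 -
        Complex.I * Real.pi * p.1 * p.2)) * polyBargmann n f ⟨p.1, p.2⟩ := by
    ext p
    rw [polyBargmann_eq, ← mul_assoc, ← Complex.exp_add]
    simp
  have hc := (isPolyanalytic_polyBargmann hf n).continuous
  have hmk : Continuous fun p : ℝ × ℝ => (⟨p.1, p.2⟩ : ℂ) :=
    Complex.equivRealProdCLM.symm.continuous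
  rw [h]
  fun_prop

lemma memLp_hermiteSTFT_right {f : ℝ → ℂ} (hf : MemLp f 2 volume) (n : ℕ) (x : ℝ) :
    MemLp (hermiteSTFT n f x) 2 volume := by
  have h1 := memLp_fourier (integrable_mul_hermite hf n x) (memLp_mul_hermite hf n x)
  have h2 := h1.comp_measurePreserving (Measure.measurePreserving_neg (volume : Measure ℝ))
  refine (memLp_congr_ae (.of_forall fun y => ?_)).1 h2
  rw [hermiteSTFT_eq_fourier]
  rfl

/-- Plancherel in `y`: for fixed `x` the transform is the Fourier transform at `-y` of `f` times the
shifted window. -/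
lemma integral_hermiteSTFT_right {f g : ℝ → ℂ} (hf : MemLp f 2 volume) (hg : MemLp g 2 volume)
    (n m : ℕ) (x : ℝ) :
    ∫ y, hermiteSTFT n f x y * conj (hermiteSTFT m g x y) =
      ∫ t, (f t * conj (g t)) * (hermiteFun n (t - x) * hermiteFun m (t - x)) := by
  simp_rw [hermiteSTFT_eq_fourier]
  rw [integral_neg_eq_self (fun y => 𝓕 (fun t => f t * hermiteFun n (t - x)) y *
    conj (𝓕 (fun t => g t * hermiteFun m (t - x)) y)),
    integral_fourier_mul_conj (integrable_mul_hermite hf n x) (memLp_mul_hermite hf n x)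
      (integrable_mul_hermite hg m x) (memLp_mul_hermite hg m x)]
  refine integral_congr_ae (.of_forall fun t => ?_)
  simp only [map_mul, conj_hermiteFun]
  ring

/-- This is the integrand of the convolution of `u` with the reflected product of the two windows.
-/
lemma integrable_mul_window {u : ℝ → ℂ} (hu : Integrable u) (n m : ℕ) :
    Integrable (fun p : ℝ × ℝ => u p.2 * (hermiteFun n (p.2 - p.1) * hermiteFun m (p.2 - p.1)))
      (volume.prod volume) := by
  have h1 : Integrable (fun s : ℝ => hermiteFun n (-s) * hermiteFun m (-s)) :=
    ((memLp_hermiteFun n).integrable_mul (memLp_hermiteFun m)).comp_neg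
  have := hu.convolution_integrand (ContinuousLinearMap.mul ℂ ℂ) h1
  refine this.congr (.of_forall fun p => ?_)
  simp

lemma integrable_norm_sq_hermiteSTFT {f : ℝ → ℂ} (hf : MemLp f 2 volume) (n : ℕ) :
    Integrable (fun p : ℝ × ℝ => ‖hermiteSTFT n f p.1 p.2‖ ^ 2) (volume.prod volume) := by
  have hc := continuous_hermiteSTFT hf n
  rw [integrable_prod_iff (Continuous.aestronglyMeasurable (by fun_prop))]
  refine ⟨.of_forall fun x => ?_, ?_⟩
  · exact (memLp_two_iff_integrable_sq_norm
      (memLp_hermiteSTFT_right hf n x).aestronglyMeasurable).1 (memLp_hermiteSTFT_right hf n x)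
  · have hff : Integrable (fun t => f t * conj (f t)) := hf.integrable_mul hf.star
    have h1 := (integrable_mul_window hff n n).integral_prod_left.norm
    refine h1.congr (.of_forall fun x => ?_)
    simp only
    rw [← integral_hermiteSTFT_right hf hf n n x]
    have h2 : ∫ y, hermiteSTFT n f x y * conj (hermiteSTFT n f x y) =
        ((∫ y, ‖‖hermiteSTFT n f x y‖ ^ 2‖ : ℝ) : ℂ) := by
      rw [← integral_complex_ofReal]
      refine integral_congr_ae (.of_forall fun y => ?_)
      simp only
      rw [Complex.mul_conj', norm_pow, norm_norm]
      push_cast; rfl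
    rw [h2, Complex.norm_real, Real.norm_of_nonneg (integral_nonneg fun y => norm_nonneg _)]

lemma memLp_polyBargmann {f : ℝ → ℂ} (hf : MemLp f 2 volume) (n : ℕ) :
    MemLp (polyBargmann n f) 2 fockMeasure := by
  rw [memLp_fockMeasure_iff (isPolyanalytic_polyBargmann hf n).continuous]
  have h1 := (Complex.volume_preserving_equiv_real_prod.integrable_comp_emb
    Complex.measurableEquivRealProd.measurableEmbedding).2 (integrable_norm_sq_hermiteSTFT hf n)
  refine h1.congr (.of_forall fun z => ?_)
  have h2 := exp_smul_polyBargmann_mul_conj n n f f z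
  rw [Complex.mul_conj', Complex.mul_conj', Complex.real_smul] at h2
  have h3 : ((‖polyBargmann n f z‖ ^ 2 * Real.exp (-Real.pi * ‖z‖ ^ 2) : ℝ) : ℂ) =
      ((‖hermiteSTFT n f z.re z.im‖ ^ 2 : ℝ) : ℂ) := by
    push_cast at h2 ⊢
    rw [← h2]; ring
  exact (Complex.ofReal_injective h3).symm

/-- Orthogonality relations for the polyanalytic Bargmann transforms. -/
theorem integral_polyBargmann_mul_conj {f g : ℝ → ℂ} (hf : MemLp f 2 volume)
    (hg : MemLp g 2 volume) (n m : ℕ) :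
    ∫ z, polyBargmann n f z * conj (polyBargmann m g z) ∂fockMeasure =
      (∫ t, f t * conj (g t)) * ∫ t, hermiteFun n t * hermiteFun m t := by
  have hint : Integrable (fun z => polyBargmann n f z * conj (polyBargmann m g z)) fockMeasure :=
    (memLp_polyBargmann hf n).integrable_mul (memLp_polyBargmann hg m).star
  rw [integrable_fockMeasure_iff] at hint
  rw [integral_fockMeasure]
  simp_rw [exp_smul_polyBargmann_mul_conj] at hint ⊢
  have hint' : Integrable (fun p : ℝ × ℝ => hermiteSTFT n f p.1 p.2 *
      conj (hermiteSTFT m g p.1 p.2)) (volume.prod volume) := by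
    rw [← Measure.volume_eq_prod, ← Complex.volume_preserving_equiv_real_prod.integrable_comp_emb
      Complex.measurableEquivRealProd.measurableEmbedding]
    exact hint
  have h1 := Complex.volume_preserving_equiv_real_prod.integral_comp
    Complex.measurableEquivRealProd.measurableEmbedding (fun p : ℝ × ℝ => hermiteSTFT n f p.1 p.2 *
      conj (hermiteSTFT m g p.1 p.2))
  have h2 : ∫ z : ℂ, hermiteSTFT n f z.re z.im * conj (hermiteSTFT m g z.re z.im) =
      ∫ p : ℝ × ℝ, hermiteSTFT n f p.1 p.2 * conj (hermiteSTFT m g p.1 p.2) := h1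
  have hfg : Integrable (fun t => f t * conj (g t)) := hf.integrable_mul hg.star
  rw [h2, Measure.volume_eq_prod, integral_prod _ hint']
  simp_rw [integral_hermiteSTFT_right hf hg]
  -- After the swap the inner integral over `x` is translation invariant, so it no longer depends on
  -- `t`.
  rw [integral_integral_swap (integrable_mul_window hfg n m), ← integral_mul_const]
  refine integral_congr_ae (.of_forall fun t => ?_)
  simp only
  rw [integral_const_mul, integral_sub_left_eq_self (fun s => hermiteFun n s * hermiteFun m s)]

end GaborHermite

namespace GaborHermite
open ComplexConjugate

/-! ### The structure of the polyanalytic Fock spaces -/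

lemma integrable_hermiteSTFT_integrand {f : ℝ → ℂ} (hf : MemLp f 2 volume) (n : ℕ) (x y : ℝ) :
    Integrable (fun t : ℝ => f t * hermiteFun n (t - x) *
      Complex.exp (2 * Real.pi * Complex.I * y * t)) := by
  have h := integrable_mul_hermite hf n x
  refine h.mono (h.aestronglyMeasurable.mul (Continuous.aestronglyMeasurable (by fun_prop)))
    (.of_forall fun t => ?_)
  have : (2 * Real.pi * Complex.I * y * t : ℂ) = ((2 * Real.pi * y * t : ℝ) : ℂ) * Complex.I := by
    push_cast; ring
  rw [norm_mul, this, Complex.norm_exp_ofReal_mul_I, mul_one]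

lemma polyBargmann_add {f g : ℝ → ℂ} (hf : MemLp f 2 volume) (hg : MemLp g 2 volume) (n : ℕ) :
    polyBargmann n (f + g) = polyBargmann n f + polyBargmann n g := by
  ext z
  simp only [Pi.add_apply, polyBargmann_eq]
  rw [← mul_add, hermiteSTFT, hermiteSTFT, hermiteSTFT,
    ← integral_add (integrable_hermiteSTFT_integrand hf n _ _)
      (integrable_hermiteSTFT_integrand hg n _ _)]
  congr 2
  ext t
  simp only [Pi.add_apply]
  ring

lemma polyBargmann_smul (f : ℝ → ℂ) (c : ℂ) (n : ℕ) :
    polyBargmann n (c • f) = c • polyBargmann n f := by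
  ext z
  simp only [Pi.smul_apply, smul_eq_mul, polyBargmann]
  rw [← integral_const_mul]
  congr 1
  ext t
  ring

lemma polyBargmann_congr_ae {f g : ℝ → ℂ} (h : f =ᵐ[volume] g) (n : ℕ) :
    polyBargmann n f = polyBargmann n g := by
  ext z
  refine integral_congr_ae ?_
  filter_upwards [h] with t ht
  rw [ht]

/-- The inner products of Hermite functions. -/
noncomputable def hermiteGram (n m : ℕ) : ℂ := ∫ t, hermiteFun n t * hermiteFun m t

/-- The polyanalytic Bargmann transform as a linear map between `L²` spaces. -/
noncomputable def polyBargmannLM (n : ℕ) :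
    Lp ℂ 2 (volume : Measure ℝ) →ₗ[ℂ] Lp ℂ 2 fockMeasure where
  toFun f := (memLp_polyBargmann (Lp.memLp f) n).toLp
  map_add' f g := by
    rw [← MemLp.toLp_add]
    refine (MemLp.toLp_eq_toLp_iff _ _).2 ?_
    rw [polyBargmann_congr_ae (Lp.coeFn_add f g), polyBargmann_add (Lp.memLp f) (Lp.memLp g)]
  map_smul' c f := by
    rw [RingHom.id_apply, ← MemLp.toLp_const_smul]
    refine (MemLp.toLp_eq_toLp_iff _ _).2 ?_
    rw [polyBargmann_congr_ae (Lp.coeFn_smul c f), polyBargmann_smul]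

lemma inner_polyBargmannLM (n m : ℕ) (f g : Lp ℂ 2 (volume : Measure ℝ)) :
    inner ℂ (polyBargmannLM m g) (polyBargmannLM n f) = inner ℂ g f * hermiteGram n m := by
  rw [L2.inner_def, L2.inner_def]
  have h := integral_polyBargmann_mul_conj (Lp.memLp f) (Lp.memLp g) n m
  rw [hermiteGram]
  refine Eq.trans ?_ h
  refine integral_congr_ae ?_
  filter_upwards [(memLp_polyBargmann (Lp.memLp f) n).coeFn_toLp,
    (memLp_polyBargmann (Lp.memLp g) m).coeFn_toLp] with z h1 h2
  rw [← h1, ← h2]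
  rfl

/-- The polyanalytic Bargmann transform as a bounded operator. -/
noncomputable def polyBargmannCLM (n : ℕ) :
    Lp ℂ 2 (volume : Measure ℝ) →L[ℂ] Lp ℂ 2 fockMeasure :=
  -- The orthogonality relation with `g = f` gives `‖B f‖² = ‖f‖² * ‖hermiteGram n n‖`.
  (polyBargmannLM n).mkContinuous (√‖hermiteGram n n‖) fun f => by
    have h := inner_polyBargmannLM n n f f
    rw [inner_self_eq_norm_sq_to_K, inner_self_eq_norm_sq_to_K] at h
    have h2 := congrArg (‖·‖) h
    simp only [norm_mul, norm_pow, RCLike.norm_ofReal, abs_norm] at h2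
    rw [← Real.sqrt_sq (norm_nonneg (polyBargmannLM n f)), h2, mul_comm,
      Real.sqrt_mul (norm_nonneg _), Real.sqrt_sq (norm_nonneg _)]

lemma polyBargmannCLM_coeFn (n : ℕ) (f : Lp ℂ 2 (volume : Measure ℝ)) :
    polyBargmannCLM n f =ᵐ[fockMeasure] polyBargmann n f :=
  (memLp_polyBargmann (Lp.memLp f) n).coeFn_toLp

lemma hermiteGram_of_ne {n m : ℕ} (h : n ≠ m) : hermiteGram n m = 0 :=
  integral_hermiteFun_mul_of_ne h

lemma hermiteGram_self_ne_zero (n : ℕ) : hermiteGram n n ≠ 0 := integral_hermiteFun_sq_ne_zero n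

/-- Project `F` onto the ranges with normalized adjoints. The remainder `G` is still polyanalytic
and square integrable and is orthogonal to the transforms of all `monoGauss k` of orders `< m`,
hence to all monomials, so it vanishes identically. -/
theorem exists_eq_sum_polyBargmann {m : ℕ} {F : ℂ → ℂ} (hF : IsPolyanalytic m F)
    (hF2 : MemLp F 2 fockMeasure) : ∃ f : ℕ → ℝ → ℂ, (∀ j, MemLp (f j) 2 volume) ∧
      F = fun z => ∑ j ∈ Finset.range m, polyBargmann j (f j) z := by
  set f : ℕ → Lp ℂ 2 (volume : Measure ℝ) := fun j =>
    (hermiteGram j j)⁻¹ • ContinuousLinearMap.adjoint (polyBargmannCLM j) hF2.toLp with hf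
  refine ⟨fun j => f j, fun j => Lp.memLp _, ?_⟩
  set G : ℂ → ℂ := fun z => F z - ∑ j ∈ Finset.range m, polyBargmann j (f j) z with hG
  have hsum : MemLp (fun z => ∑ j ∈ Finset.range m, polyBargmann j (f j) z) 2 fockMeasure :=
    memLp_finsetSum _ fun j _ => memLp_polyBargmann (Lp.memLp _) j
  have hGp : IsPolyanalytic m G := by
    have h1 : IsPolyanalytic m (fun z => ∑ j ∈ Finset.range m, polyBargmann j (f j) z) :=
      IsPolyanalytic.sum _ fun j hj =>
        (isPolyanalytic_polyBargmann (Lp.memLp _) j).mono (Finset.mem_range.1 hj)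
    convert hF.add (h1.const_mul (-1)) using 2
    simp only [hG]; ring
  have hG2 : MemLp G 2 fockMeasure := hF2.sub hsum
  -- The orthogonal complement of `G`, as a space of functions to which
  -- `monomial_mem_of_polyBargmann_mem` applies; square integrability is included so that the
  -- pairing is additive.
  let V : Submodule ℂ (ℂ → ℂ) :=
    { carrier := {g | MemLp g 2 fockMeasure ∧ ∫ z, G z * conj (g z) ∂fockMeasure = 0}
      add_mem' := by
        rintro a b ⟨ha, ha'⟩ ⟨hb, hb'⟩
        refine ⟨ha.add hb, ?_⟩
        have h1 : Integrable (fun z => G z * conj (a z)) fockMeasure := hG2.integrable_mul ha.star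
        have h2 : Integrable (fun z => G z * conj (b z)) fockMeasure := hG2.integrable_mul hb.star
        simp only [Pi.add_apply, map_add, mul_add]
        rw [integral_add h1 h2, ha', hb', add_zero]
      zero_mem' := ⟨MemLp.zero', by simp⟩
      smul_mem' := by
        rintro c a ⟨ha, ha'⟩
        refine ⟨ha.const_smul c, ?_⟩
        simp only [Pi.smul_apply, smul_eq_mul, map_mul, mul_left_comm _ (conj c)]
        rw [integral_const_mul, ha', mul_zero] }
  have hV : ∀ n < m, ∀ k, polyBargmann n (monoGauss k) ∈ V := by
    intro n hn k
    refine ⟨memLp_polyBargmann (memLp_monoGauss k) n, ?_⟩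
    set u : Lp ℂ 2 (volume : Measure ℝ) := (memLp_monoGauss k).toLp with hu
    have h1 : inner ℂ (polyBargmannCLM n u)
        (hF2.toLp - ∑ j ∈ Finset.range m, polyBargmannCLM j (f j)) = 0 := by
      rw [inner_sub_right, inner_sum]
      have h2 : ∀ j ∈ Finset.range m, inner ℂ (polyBargmannCLM n u) (polyBargmannCLM j (f j)) =
          inner ℂ u (f j) * hermiteGram j n := fun j _ => inner_polyBargmannLM j n (f j) u
      rw [Finset.sum_congr rfl h2, Finset.sum_eq_single n]
      · rw [← ContinuousLinearMap.adjoint_inner_right, hf]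
        simp only [inner_smul_right]
        rw [mul_right_comm, inv_mul_cancel₀ (hermiteGram_self_ne_zero n), one_mul, sub_self]
      · intro j _ hj
        rw [hermiteGram_of_ne hj, mul_zero]
      · intro h
        exact absurd (Finset.mem_range.2 hn) h
    rw [L2.inner_def] at h1
    rw [← h1]
    have h3 : ∀ᵐ z ∂fockMeasure, ∀ j ∈ Finset.range m,
        (polyBargmannCLM j (f j)) z = polyBargmann j (f j) z :=
      (ae_ball_iff (Finset.countable_toSet _)).2 fun j _ => polyBargmannCLM_coeFn j (f j)
    refine integral_congr_ae ?_
    filter_upwards [polyBargmannCLM_coeFn n u, h3, hF2.coeFn_toLp,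
      Lp.coeFn_sub hF2.toLp (∑ j ∈ Finset.range m, polyBargmannCLM j (f j)),
      Lp.coeFn_finsetSum (s := Finset.range m) (f := fun j => polyBargmannCLM j (f j))]
      with z h4 h5 h6 h7 h8
    rw [h4, h7, Pi.sub_apply, h6, h8]
    have h9 : ∑ j ∈ Finset.range m, (polyBargmannCLM j (f j)) z =
        ∑ j ∈ Finset.range m, polyBargmann j (f j) z := Finset.sum_congr rfl h5
    rw [polyBargmann_congr_ae (memLp_monoGauss k).coeFn_toLp]
    simp only [Finset.sum_apply, h9]
    rfl
  have hG0 := hGp.eq_zero_of_orthogonal hG2 fun j hj k =>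
    (monomial_mem_of_polyBargmann_mem V m hV j hj k).2
  ext z
  exact sub_eq_zero.1 (congrFun hG0 z)

/-- The transform is an isometry up to a nonzero factor. The hypothesis concerns the integral, so
that it can be fed either by vanishing of the transform or by an orthogonality argument. -/
lemma ae_eq_zero_of_polyBargmann_eq_zero {f : ℝ → ℂ} (hf : MemLp f 2 volume) (n : ℕ)
    (h : ∫ z, polyBargmann n f z * conj (polyBargmann n f z) ∂fockMeasure = 0) :
    f =ᵐ[volume] 0 := by
  rw [integral_polyBargmann_mul_conj hf hf] at h
  have h1 := (mul_eq_zero.1 h).resolve_right (hermiteGram_self_ne_zero n)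
  have h2 : ∫ t, ‖f t‖ ^ 2 = 0 := by
    rw [← Complex.ofReal_eq_zero, ← integral_complex_ofReal, ← h1]
    refine integral_congr_ae (.of_forall fun t => ?_)
    simp only
    rw [Complex.mul_conj']
    push_cast; rfl
  have h3 := (integral_eq_zero_iff_of_nonneg (fun t => by positivity)
    ((memLp_two_iff_integrable_sq_norm hf.aestronglyMeasurable).1 hf)).1 h2
  filter_upwards [h3] with t ht
  simpa using ht

lemma polyBargmann_zero (n : ℕ) : polyBargmann n 0 = 0 := by
  ext z
  simp [polyBargmann]

lemma polyBargmann_mem_polyFock {f : ℝ → ℂ} (hf : MemLp f 2 volume) {n m : ℕ} (h : n < m) :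
    polyBargmann n f ∈ polyFock m :=
  mem_polyFock_iff.2 ⟨(isPolyanalytic_polyBargmann hf n).mono h,
    (memLp_fockMeasure_iff (isPolyanalytic_polyBargmann hf n).continuous).1
      (memLp_polyBargmann hf n)⟩

lemma exists_eq_sum_of_mem_polyFock {m : ℕ} {F : ℂ → ℂ} (hF : F ∈ polyFock m) :
    ∃ f : ℕ → ℝ → ℂ, (∀ j, MemLp (f j) 2 volume) ∧
      F = fun z => ∑ j ∈ Finset.range m, polyBargmann j (f j) z := by
  obtain ⟨h1, h2⟩ := mem_polyFock_iff.1 hF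
  exact exists_eq_sum_polyBargmann h1 ((memLp_fockMeasure_iff h1.continuous).2 h2)

lemma integral_fockMeasure_eq (f g : ℂ → ℂ) :
    ∫ z : ℂ, f z * conj (g z) * (Real.exp (-Real.pi * ‖z‖ ^ 2) : ℂ) =
      ∫ z, f z * conj (g z) ∂fockMeasure := by
  rw [integral_fockMeasure]
  refine integral_congr_ae (.of_forall fun z => ?_)
  simp only [Complex.real_smul]
  ring

/-- The true polyanalytic Fock space is the range of the polyanalytic Bargmann transform. -/
theorem mem_truePolyFock_iff {n : ℕ} {F : ℂ → ℂ} : F ∈ truePolyFock (n + 1) ↔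
    ∃ f : ℝ → ℂ, MemLp f 2 volume ∧ F = polyBargmann n f := by
  have hint : ∀ {f g : ℝ → ℂ} (_ : MemLp f 2 volume) (_ : MemLp g 2 volume) (i j : ℕ),
      Integrable (fun z => polyBargmann i f z * conj (polyBargmann j g z)) fockMeasure :=
    fun hf hg i j => (memLp_polyBargmann hf i).integrable_mul (memLp_polyBargmann hg j).star
  constructor
  · rintro ⟨hF, horth⟩
    obtain ⟨f, hf, rfl⟩ := exists_eq_sum_of_mem_polyFock hF
    refine ⟨f n, hf n, ?_⟩
    -- Test against the `j`-th summand itself, which lies in `A²_n`; the other summands are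
    -- orthogonal to it.
    have h0 : ∀ j < n, f j =ᵐ[volume] 0 := fun j hj => by
      refine ae_eq_zero_of_polyBargmann_eq_zero (hf j) j ?_
      have h1 := horth _ (polyBargmann_mem_polyFock (hf j) (show j < n + 1 - 1 by omega))
      rw [integral_fockMeasure_eq] at h1
      rw [← h1]
      simp_rw [Finset.sum_mul]
      rw [integral_finsetSum _ fun i _ => hint (hf i) (hf j) i j, Finset.sum_eq_single j]
      · intro i _ hij
        rw [integral_polyBargmann_mul_conj (hf i) (hf j), integral_hermiteFun_mul_of_ne hij,
          mul_zero]
      · intro h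
        exact absurd (Finset.mem_range.2 (by omega)) h
    ext z
    rw [Finset.sum_range_succ, Finset.sum_eq_zero, zero_add]
    intro j hj
    rw [polyBargmann_congr_ae (h0 j (Finset.mem_range.1 hj)), polyBargmann_zero, Pi.zero_apply]
  · rintro ⟨f, hf, rfl⟩
    refine ⟨polyBargmann_mem_polyFock hf n.lt_succ_self, fun g hg => ?_⟩
    obtain ⟨u, hu, rfl⟩ := exists_eq_sum_of_mem_polyFock hg
    rw [integral_fockMeasure_eq]
    simp_rw [map_sum, Finset.mul_sum]
    rw [integral_finsetSum _ fun i _ => hint hf (hu i) n i]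
    refine Finset.sum_eq_zero fun i hi => ?_
    have hin : n ≠ i := by
      have := Finset.mem_range.1 hi
      omega
    rw [integral_polyBargmann_mul_conj hf (hu i), integral_hermiteFun_mul_of_ne hin, mul_zero]

/-! ### Completeness and uniqueness sets -/

lemma isUniquenessSet_iff (n : ℕ) (Λ : Set ℂ) : IsUniquenessSet Λ (truePolyFock (n + 1)) ↔
    ∀ f : ℝ → ℂ, MemLp f 2 volume → (∀ z ∈ Λ, polyBargmann n f z = 0) → f =ᵐ[volume] 0 := by
  constructor
  · intro h f hf hz
    have h1 := h _ (mem_truePolyFock_iff.2 ⟨f, hf, rfl⟩) hz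
    exact ae_eq_zero_of_polyBargmann_eq_zero hf n (by simp [h1])
  · intro h F hF hz
    obtain ⟨f, hf, rfl⟩ := mem_truePolyFock_iff.1 hF
    rw [polyBargmann_congr_ae (h f hf hz), polyBargmann_zero]

lemma polyBargmann_eq_zero_iff (n : ℕ) (f : ℝ → ℂ) (z : ℂ) :
    polyBargmann n f z = 0 ↔ hermiteSTFT n f z.re z.im = 0 := by
  rw [polyBargmann_eq, mul_eq_zero]
  exact or_iff_right (Complex.exp_ne_zero _)

lemma memLp_gaborSystem (n : ℕ) (α β : ℝ) :
    ∀ f ∈ gaborSystem (hermiteFun n) α β, MemLp f 2 (volume : Measure ℝ) := by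
  rintro _ ⟨k, l, rfl⟩
  have h : MemLp (translation (α * k) (hermiteFun n)) 2 volume :=
    (memLp_hermiteFun n).comp_measurePreserving (measurePreserving_sub_right _ _)
  refine h.mono (Continuous.aestronglyMeasurable (by fun_prop) |>.mul h.aestronglyMeasurable)
    (.of_forall fun x => ?_)
  have : (2 * Real.pi * Complex.I * ((β * l : ℝ) : ℂ) * x : ℂ) =
      ((2 * Real.pi * (β * l) * x : ℝ) : ℂ) * Complex.I := by
    push_cast; ring
  rw [modulation, norm_mul, this, Complex.norm_exp_ofReal_mul_I, one_mul]

lemma inner_gabor_eq (n : ℕ) (f : Lp ℂ 2 (volume : Measure ℝ)) (a b : ℝ)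
    (u : Lp ℂ 2 (volume : Measure ℝ))
    (hu : u =ᵐ[volume] modulation b (translation a (hermiteFun n))) :
    inner ℂ u f = hermiteSTFT n f a (-b) := by
  rw [L2.inner_def, hermiteSTFT]
  refine integral_congr_ae ?_
  filter_upwards [hu] with t ht
  rw [ht, RCLike.inner_apply, modulation, translation, map_mul, conj_hermiteFun,
    ← Complex.exp_conj]
  have : conj (2 * Real.pi * Complex.I * b * t : ℂ) =
      2 * Real.pi * Complex.I * ((-b : ℝ) : ℂ) * t := by
    simp only [map_mul, Complex.conj_ofReal, Complex.conj_I, map_ofNat]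
    push_cast; ring
  rw [this]
  ring

/-- A span is dense iff its orthogonal complement is trivial. Conjugating the modulation reverses
the frequency, so the atom `(k, l)` corresponds to the lattice point `(k, -l)`. -/
lemma isCompleteL2_iff (n : ℕ) (α β : ℝ) : IsCompleteL2 (gaborSystem (hermiteFun n) α β) ↔
    ∀ f : ℝ → ℂ, MemLp f 2 volume → (∀ z ∈ rectLattice α β, polyBargmann n f z = 0) →
      f =ᵐ[volume] 0 := by
  have hmem := memLp_gaborSystem n α β
  set S : Set (Lp ℂ 2 (volume : Measure ℝ)) :=
    {F | ∃ f ∈ gaborSystem (hermiteFun n) α β, F =ᵐ[volume] f} with hS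
  have hperp : ∀ f : Lp ℂ 2 (volume : Measure ℝ), f ∈ (Submodule.span ℂ S)ᗮ ↔
      ∀ z ∈ rectLattice α β, polyBargmann n f z = 0 := by
    intro f
    rw [Submodule.mem_orthogonal]
    constructor
    · rintro h _ ⟨k, l, rfl⟩
      have hg := hmem _ ⟨k, -l, rfl⟩
      have h1 := h hg.toLp (Submodule.subset_span ⟨_, ⟨k, -l, rfl⟩, hg.coeFn_toLp⟩)
      rw [inner_gabor_eq n f _ _ _ hg.coeFn_toLp] at h1
      rw [polyBargmann_eq_zero_iff]
      simpa using h1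
    · intro h u hu
      induction hu using Submodule.span_induction with
      | mem u hu =>
        obtain ⟨_, ⟨k, l, rfl⟩, hu⟩ := hu
        rw [inner_gabor_eq n f _ _ _ hu]
        have h1 := h _ ⟨k, -l, rfl⟩
        rw [polyBargmann_eq_zero_iff] at h1
        simpa using h1
      | zero => exact inner_zero_left _
      | add x y _ _ hx hy => rw [inner_add_left, hx, hy, add_zero]
      | smul a x _ hx => rw [inner_smul_left, hx, mul_zero]
  rw [IsCompleteL2, and_iff_right hmem, Submodule.dense_iff_topologicalClosure_eq_top,
    Submodule.topologicalClosure_eq_top_iff, Submodule.eq_bot_iff]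
  constructor
  · intro h f hf hz
    have h1 := h hf.toLp ((hperp _).2 fun z hz' => by
      rw [polyBargmann_congr_ae hf.coeFn_toLp]; exact hz z hz')
    have h2 := hf.coeFn_toLp
    rw [h1] at h2
    exact h2.symm.trans (Lp.coeFn_zero _ _ _)
  · intro h f hf
    exact (Lp.eq_zero_iff_ae_eq_zero).2 (h f (Lp.memLp f) ((hperp f).1 hf))

theorem isCompleteL2_iff_isUniquenessSet (n : ℕ) (α β : ℝ) :
    IsCompleteL2 (gaborSystem (hermiteFun n) α β) ↔
      IsUniquenessSet (rectLattice α β) (truePolyFock (n + 1)) :=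
  (isCompleteL2_iff n α β).trans (isUniquenessSet_iff n _).symm

end GaborHermite

namespace GaborHermite

/-! ### Uniqueness for Gaussian series -/

lemma summable_exp_neg_mul_abs {q : ℝ} (hq : 0 < q) :
    Summable fun j : ℤ => Real.exp (-q * |(j : ℝ)|) := by
  have h : Summable fun n : ℕ => Real.exp (-q * n) := by
    have := summable_geometric_of_lt_one (Real.exp_pos (-q)).le
      (by simpa using hq)
    refine this.congr fun n => ?_
    rw [← Real.exp_nat_mul, mul_comm]
  refine Summable.of_nat_of_neg ?_ ?_
  · simpa using h
  · simpa using h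

lemma summable_exp_quadratic {a : ℝ} (ha : 0 < a) (b : ℝ) :
    Summable fun j : ℤ => Real.exp (-a * (j : ℝ) ^ 2 + b * j) := by
  obtain ⟨C, hC, h⟩ := pow_mul_exp_le_exp_sq 0 (|b| + 1) ha
  refine Summable.of_nonneg_of_le (fun _ => (Real.exp_pos _).le) (fun j => ?_)
    ((summable_exp_neg_mul_abs one_pos).mul_left C)
  have h1 := h |(j : ℝ)| (abs_nonneg _)
  rw [pow_zero, one_mul, sq_abs] at h1
  have h2 : b * (j : ℝ) ≤ |b| * |(j : ℝ)| := by
    rw [← abs_mul]; exact le_abs_self _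
  calc Real.exp (-a * (j : ℝ) ^ 2 + b * j)
      ≤ Real.exp (-a * (j : ℝ) ^ 2 + |b| * |(j : ℝ)|) := by gcongr
    _ = Real.exp ((|b| + 1) * |(j : ℝ)|) * Real.exp (-a * (j : ℝ) ^ 2 - |(j : ℝ)|) := by
      rw [← Real.exp_add]; ring_nf
    _ ≤ (C * Real.exp (a * (j : ℝ) ^ 2)) * Real.exp (-a * (j : ℝ) ^ 2 - |(j : ℝ)|) := by gcongr
    _ = _ := by
      rw [mul_assoc, ← Real.exp_add]; ring_nf

lemma summable_exp_affine {a b : ℝ} (ha : 0 < a) (hb : b ≠ 0) (d : ℝ) :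
    Summable fun j : ℤ => Real.exp (-a * (b * j + d) ^ 2) := by
  have hb2 : 0 < b ^ 2 := by positivity
  refine ((summable_exp_quadratic (mul_pos ha hb2) (-2 * a * b * d)).mul_left
    (Real.exp (-a * d ^ 2))).congr fun j => ?_
  rw [← Real.exp_add]
  ring_nf

/-- For `0 < x ≤ exp (-q)` one has `1 - x ≥ exp (-K x)` with `K = 1 / (1 - exp (-q))`, and the
resulting exponents sum to a convergent series. -/
lemma exists_le_prod_one_sub_exp {q : ℝ} (hq : 0 < q) : ∃ κ : ℝ, 0 < κ ∧ ∀ N : ℕ,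
    κ ≤ ∏ l ∈ Finset.range N, (1 - Real.exp (-q * (l + 1))) := by
  have h0 : Real.exp (-q) < 1 := by simpa using hq
  set K := (1 - Real.exp (-q))⁻¹ with hK
  have hKpos : 0 < K := inv_pos.2 (sub_pos.2 h0)
  have hs : Summable fun l : ℕ => Real.exp (-q * ((l : ℝ) + 1)) := by
    have := (summable_geometric_of_lt_one (Real.exp_pos (-q)).le h0).mul_left (Real.exp (-q))
    refine this.congr fun n => ?_
    rw [← Real.exp_nat_mul, ← Real.exp_add]
    ring_nf
  refine ⟨Real.exp (-(K * ∑' l : ℕ, Real.exp (-q * ((l : ℝ) + 1)))), Real.exp_pos _, fun N => ?_⟩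
  have h1 : ∀ l : ℕ, Real.exp (-(K * Real.exp (-q * ((l : ℝ) + 1)))) ≤
      1 - Real.exp (-q * ((l : ℝ) + 1)) := by
    intro l
    set x := Real.exp (-q * ((l : ℝ) + 1)) with hx
    have hx0 : 0 < x := Real.exp_pos _
    have hx1 : x ≤ Real.exp (-q) := by
      rw [hx]
      have : 0 ≤ q * (l : ℝ) := by positivity
      gcongr
      linarith
    have h2 : 0 < 1 - x := by linarith
    have h3 : 1 ≤ K * (1 - x) := by
      rw [hK, inv_mul_eq_div, le_div_iff₀ (sub_pos.2 h0)]
      linarith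
    have h4 : 1 + K * x ≤ Real.exp (K * x) := by
      rw [add_comm]; exact Real.add_one_le_exp _
    rw [Real.exp_neg, inv_le_iff_one_le_mul₀ (Real.exp_pos _)]
    calc (1 : ℝ) ≤ (1 - x) * (1 + K * x) := by nlinarith
      _ ≤ _ := by gcongr
  calc Real.exp (-(K * ∑' l : ℕ, Real.exp (-q * ((l : ℝ) + 1))))
      ≤ Real.exp (-(K * ∑ l ∈ Finset.range N, Real.exp (-q * ((l : ℝ) + 1)))) := by
        gcongr
        exact hs.sum_le_tsum _ fun _ _ => (Real.exp_pos _).le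
    _ = ∏ l ∈ Finset.range N, Real.exp (-(K * Real.exp (-q * ((l : ℝ) + 1)))) := by
        rw [← Real.exp_sum, Finset.mul_sum, Finset.sum_neg_distrib]
    _ ≤ _ := Finset.prod_le_prod (fun _ _ => (Real.exp_pos _).le) fun l _ => h1 l

/-- The interpolating multiplier, vanishing at `1 ≤ |s| ≤ N`. -/
noncomputable def gaussMultiplier (q : ℝ) (N : ℕ) (s : ℤ) : ℝ :=
  ∏ l ∈ Finset.range N, ((1 - Real.exp (q * (s - (l + 1)))) * (1 - Real.exp (q * (s + (l + 1)))))

lemma gaussMultiplier_eq_zero (q : ℝ) {N : ℕ} {s : ℤ} (hs : s ≠ 0) (hN : s.natAbs ≤ N) :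
    gaussMultiplier q N s = 0 := by
  refine Finset.prod_eq_zero (i := s.natAbs - 1) (Finset.mem_range.2 (by omega)) ?_
  have h1 : (((s.natAbs - 1 : ℕ) : ℝ) + 1) = |(s : ℝ)| := by
    have : 1 ≤ s.natAbs := by omega
    rw [Nat.cast_sub this]
    simp [Nat.cast_natAbs]
  rw [h1]
  rcases abs_choice (s : ℝ) with h | h
  · simp [h]
  · simp [h]

/-- The multiplier has degree `2N` in `exp (q s)`, and `exp (-q N s)` centres it. For `s > N` each
pair of factors is at most `exp (2 q s)`; for `s < -N` it is at most `1`. -/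
lemma abs_gaussMultiplier_le {q : ℝ} (hq : 0 < q) {N : ℕ} {s : ℤ} (hN : N < s.natAbs) :
    Real.exp (-q * N * s) * |gaussMultiplier q N s| ≤ Real.exp (q * N * |(s : ℝ)|) := by
  have hl : ∀ l ∈ Finset.range N, (l : ℝ) + 1 ≤ |(s : ℝ)| := fun l hl => by
    have h1 : l + 1 ≤ s.natAbs := by
      have := Finset.mem_range.1 hl
      omega
    have h2 : ((l + 1 : ℕ) : ℝ) ≤ (s.natAbs : ℝ) := by exact_mod_cast h1
    simpa [Nat.cast_natAbs] using h2
  rw [gaussMultiplier, Finset.abs_prod]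
  rcases le_total 0 (s : ℝ) with hs | hs
  · rw [abs_of_nonneg hs] at hl ⊢
    have h1 : ∏ l ∈ Finset.range N, |(1 - Real.exp (q * (s - (l + 1)))) *
        (1 - Real.exp (q * (s + (l + 1))))| ≤ ∏ l ∈ Finset.range N, Real.exp (2 * q * s) := by
      refine Finset.prod_le_prod (fun _ _ => abs_nonneg _) fun l hl' => ?_
      have h2 := hl l hl'
      have e1 : |1 - Real.exp (q * (s - (l + 1)))| ≤ Real.exp (q * (s - (l + 1))) := by
        have : 1 ≤ Real.exp (q * (s - (l + 1))) := Real.one_le_exp (by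
          have : (0 : ℝ) ≤ s - (l + 1) := by linarith
          positivity)
        rw [abs_le]; constructor <;> linarith
      have e2 : |1 - Real.exp (q * (s + (l + 1)))| ≤ Real.exp (q * (s + (l + 1))) := by
        have : 1 ≤ Real.exp (q * (s + (l + 1))) := Real.one_le_exp (by positivity)
        rw [abs_le]; constructor <;> linarith
      rw [abs_mul]
      refine (mul_le_mul e1 e2 (abs_nonneg _) (Real.exp_pos _).le).trans_eq ?_
      rw [← Real.exp_add]
      ring_nf
    rw [Finset.prod_const, Finset.card_range, ← Real.exp_nat_mul] at h1
    refine (mul_le_mul_of_nonneg_left h1 (Real.exp_pos _).le).trans_eq ?_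
    rw [← Real.exp_add]
    ring_nf
  · rw [abs_of_nonpos hs] at hl ⊢
    have h1 : ∏ l ∈ Finset.range N, |(1 - Real.exp (q * (s - (l + 1)))) *
        (1 - Real.exp (q * (s + (l + 1))))| ≤ 1 := by
      refine Finset.prod_le_one (fun _ _ => abs_nonneg _) fun l hl' => ?_
      have h2 := hl l hl'
      have e : ∀ x : ℝ, x ≤ 0 → |1 - Real.exp x| ≤ 1 := fun x hx => by
        have h3 := Real.exp_pos x
        have h4 := Real.exp_le_one_iff.2 hx
        rw [abs_le]; constructor <;> linarith
      rw [abs_mul]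
      have l0 : (0 : ℝ) ≤ l := l.cast_nonneg
      exact mul_le_one₀ (e _ (by nlinarith)) (abs_nonneg _) (e _ (by nlinarith))
    refine (mul_le_mul_of_nonneg_left h1 (Real.exp_pos _).le).trans_eq ?_
    rw [mul_one]
    ring_nf

/-- At `s = 0` the pair of factors for `l` has modulus `(1 - exp (-q l))² * exp (q l)`, and the
exponents `q l`, `1 ≤ l ≤ N`, add up to `q N (N + 1) / 2`. -/
lemma exists_le_gaussMultiplier_zero {q : ℝ} (hq : 0 < q) : ∃ κ : ℝ, 0 < κ ∧ ∀ N : ℕ,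
    κ * Real.exp (q * (N * (N + 1) / 2)) ≤ |gaussMultiplier q N 0| := by
  obtain ⟨κ, hκ, h⟩ := exists_le_prod_one_sub_exp hq
  refine ⟨κ * κ, by positivity, fun N => ?_⟩
  have hsum : ∀ N : ℕ, ∑ l ∈ Finset.range N, q * ((l : ℝ) + 1) = q * (N * (N + 1) / 2) := by
    intro N
    induction N with
    | zero => simp
    | succ N ih => rw [Finset.sum_range_succ, ih]; push_cast; ring
  have h1 : |gaussMultiplier q N 0| = (∏ l ∈ Finset.range N, (1 - Real.exp (-q * (l + 1)))) *
      (∏ l ∈ Finset.range N, (1 - Real.exp (-q * (l + 1)))) *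
      Real.exp (q * (N * (N + 1) / 2)) := by
    rw [← hsum, Real.exp_sum, ← Finset.prod_mul_distrib, ← Finset.prod_mul_distrib,
      gaussMultiplier, Finset.abs_prod]
    refine Finset.prod_congr rfl fun l _ => ?_
    have e1 : Real.exp (q * (((0 : ℤ) : ℝ) - (l + 1))) = Real.exp (-q * (l + 1)) := by
      push_cast; ring_nf
    have e2 : Real.exp (q * (((0 : ℤ) : ℝ) + (l + 1))) = Real.exp (q * (l + 1)) := by
      push_cast; ring_nf
    have e3 : Real.exp (-q * (l + 1)) * Real.exp (q * (l + 1)) = 1 := by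
      rw [← Real.exp_add, Real.exp_eq_one_iff]; ring
    have h2 : Real.exp (-q * (l + 1)) ≤ 1 := Real.exp_le_one_iff.2 (by
      have : 0 ≤ q * ((l : ℝ) + 1) := by positivity
      linarith)
    have h3 : 1 ≤ Real.exp (q * (l + 1)) := Real.one_le_exp (by positivity)
    rw [e1, e2, abs_mul, abs_of_nonneg (by linarith), abs_of_nonpos (by linarith)]
    linear_combination (1 - Real.exp (-q * (l + 1))) * e3
  rw [h1]
  gcongr
  · exact hκ.le.trans (h N)
  · exact h N
  · exact h N

/-- Each new pair of factors is `1 - (exp (-q l) + exp (q l)) X + X²` in `X = exp (q s)`, so it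
amounts to combining the equations with indices `k`, `k + 1`, `k + 2`. -/
lemma hasSum_mul_gaussMultiplier {q : ℝ} {D : ℤ → ℂ}
    (hD : ∀ k : ℤ, HasSum (fun s : ℤ => D s * Real.exp (q * k * s)) 0) (N : ℕ) (k : ℤ) :
    HasSum (fun s : ℤ => D s * ((Real.exp (q * k * s) * gaussMultiplier q N s : ℝ) : ℂ)) 0 := by
  induction N generalizing k with
  | zero => simpa [gaussMultiplier] using hD k
  | succ N ih =>
    have h1 := (((ih k).sub ((ih (k + 1)).mul_left
      (((Real.exp (-q * (N + 1)) + Real.exp (q * (N + 1)) : ℝ) : ℂ)))).add (ih (k + 2)))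
    simp only [mul_zero, sub_zero, add_zero] at h1
    have e : (fun s : ℤ =>
        D s * ((Real.exp (q * k * s) * gaussMultiplier q (N + 1) s : ℝ) : ℂ)) = fun s : ℤ =>
        D s * ((Real.exp (q * k * s) * gaussMultiplier q N s : ℝ) : ℂ) -
        ((Real.exp (-q * (N + 1)) + Real.exp (q * (N + 1)) : ℝ) : ℂ) *
          (D s * ((Real.exp (q * (k + 1 : ℤ) * s) * gaussMultiplier q N s : ℝ) : ℂ)) +
        D s * ((Real.exp (q * (k + 2 : ℤ) * s) * gaussMultiplier q N s : ℝ) : ℂ) := by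
      funext s
      have e1 : Real.exp (q * k * s) * gaussMultiplier q (N + 1) s =
          Real.exp (q * k * s) * gaussMultiplier q N s -
          (Real.exp (-q * (N + 1)) + Real.exp (q * (N + 1))) *
            (Real.exp (q * (k + 1 : ℤ) * s) * gaussMultiplier q N s) +
          Real.exp (q * (k + 2 : ℤ) * s) * gaussMultiplier q N s := by
        have a1 : Real.exp (q * (s - (N + 1))) = Real.exp (-q * (N + 1)) * Real.exp (q * s) := by
          rw [← Real.exp_add]; ring_nf
        have a2 : Real.exp (q * (s + (N + 1))) = Real.exp (q * (N + 1)) * Real.exp (q * s) := by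
          rw [← Real.exp_add]; ring_nf
        have a3 : Real.exp (q * (k + 1 : ℤ) * s) = Real.exp (q * k * s) * Real.exp (q * s) := by
          rw [← Real.exp_add]; push_cast; ring_nf
        have a4 : Real.exp (q * (k + 2 : ℤ) * s) =
            Real.exp (q * k * s) * Real.exp (q * s) * Real.exp (q * s) := by
          rw [← Real.exp_add, ← Real.exp_add]; push_cast; ring_nf
        have a5 : Real.exp (-q * (N + 1)) * Real.exp (q * (N + 1)) = 1 := by
          rw [← Real.exp_add, Real.exp_eq_one_iff]; ring
        have a6 : gaussMultiplier q (N + 1) s = gaussMultiplier q N s *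
            ((1 - Real.exp (q * (s - (N + 1)))) * (1 - Real.exp (q * (s + (N + 1))))) := by
          rw [gaussMultiplier, Finset.prod_range_succ, ← gaussMultiplier]
        rw [a6, a1, a2, a3, a4]
        linear_combination (Real.exp (q * k * s) * gaussMultiplier q N s *
          Real.exp (q * s) * Real.exp (q * s)) * a5
      rw [e1]
      push_cast
      ring
    rw [e]
    exact h1

/-- Use the multiplied equation with `k = -N`. Only `s = 0` and `|s| > N` remain; the tail is `O(exp
(q N² / 2))` while the central coefficient grows like `exp (q N (N + 1) / 2)`. Thus `‖D 0‖ * exp (q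
N / 2)` stays bounded as `N → ∞`. -/
lemma apply_zero_eq_zero_of_hasSum_exp {q B : ℝ} (hq : 0 < q) {D : ℤ → ℂ}
    (hB : ∀ s : ℤ, ‖D s‖ ≤ B * Real.exp (-(q / 2) * (s : ℝ) ^ 2))
    (hD : ∀ k : ℤ, HasSum (fun s : ℤ => D s * Real.exp (q * k * s)) 0) : D 0 = 0 := by
  have hB0 : 0 ≤ B := by
    have := (norm_nonneg _).trans (hB 0)
    simpa using this
  obtain ⟨κ, hκ, hκN⟩ := exists_le_gaussMultiplier_zero hq
  set S := ∑' s : ℤ, Real.exp (-(q / 2) * (s : ℝ) ^ 2) with hS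
  have hsum : Summable fun s : ℤ => Real.exp (-(q / 2) * (s : ℝ) ^ 2) := by
    simpa using summable_exp_quadratic (half_pos hq) 0
  have hshift : ∀ M : ℤ, HasSum (fun s : ℤ => Real.exp (-(q / 2) * ((s : ℝ) + M) ^ 2)) S := by
    intro M
    have := (Equiv.addRight M).hasSum_iff.2 hsum.hasSum
    simpa [Function.comp_def, hS] using this
  have hN : ∀ N : ℕ, ‖D 0‖ * (κ * Real.exp (q * N / 2)) ≤ 2 * B * S := by
    intro N
    have h0 := hasSum_mul_gaussMultiplier hD N (-N)
    have h1 := h0.sub (hasSum_ite_eq (0 : ℤ) (D 0 * ((gaussMultiplier q N 0 : ℝ) : ℂ)))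
    have hbd := (((hshift (-N)).add (hshift N)).mul_left (B * Real.exp (q * N ^ 2 / 2)))
    have h2 := h1.norm_le_of_bounded hbd (fun s => ?_)
    · rw [zero_sub, norm_neg, norm_mul, Complex.norm_real, Real.norm_eq_abs] at h2
      have h3 : ‖D 0‖ * (κ * Real.exp (q * (N * (N + 1) / 2))) ≤
          B * Real.exp (q * N ^ 2 / 2) * (S + S) :=
        (mul_le_mul_of_nonneg_left (hκN N) (norm_nonneg _)).trans h2
      have h4 : Real.exp (q * (N * (N + 1) / 2)) =
          Real.exp (q * N / 2) * Real.exp (q * N ^ 2 / 2) := by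
        rw [← Real.exp_add]; ring_nf
      rw [h4] at h3
      refine le_of_mul_le_mul_right ?_ (Real.exp_pos (q * N ^ 2 / 2))
      linarith
    · have hnn : 0 ≤ B * Real.exp (q * N ^ 2 / 2) *
          (Real.exp (-(q / 2) * ((s : ℝ) + (-N : ℤ)) ^ 2) +
            Real.exp (-(q / 2) * ((s : ℝ) + (N : ℤ)) ^ 2)) := by positivity
      by_cases hs : s = 0
      · subst hs
        simpa using hnn
      rw [if_neg hs, sub_zero]
      by_cases hsN : s.natAbs ≤ N
      · rw [gaussMultiplier_eq_zero q hs hsN]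
        simpa using hnn
      · have h5 := abs_gaussMultiplier_le hq (not_le.1 hsN)
        rw [norm_mul, Complex.norm_real, norm_mul, Real.norm_of_nonneg (Real.exp_pos _).le,
          Real.norm_eq_abs]
        have h6 : Real.exp (q * (-N : ℤ) * s) = Real.exp (-q * N * s) := by
          push_cast; ring_nf
        rw [h6]
        -- Completing the square moves the Gaussian to `|s| = N`, so its total mass is bounded
        -- independently of `N`.
        have h7 : Real.exp (-(q / 2) * (s : ℝ) ^ 2) * Real.exp (q * N * |(s : ℝ)|) =
            Real.exp (q * N ^ 2 / 2) * Real.exp (-(q / 2) * (|(s : ℝ)| - N) ^ 2) := by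
          rw [← Real.exp_add, ← Real.exp_add, ← sq_abs (s : ℝ)]
          ring_nf
        have h8 : Real.exp (-(q / 2) * (|(s : ℝ)| - N) ^ 2) ≤
            Real.exp (-(q / 2) * ((s : ℝ) + (-N : ℤ)) ^ 2) +
            Real.exp (-(q / 2) * ((s : ℝ) + (N : ℤ)) ^ 2) := by
          push_cast
          rcases abs_choice (s : ℝ) with h | h
          · rw [h, ← sub_eq_add_neg]
            linarith [Real.exp_pos (-(q / 2) * ((s : ℝ) + N) ^ 2)]
          · rw [h]
            have : (-(s : ℝ) - N) ^ 2 = ((s : ℝ) + N) ^ 2 := by ring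
            rw [this]
            linarith [Real.exp_pos (-(q / 2) * ((s : ℝ) + -N) ^ 2)]
        calc ‖D s‖ * (Real.exp (-q * N * s) * |gaussMultiplier q N s|)
            ≤ (B * Real.exp (-(q / 2) * (s : ℝ) ^ 2)) * Real.exp (q * N * |(s : ℝ)|) :=
              mul_le_mul (hB s) h5 (by positivity) (by positivity)
          _ = B * Real.exp (q * N ^ 2 / 2) * Real.exp (-(q / 2) * (|(s : ℝ)| - N) ^ 2) := by
              rw [mul_assoc, h7, mul_assoc]
          _ ≤ _ := by gcongr
  by_contra hne
  have hpos : 0 < ‖D 0‖ := norm_pos_iff.2 hne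
  obtain ⟨N, hNN⟩ := exists_nat_gt (2 * B * S / (‖D 0‖ * κ * (q / 2)))
  have h1 := hN N
  have h2 : q * N / 2 + 1 ≤ Real.exp (q * N / 2) := Real.add_one_le_exp _
  rw [div_lt_iff₀ (by positivity)] at hNN
  have h3 : ‖D 0‖ * κ * (q * N / 2) ≤ ‖D 0‖ * κ * Real.exp (q * N / 2) := by
    gcongr; linarith
  linarith

/-- A bounded sequence orthogonal to all translates by `θ ≤ 1` of a Gaussian on `ℤ` vanishes. -/
theorem eq_zero_of_gaussian_series {a θ B : ℝ} (ha : 0 < a) (hθ : 0 < θ) (hθ1 : θ ≤ 1)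
    {c : ℤ → ℂ} (hB : ∀ j, ‖c j‖ ≤ B)
    (hc : ∀ k : ℤ, ∑' j : ℤ, c j * Real.exp (-a * ((j : ℝ) - θ * k) ^ 2) = 0) (j₀ : ℤ) :
    c j₀ = 0 := by
  have hB0 : 0 ≤ B := (norm_nonneg _).trans (hB 0)
  set q := 2 * a * θ with hq
  have hqpos : 0 < q := by positivity
  -- This is where `θ ≤ 1` enters: the Gaussian must decay at least as fast as `exp (-(q / 2) s²)`.
  have hqa : q / 2 ≤ a := by
    rw [hq]; nlinarith
  set D : ℤ → ℂ := fun s => c (s + j₀) *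
    ((Real.exp (-a * ((s : ℝ) + j₀) ^ 2) * Real.exp (q * j₀ * s) : ℝ) : ℂ) with hD
  have h0 : D 0 = 0 := by
    refine apply_zero_eq_zero_of_hasSum_exp (B := B * Real.exp (-a * j₀ ^ 2 +
      (a - q / 2) * j₀ ^ 2)) hqpos (fun s => ?_) (fun k => ?_)
    · simp only [hD]
      rw [norm_mul, Complex.norm_real, Real.norm_of_nonneg (by positivity), mul_assoc B]
      refine mul_le_mul (hB _) ?_ (by positivity) hB0
      rw [← Real.exp_add, ← Real.exp_add]
      refine Real.exp_le_exp.2 ?_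
      nlinarith [mul_nonneg (sub_nonneg.2 hqa) (sq_nonneg ((s : ℝ) + j₀))]
    · have hs : Summable fun j : ℤ => c j *
          Real.exp (-a * ((j : ℝ) - θ * (k + j₀ : ℤ)) ^ 2) := by
        refine Summable.of_norm_bounded
          ((summable_exp_affine ha one_ne_zero (-(θ * (k + j₀ : ℤ)))).mul_left B) fun j => ?_
        rw [norm_mul, Complex.norm_real, Real.norm_of_nonneg (Real.exp_pos _).le, one_mul,
          ← sub_eq_add_neg]
        gcongr
        exact hB j
      have h1 := hs.hasSum
      rw [hc] at h1
      -- Take the equation of index `k + j₀`, recentre the sum at `j₀` and expand the square; the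
      -- multiplier cancels the part of the exponent independent of `s`.
      have h2 := ((Equiv.addRight j₀).hasSum_iff.2 h1).mul_left
        ((Real.exp (a * θ ^ 2 * (k + j₀) ^ 2 - q * k * j₀ - q * j₀ ^ 2) : ℝ) : ℂ)
      rw [mul_zero] at h2
      refine Eq.subst (motive := fun F => HasSum F 0) (funext fun s => ?_) h2
      simp only [Function.comp_apply, Equiv.coe_addRight, hD]
      rw [mul_left_comm, mul_assoc (c _)]
      congr 1
      rw [← Complex.ofReal_mul, ← Complex.ofReal_mul, ← Real.exp_add, ← Real.exp_add,
        ← Real.exp_add]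
      congr 2
      rw [hq]
      push_cast
      ring
  simp only [hD, zero_add] at h0
  refine (mul_eq_zero.1 h0).resolve_right ?_
  refine Complex.ofReal_ne_zero.2 ?_
  positivity

end GaborHermite

namespace GaborHermite
open Polynomial

/-! ### Zak type matrices -/

lemma tsum_int_eq_sum_fin (p : ℕ) [NeZero p] {F : ℤ → ℂ} (hF : Summable F) :
    ∑' j, F j = ∑ s : Fin p, ∑' m : ℤ, F (m * p + (s : ℕ)) := by
  set e := (Equiv.prodComm (Fin p) ℤ).trans (Int.divModEquiv p).symm with he
  have hs : Summable fun x : Fin p × ℤ => F (e x) := e.summable_iff.2 hF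
  rw [← e.tsum_eq F, hs.tsum_prod, tsum_fintype]
  rfl

lemma norm_eval_mul_gaussian_le (P : ℂ[X]) (R : ℝ) : ∃ C : ℝ, 0 < C ∧ ∀ (x : ℂ) (τ : ℝ), ‖x‖ ≤ R →
    ‖P.eval (x + τ) * Complex.exp (-Real.pi * (x + τ) ^ 2)‖ ≤
      C * Real.exp (-(Real.pi / 4) * τ ^ 2) := by
  obtain ⟨C, hC, h⟩ := norm_eval_le_exp_sq P (by positivity : (0 : ℝ) < Real.pi / 8)
  obtain ⟨D, hD, h'⟩ := pow_mul_exp_le_exp_sq 0 (2 * Real.pi * R)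
    (by positivity : (0 : ℝ) < Real.pi / 2)
  refine ⟨C * D * Real.exp (Real.pi / 4 * R ^ 2 + Real.pi * R ^ 2), by positivity,
    fun x τ hx => ?_⟩
  have hpi := Real.pi_pos
  have hR : 0 ≤ R := (norm_nonneg _).trans hx
  have h1 : ‖P.eval (x + τ)‖ ≤ C * Real.exp (Real.pi / 4 * R ^ 2 + Real.pi / 4 * τ ^ 2) := by
    refine (h _).trans ?_
    have h2 : ‖x + τ‖ ≤ R + |τ| := (norm_add_le _ _).trans (by
      rw [Complex.norm_real, Real.norm_eq_abs]; gcongr)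
    have h3 : ‖x + τ‖ ^ 2 ≤ 2 * R ^ 2 + 2 * τ ^ 2 := by
      have h4 : ‖x + τ‖ ^ 2 ≤ (R + |τ|) ^ 2 := by gcongr
      nlinarith [sq_abs τ, sq_nonneg (R - |τ|)]
    gcongr
    nlinarith
  have h2 : ‖Complex.exp (-Real.pi * (x + τ) ^ 2)‖ ≤
      Real.exp (Real.pi * R ^ 2 - Real.pi * τ ^ 2 + 2 * Real.pi * R * |τ|) := by
    rw [Complex.norm_exp]
    refine Real.exp_le_exp.2 ?_
    have e : (-Real.pi * (x + τ) ^ 2 : ℂ).re = -Real.pi * ((x.re + τ) ^ 2 - x.im ^ 2) := by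
      have : (-Real.pi * (x + τ) ^ 2 : ℂ) = ((-Real.pi : ℝ) : ℂ) * (x + τ) ^ 2 := by
        push_cast; ring
      rw [this, Complex.re_ofReal_mul, sq, Complex.mul_re]
      simp
      ring
    rw [e]
    have h3 : x.im ^ 2 ≤ R ^ 2 := by
      rw [← sq_abs]
      gcongr
      exact (Complex.abs_im_le_norm x).trans hx
    have h4 : -(x.re * τ) ≤ R * |τ| := (neg_le_abs _).trans (by
      rw [abs_mul]; gcongr; exact (Complex.abs_re_le_norm x).trans hx)
    nlinarith [sq_nonneg x.re]
  have h3 := h' |τ| (abs_nonneg _)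
  rw [pow_zero, one_mul, sq_abs] at h3
  rw [norm_mul]
  calc ‖P.eval (x + τ)‖ * ‖Complex.exp (-Real.pi * (x + τ) ^ 2)‖
      ≤ (C * Real.exp (Real.pi / 4 * R ^ 2 + Real.pi / 4 * τ ^ 2)) *
        Real.exp (Real.pi * R ^ 2 - Real.pi * τ ^ 2 + 2 * Real.pi * R * |τ|) :=
        mul_le_mul h1 h2 (norm_nonneg _) (by positivity)
    _ = C * Real.exp (Real.pi / 4 * R ^ 2 + Real.pi * R ^ 2 - 3 * Real.pi / 4 * τ ^ 2) *
        Real.exp (2 * Real.pi * R * |τ|) := by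
        rw [mul_assoc C, mul_assoc C, ← Real.exp_add, ← Real.exp_add]; ring_nf
    _ ≤ C * Real.exp (Real.pi / 4 * R ^ 2 + Real.pi * R ^ 2 - 3 * Real.pi / 4 * τ ^ 2) *
        (D * Real.exp (Real.pi / 2 * τ ^ 2)) := by gcongr
    _ = C * D * (Real.exp (Real.pi / 4 * R ^ 2 + Real.pi * R ^ 2 - 3 * Real.pi / 4 * τ ^ 2) *
        Real.exp (Real.pi / 2 * τ ^ 2)) := by ring
    _ = C * D * (Real.exp (Real.pi / 4 * R ^ 2 + Real.pi * R ^ 2) *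
        Real.exp (-(Real.pi / 4) * τ ^ 2)) := by
        rw [← Real.exp_add, ← Real.exp_add]; ring_nf
    _ = _ := by ring

/-- The sampling nodes `b (p m + s) - b p r / q`. -/
noncomputable def zakNode (b : ℝ) (p q r s : ℕ) (m : ℤ) : ℝ := b * (p * m + s) - b * p * r / q

lemma summable_zakNode {b c : ℝ} (hb : b ≠ 0) (hc : 0 < c) {p : ℕ} (hp : p ≠ 0) (q r s : ℕ) :
    Summable fun m : ℤ => Real.exp (-c * zakNode b p q r s m ^ 2) := by
  have hbp : b * p ≠ 0 := mul_ne_zero hb (by exact_mod_cast hp)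
  refine (summable_exp_affine hc hbp (b * s - b * p * r / q)).congr fun m => ?_
  rw [zakNode]
  ring_nf

/-- The Zibulski-Zeevi type matrix of the window `P(x) exp(-π x²)`. -/
noncomputable def zakMatrix (P : ℂ[X]) (b : ℝ) (p q : ℕ) (x : ℂ) (ξ : UnitAddCircle) :
    Matrix (Fin q) (Fin p) ℂ := fun r s =>
  ∑' m : ℤ, P.eval (x + zakNode b p q r s m) *
    Complex.exp (-Real.pi * (x + zakNode b p q r s m) ^ 2) * fourier m ξ

lemma norm_fourier_apply (m : ℤ) (ξ : UnitAddCircle) : ‖fourier m ξ‖ = 1 := by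
  rw [fourier_apply]; exact Circle.norm_coe _

/-- Joint continuity in both variables supplies the measurability needed to exchange "almost every
`x`" and "almost every `ξ`". -/
lemma continuous_zakMatrix (P : ℂ[X]) {b : ℝ} (hb : b ≠ 0) {p : ℕ} (hp : p ≠ 0) (q : ℕ) :
    Continuous fun y : ℂ × UnitAddCircle => zakMatrix P b p q y.1 y.2 := by
  refine continuous_pi fun r => continuous_pi fun s => continuous_iff_continuousAt.2 fun y => ?_
  obtain ⟨C, hC, h⟩ := norm_eval_mul_gaussian_le P (‖y.1‖ + 1)
  have hon : ContinuousOn (fun y : ℂ × UnitAddCircle => zakMatrix P b p q y.1 y.2 r s)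
      {w | ‖w.1‖ < ‖y.1‖ + 1} := by
    refine continuousOn_tsum (u := fun m => C *
      Real.exp (-(Real.pi / 4) * zakNode b p q r s m ^ 2)) (fun m => ?_)
      ((summable_zakNode hb (by positivity) hp q r s).mul_left C) (fun m w hw => ?_)
    · exact Continuous.continuousOn (by fun_prop)
    · rw [norm_mul, norm_fourier_apply, mul_one]
      exact h _ _ (le_of_lt hw)
  refine hon.continuousAt (IsOpen.mem_nhds ?_ ?_)
  · exact isOpen_lt (by fun_prop) continuous_const
  · simp

lemma differentiable_zakMatrix (P : ℂ[X]) {b : ℝ} (hb : b ≠ 0) {p : ℕ} (hp : p ≠ 0) (q : ℕ)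
    (ξ : UnitAddCircle) (r : Fin q) (s : Fin p) :
    Differentiable ℂ fun x => zakMatrix P b p q x ξ r s := by
  intro x
  obtain ⟨C, hC, h⟩ := norm_eval_mul_gaussian_le P (‖x‖ + 1)
  have hon : DifferentiableOn ℂ (fun x => zakMatrix P b p q x ξ r s) {w | ‖w‖ < ‖x‖ + 1} := by
    refine Complex.differentiableOn_tsum_of_summable_norm
      ((summable_zakNode hb (c := Real.pi / 4) (by positivity) hp q r s).mul_left C) (fun m => ?_)
      (isOpen_lt (by fun_prop) continuous_const) (fun m w hw => ?_)
    · refine Differentiable.differentiableOn (Differentiable.mul_const (Differentiable.mul ?_ ?_) _)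
      · exact P.differentiable.comp (differentiable_id.add_const _)
      · fun_prop
    · rw [norm_mul, norm_fourier_apply, mul_one]
      exact h _ _ (le_of_lt hw)
  exact hon.differentiableAt ((isOpen_lt (by fun_prop) continuous_const).mem_nhds (by simp))

-- Since `Zᴴ Z` and `Z` have the same kernel, injectivity of a rectangular matrix becomes
-- nonvanishing of a scalar that is continuous in `Z`.
open scoped ComplexOrder in
lemma det_conjTranspose_mul_self_ne_zero_iff {p q : ℕ} (Z : Matrix (Fin q) (Fin p) ℂ) :
    (Z.conjTranspose * Z).det ≠ 0 ↔ ∀ v, Z.mulVec v = 0 → v = 0 := by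
  constructor
  · intro h v hv
    refine Matrix.eq_zero_of_mulVec_eq_zero h ?_
    rw [← Matrix.mulVec_mulVec, hv, Matrix.mulVec_zero]
  · intro h h0
    obtain ⟨v, hv, hZ⟩ := Matrix.exists_mulVec_eq_zero_iff.2 h0
    exact hv (h v ((Matrix.conjTranspose_mul_self_mulVec_eq_zero _ _).1 hZ))

/-- At `x = 0`, the matrix of the Gaussian is injective. -/
lemma zakMatrix_gaussian_injective {b : ℝ} (hb : b ≠ 0) {p q : ℕ} (hp : p ≠ 0) (hpq : p ≤ q)
    (ξ : UnitAddCircle) (v : Fin p → ℂ) (hv : (zakMatrix 1 b p q 0 ξ).mulVec v = 0) : v = 0 := by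
  have : NeZero p := ⟨hp⟩
  have hq : 0 < q := by omega
  have hq' : (q : ℝ) ≠ 0 := by exact_mod_cast hq.ne'
  have hp' : (0 : ℝ) < p := by exact_mod_cast Nat.pos_of_ne_zero hp
  -- A kernel vector extends to the bounded quasi-periodic sequence `c (m p + s) = fourier m ξ * v
  -- s`, and the kernel equations become annihilation by Gaussians centred at multiples of `p / q`.
  set c : ℤ → ℂ := fun j =>
    fourier (((Int.divModEquiv p) j).1) ξ * v ((Int.divModEquiv p) j).2 with hc
  have hcj : ∀ (m : ℤ) (s : Fin p), c (m * p + (s : ℕ)) = fourier m ξ * v s := fun m s => by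
    have : (Int.divModEquiv p) (m * p + (s : ℕ)) = (m, s) :=
      (Int.divModEquiv p).apply_symm_apply (m, s)
    simp only [hc, this]
  have hbd : ∀ j, ‖c j‖ ≤ ∑ s, ‖v s‖ := fun j => by
    simp only [hc, norm_mul, norm_fourier_apply, one_mul]
    exact Finset.single_le_sum (f := fun s => ‖v s‖) (fun _ _ => norm_nonneg _)
      (Finset.mem_univ _)
  have hb2 : 0 < b ^ 2 := by positivity
  have key := eq_zero_of_gaussian_series (a := Real.pi * b ^ 2) (θ := p / q) (c := c)
    (by positivity) (by positivity)
    (by rw [div_le_one (by exact_mod_cast hq)]; exact_mod_cast hpq) hbd (fun k => ?_)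
  · ext s
    have h1 := key (0 * p + (s : ℕ))
    rw [hcj, fourier_zero, one_mul] at h1
    exact h1
  -- Rows give only `0 ≤ r < q`; shifting the sum by `k' p` reaches every `k`, at the cost of the
  -- factor `fourier k' ξ`.
  · obtain ⟨k', r, rfl⟩ : ∃ (k' : ℤ) (r : Fin q), k = q * k' + (r : ℕ) := by
      refine ⟨k / q, ⟨(k % q).toNat, ?_⟩, ?_⟩
      · have := Int.emod_lt_of_pos k (by exact_mod_cast hq : (0 : ℤ) < q)
        have := Int.emod_nonneg k (by exact_mod_cast hq.ne' : (q : ℤ) ≠ 0)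
        omega
      · have := Int.emod_nonneg k (by exact_mod_cast hq.ne' : (q : ℤ) ≠ 0)
        simp only [Int.toNat_of_nonneg this]
        exact (Int.mul_ediv_add_emod k q).symm
    rw [← (Equiv.addRight (k' * p)).tsum_eq, tsum_int_eq_sum_fin p]
    · have h1 := congrFun hv r
      rw [Matrix.mulVec, dotProduct, Pi.zero_apply] at h1
      rw [← mul_zero (fourier k' ξ), ← h1, Finset.mul_sum]
      refine Finset.sum_congr rfl fun s _ => ?_
      rw [zakMatrix, ← tsum_mul_right, ← tsum_mul_left]
      refine tsum_congr fun m => ?_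
      have e : (Equiv.addRight (k' * (p : ℤ))) (m * p + (s : ℕ)) = (m + k') * p + (s : ℕ) := by
        simp only [Equiv.coe_addRight]; ring
      rw [e, hcj, fourier_add, eval_one, one_mul, zero_add, Complex.ofReal_exp]
      have e2 : (((-(Real.pi * b ^ 2) * ((((m + k') * p + (s : ℕ) : ℤ) : ℝ) -
          p / q * ((q * k' + (r : ℕ) : ℤ) : ℝ)) ^ 2 : ℝ)) : ℂ) =
          -Real.pi * (zakNode b p q r s m : ℂ) ^ 2 := by
        rw [← Complex.ofReal_pow, ← Complex.ofReal_neg, ← Complex.ofReal_mul]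
        congr 1
        rw [zakNode]
        push_cast
        field_simp
        ring
      rw [e2]
      ring
    · have hs := summable_exp_affine (a := Real.pi * b ^ 2) (by positivity) one_ne_zero
        (-((p / q : ℝ) * ((q * k' + (r : ℕ) : ℤ) : ℝ)))
      have hs2 : Summable fun j : ℤ => c j * ((Real.exp (-(Real.pi * b ^ 2) *
          ((j : ℝ) - p / q * ((q * k' + (r : ℕ) : ℤ) : ℝ)) ^ 2) : ℝ) : ℂ) := by
        refine Summable.of_norm_bounded (hs.mul_left (∑ s, ‖v s‖)) fun j => ?_
        rw [norm_mul, Complex.norm_real, Real.norm_of_nonneg (Real.exp_pos _).le, one_mul,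
          ← sub_eq_add_neg]
        gcongr
        exact hbd j
      exact (Equiv.addRight (k' * (p : ℤ))).summable_iff.2 hs2

/-! ### Degeneration to the Gaussian matrix along the imaginary axis. -/

/-- The homogenization `ε ^ n * P(i / ε + τ)`. -/
noncomputable def homogEval (P : ℂ[X]) (n : ℕ) (ε τ : ℝ) : ℂ :=
  ∑ k ∈ Finset.range (n + 1), P.coeff k * (Complex.I + τ * ε) ^ k * (ε : ℂ) ^ (n - k)

lemma homogEval_eq {P : ℂ[X]} {n : ℕ} (hP : P.natDegree ≤ n) {ε : ℝ} (hε : ε ≠ 0) (τ : ℝ) :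
    homogEval P n ε τ = (ε : ℂ) ^ n * P.eval (Complex.I / ε + τ) := by
  have hε' : (ε : ℂ) ≠ 0 := by exact_mod_cast hε
  rw [eval_eq_sum_range' (n := n + 1) (by omega), Finset.mul_sum]
  refine Finset.sum_congr rfl fun k hk => ?_
  have hk' : k ≤ n := by
    have := Finset.mem_range.1 hk
    omega
  have h1 : (Complex.I / ε + τ : ℂ) = (Complex.I + τ * ε) / ε := by field_simp
  rw [h1, div_pow, ← pow_sub_mul_pow (ε : ℂ) hk']
  field_simp

lemma homogEval_zero (P : ℂ[X]) (n : ℕ) (τ : ℝ) :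
    homogEval P n 0 τ = P.coeff n * Complex.I ^ n := by
  rw [homogEval, Finset.sum_eq_single n]
  · simp
  · intro k hk hkn
    have : n - k ≠ 0 := by
      have := Finset.mem_range.1 hk
      omega
    simp [this]
  · simp

/-- Uniformity down to and including `ε = 0` lets the limit pass through the series over the nodes.
-/
lemma norm_homogEval_le (P : ℂ[X]) (n : ℕ) : ∃ C : ℝ, 0 < C ∧ ∀ ε τ : ℝ, |ε| ≤ 1 →
    ‖homogEval P n ε τ * Complex.exp (-Real.pi * (τ : ℂ) ^ 2)‖ ≤
      C * Real.exp (-(Real.pi / 2) * τ ^ 2) := by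
  obtain ⟨C, hC, h⟩ := pow_mul_exp_le_exp_sq n 0 (by positivity : (0 : ℝ) < Real.pi / 4)
  refine ⟨(∑ k ∈ Finset.range (n + 1), ‖P.coeff k‖ + 1) * (C * Real.exp (Real.pi / 2)),
    by positivity, fun ε τ hε => ?_⟩
  have h1 := h (1 + |τ|) (by positivity)
  rw [zero_mul, Real.exp_zero, mul_one] at h1
  have h2 : Real.exp (Real.pi / 4 * (1 + |τ|) ^ 2) ≤
      Real.exp (Real.pi / 2) * Real.exp (Real.pi / 2 * τ ^ 2) := by
    rw [← Real.exp_add]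
    refine Real.exp_le_exp.2 ?_
    have := Real.pi_pos
    have h3 : (1 + |τ|) ^ 2 ≤ 2 + 2 * τ ^ 2 := by nlinarith [sq_abs τ, sq_nonneg (1 - |τ|)]
    nlinarith
  have h3 : ‖homogEval P n ε τ‖ ≤ (∑ k ∈ Finset.range (n + 1), ‖P.coeff k‖) * (1 + |τ|) ^ n := by
    rw [homogEval, Finset.sum_mul]
    refine (norm_sum_le _ _).trans (Finset.sum_le_sum fun k hk => ?_)
    have hk' : k ≤ n := by
      have := Finset.mem_range.1 hk
      omega
    rw [norm_mul, norm_mul, norm_pow, norm_pow, mul_assoc]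
    have a1 : ‖(Complex.I + τ * ε : ℂ)‖ ≤ 1 + |τ| := by
      refine (norm_add_le _ _).trans ?_
      rw [Complex.norm_I, norm_mul, Complex.norm_real, Complex.norm_real, Real.norm_eq_abs,
        Real.norm_eq_abs]
      have := mul_le_mul_of_nonneg_left hε (abs_nonneg τ)
      linarith
    have a2 : ‖(ε : ℂ)‖ ^ (n - k) ≤ 1 :=
      pow_le_one₀ (norm_nonneg _) (by rwa [Complex.norm_real])
    have a3 : ‖(Complex.I + τ * ε : ℂ)‖ ^ k ≤ (1 + |τ|) ^ n :=
      (pow_le_pow_left₀ (norm_nonneg _) a1 k).trans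
        (pow_le_pow_right₀ (by linarith [abs_nonneg τ]) hk')
    refine mul_le_mul_of_nonneg_left ?_ (norm_nonneg _)
    calc _ ≤ (1 + |τ|) ^ n * 1 := mul_le_mul a3 a2 (by positivity) (by positivity)
      _ = _ := mul_one _
  have h4 : ‖Complex.exp (-Real.pi * (τ : ℂ) ^ 2)‖ = Real.exp (-Real.pi * τ ^ 2) := by
    rw [Complex.norm_exp]
    congr 1
    norm_cast
  rw [norm_mul, h4]
  calc ‖homogEval P n ε τ‖ * Real.exp (-Real.pi * τ ^ 2)
      ≤ ((∑ k ∈ Finset.range (n + 1), ‖P.coeff k‖ + 1) *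
        (C * (Real.exp (Real.pi / 2) * Real.exp (Real.pi / 2 * τ ^ 2)))) *
          Real.exp (-Real.pi * τ ^ 2) := by
        refine mul_le_mul_of_nonneg_right (h3.trans ?_) (Real.exp_pos _).le
        refine mul_le_mul (by linarith) (h1.trans (by gcongr)) (by positivity) (by positivity)
    _ = (∑ k ∈ Finset.range (n + 1), ‖P.coeff k‖ + 1) * (C * Real.exp (Real.pi / 2)) *
        (Real.exp (Real.pi / 2 * τ ^ 2) * Real.exp (-Real.pi * τ ^ 2)) := by ring
    _ = _ := by rw [← Real.exp_add]; ring_nf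

/-- The renormalized matrices, converging to the Gaussian one. -/
noncomputable def zakLimitMatrix (P : ℂ[X]) (n : ℕ) (b : ℝ) (p q : ℕ) (ξ : UnitAddCircle) (ε : ℝ) :
    Matrix (Fin q) (Fin p) ℂ := fun r s =>
  ∑' m : ℤ, homogEval P n ε (zakNode b p q r s m) *
    Complex.exp (-Real.pi * (zakNode b p q r s m : ℂ) ^ 2) * fourier m ξ

lemma continuousOn_zakLimitMatrix (P : ℂ[X]) (n : ℕ) {b : ℝ} (hb : b ≠ 0) {p : ℕ} (hp : p ≠ 0)
    (q : ℕ) (ξ : UnitAddCircle) :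
    ContinuousOn (zakLimitMatrix P n b p q ξ) {ε | |ε| ≤ 1} := by
  refine continuousOn_pi.2 fun r => continuousOn_pi.2 fun s => ?_
  obtain ⟨C, hC, h⟩ := norm_homogEval_le P n
  refine continuousOn_tsum (u := fun m => C *
      Real.exp (-(Real.pi / 2) * zakNode b p q r s m ^ 2)) (fun m => ?_)
      ((summable_zakNode hb (by positivity) hp q r s).mul_left C) (fun m w hw => ?_)
  · refine Continuous.continuousOn ?_
    unfold homogEval
    fun_prop
  · rw [norm_mul, norm_fourier_apply, mul_one]
    exact h _ _ hw

lemma zakLimitMatrix_zero (P : ℂ[X]) (n : ℕ) (b : ℝ) (p q : ℕ) (ξ : UnitAddCircle) :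
    zakLimitMatrix P n b p q ξ 0 = (P.coeff n * Complex.I ^ n) • zakMatrix 1 b p q 0 ξ := by
  ext r s
  rw [Matrix.smul_apply, zakLimitMatrix, zakMatrix, smul_eq_mul, ← tsum_mul_left]
  refine tsum_congr fun m => ?_
  rw [homogEval_zero, eval_one, one_mul, zero_add]
  ring

/-- At `x = i/ε` the Gaussian splits as `exp (π/ε²) * exp (-2πi τ/ε) * exp (-πτ²)`. With `ε = b / (q
t)` the ratio `τ/ε` is an integer at every node, so the oscillating factor is `1` throughout. -/
lemma zakMatrix_imaginary {P : ℂ[X]} {n : ℕ} (hP : P.natDegree ≤ n) {b : ℝ} (hb : b ≠ 0) {p q : ℕ}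
    (hq : q ≠ 0) (ξ : UnitAddCircle) {t : ℕ} (ht : t ≠ 0) :
    zakMatrix P b p q (Complex.I / ((b / (q * t) : ℝ) : ℂ)) ξ =
      (Complex.exp (Real.pi / ((b / (q * t) : ℝ) : ℂ) ^ 2) / ((b / (q * t) : ℝ) : ℂ) ^ n) •
        zakLimitMatrix P n b p q ξ (b / (q * t)) := by
  set ε : ℝ := b / (q * t) with hε
  have hq' : (q : ℝ) ≠ 0 := by exact_mod_cast hq
  have ht' : (t : ℝ) ≠ 0 := by exact_mod_cast ht
  have hε0 : ε ≠ 0 := by positivity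
  have hε' : (ε : ℂ) ≠ 0 := by exact_mod_cast hε0
  ext r s
  rw [Matrix.smul_apply, zakLimitMatrix, zakMatrix, smul_eq_mul, ← tsum_mul_left]
  refine tsum_congr fun m => ?_
  set τ := zakNode b p q r s m with hτ
  rw [homogEval_eq hP hε0]
  have h1 : Complex.exp (-Real.pi * (Complex.I / ε + τ) ^ 2) =
      Complex.exp (Real.pi / (ε : ℂ) ^ 2) * Complex.exp (-Real.pi * (τ : ℂ) ^ 2) := by
    rw [← Complex.exp_add, Complex.exp_eq_exp_iff_exists_int]
    refine ⟨-(q * t * (p * m + (s : ℕ)) - t * p * (r : ℕ)), ?_⟩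
    have h2 : (τ / ε : ℂ) = ((q * t * (p * m + (s : ℕ)) - t * p * (r : ℕ) : ℤ) : ℂ) := by
      have : (τ / ε : ℝ) = ((q * t * (p * m + (s : ℕ)) - t * p * (r : ℕ) : ℤ) : ℝ) := by
        rw [hτ, hε, zakNode]
        push_cast
        field_simp
      exact_mod_cast congrArg (fun x : ℝ => (x : ℂ)) this
    have h3 : (Complex.I / ε + τ : ℂ) ^ 2 =
        -1 / (ε : ℂ) ^ 2 + 2 * Complex.I * (τ / ε) + (τ : ℂ) ^ 2 := by
      field_simp
      linear_combination Complex.I_sq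
    rw [h3, h2]
    push_cast
    ring
  rw [h1]
  field_simp

/-- Multiplying by the fixed Gaussian adjoint, rather than by the adjoint of the matrix itself,
gives a square determinant that is holomorphic in `x`. At `ε = 0` the renormalized determinant is a
nonzero multiple of the Gaussian Gram determinant, hence it stays nonzero for small `ε = b / (q t)`.
-/
lemma exists_det_zakMatrix_ne_zero {P : ℂ[X]} {n : ℕ} (hP : P.natDegree ≤ n)
    (hPn : P.coeff n ≠ 0) {b : ℝ} (hb : b ≠ 0) {p q : ℕ} (hp : p ≠ 0) (hpq : p ≤ q)
    (ξ : UnitAddCircle) : ∃ x : ℂ,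
      ((zakMatrix 1 b p q 0 ξ).conjTranspose * zakMatrix P b p q x ξ).det ≠ 0 := by
  set A := (zakMatrix 1 b p q 0 ξ).conjTranspose with hA
  have hq : q ≠ 0 := by omega
  have hcont : ContinuousOn (fun ε => (A * zakLimitMatrix P n b p q ξ ε).det) {ε | |ε| ≤ 1} := by
    have h1 : Continuous fun Z : Matrix (Fin q) (Fin p) ℂ => (A * Z).det :=
      Continuous.matrix_det (continuous_const.matrix_mul continuous_id)
    exact h1.comp_continuousOn (continuousOn_zakLimitMatrix P n hb hp q ξ)
  have h0 : (A * zakLimitMatrix P n b p q ξ 0).det ≠ 0 := by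
    rw [zakLimitMatrix_zero, Matrix.mul_smul, Matrix.det_smul]
    refine mul_ne_zero (pow_ne_zero _ (mul_ne_zero hPn (pow_ne_zero _ Complex.I_ne_zero))) ?_
    exact (det_conjTranspose_mul_self_ne_zero_iff _).2 fun v hv =>
      zakMatrix_gaussian_injective hb hp hpq ξ v hv
  have hnhds : {ε : ℝ | |ε| ≤ 1} ∈ nhds (0 : ℝ) := by
    filter_upwards [Metric.ball_mem_nhds (0 : ℝ) one_pos] with ε hε
    rw [mem_ball_zero_iff, Real.norm_eq_abs] at hε
    exact hε.le
  have hev := (hcont.continuousAt hnhds).eventually_ne h0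
  have htend : Filter.Tendsto (fun t : ℕ => b / (q * (t : ℝ))) Filter.atTop (nhds 0) := by
    have := tendsto_const_div_atTop_nhds_zero_nat (b / q)
    refine this.congr fun t => ?_
    rw [div_div]
  obtain ⟨t, ht, ht1⟩ := ((htend.eventually hev).and (Filter.eventually_ge_atTop 1)).exists
  refine ⟨Complex.I / ((b / (q * t) : ℝ) : ℂ), ?_⟩
  have ht0 : t ≠ 0 := by omega
  rw [zakMatrix_imaginary hP hb hq ξ ht0, Matrix.mul_smul, Matrix.det_smul]
  have hq' : (q : ℝ) ≠ 0 := by exact_mod_cast hq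
  have ht' : (t : ℝ) ≠ 0 := by exact_mod_cast ht0
  have hε : ((b / (q * t) : ℝ) : ℂ) ≠ 0 := by
    have : b / (q * t) ≠ 0 := by positivity
    exact_mod_cast this
  exact mul_ne_zero (pow_ne_zero _ (div_ne_zero (Complex.exp_ne_zero _) (pow_ne_zero _ hε))) ht

/-- By the identity theorem `f` cannot vanish on all of `ℝ`, and the zeros of a real-analytic
function that is not identically zero form a null set. -/
lemma ae_ne_zero_of_differentiable {f : ℂ → ℂ} (hf : Differentiable ℂ f) {w : ℂ} (hw : f w ≠ 0) :
    ∀ᵐ x : ℝ, f x ≠ 0 := by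
  have hg : AnalyticOnNhd ℝ (fun x : ℝ => f x) Set.univ := fun x _ =>
    ((hf.analyticAt (x : ℂ)).restrictScalars (𝕜 := ℝ)).comp (Complex.ofRealCLM.analyticAt x)
  have hx : ∃ x : ℝ, f x ≠ 0 := by
    by_contra! h
    have h1 : ∃ᶠ z in nhdsWithin (0 : ℂ) {0}ᶜ, f z = 0 := by
      have ht : Filter.Tendsto (fun x : ℝ => (x : ℂ)) (nhdsWithin 0 {0}ᶜ)
          (nhdsWithin (0 : ℂ) {0}ᶜ) := by
        refine tendsto_nhdsWithin_iff.2 ⟨?_, ?_⟩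
        · exact (Complex.continuous_ofReal.tendsto' 0 0 (by simp)).mono_left nhdsWithin_le_nhds
        · filter_upwards [self_mem_nhdsWithin] with x hx
          simpa using hx
      exact ht.frequently (Filter.Frequently.of_forall h)
    have h2 := AnalyticOnNhd.eqOn_zero_of_preconnected_of_frequently_eq_zero
      (fun z _ => hf.analyticAt z) isPreconnected_univ (Set.mem_univ (0 : ℂ)) h1
    exact hw (h2 (Set.mem_univ w))
  obtain ⟨x, hx⟩ := hx
  have h3 := hg.preimage_zero_mem_codiscrete hx
  have h4 := ae_restrict_le_codiscreteWithin (μ := (volume : Measure ℝ)) MeasurableSet.univ h3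
  rw [Measure.restrict_univ] at h4
  filter_upwards [h4] with y hy
  simpa using hy

/-- For each `ξ` holomorphy in `x` gives almost every `x`. Fubini exchanges the quantifiers, because
the application fixes `x = b t` and needs almost every `ξ`. -/
lemma ae_ae_zakMatrix_injective {P : ℂ[X]} {n : ℕ} (hP : P.natDegree ≤ n)
    (hPn : P.coeff n ≠ 0) {b : ℝ} (hb : b ≠ 0) {p q : ℕ} (hp : p ≠ 0) (hpq : p ≤ q) :
    ∀ᵐ x : ℝ, ∀ᵐ ξ ∂(AddCircle.haarAddCircle (T := (1 : ℝ))),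
      ∀ v, (zakMatrix P b p q x ξ).mulVec v = 0 → v = 0 := by
  have hc := continuous_zakMatrix P hb hp q
  have hcd : Continuous fun y : UnitAddCircle × ℝ =>
      ((zakMatrix P b p q y.2 y.1).conjTranspose * zakMatrix P b p q y.2 y.1).det := by
    have h1 : Continuous fun y : UnitAddCircle × ℝ => zakMatrix P b p q y.2 y.1 :=
      hc.comp ((Complex.continuous_ofReal.comp continuous_snd).prodMk continuous_fst)
    exact Continuous.matrix_det (h1.matrix_conjTranspose.matrix_mul h1)
  have hmeas : MeasurableSet {y : UnitAddCircle × ℝ |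
      ((zakMatrix P b p q y.2 y.1).conjTranspose * zakMatrix P b p q y.2 y.1).det ≠ 0} :=
    (isOpen_ne_fun hcd continuous_const).measurableSet
  have hall : ∀ ξ : UnitAddCircle, ∀ᵐ x : ℝ,
      ((zakMatrix P b p q x ξ).conjTranspose * zakMatrix P b p q x ξ).det ≠ 0 := by
    intro ξ
    obtain ⟨w, hw⟩ := exists_det_zakMatrix_ne_zero hP hPn hb hp hpq ξ
    have hd : Differentiable ℂ fun x =>
        ((zakMatrix 1 b p q 0 ξ).conjTranspose * zakMatrix P b p q x ξ).det := by
      simp_rw [Matrix.det_apply, Matrix.mul_apply]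
      have := fun r s => differentiable_zakMatrix P hb hp q ξ r s
      fun_prop
    filter_upwards [ae_ne_zero_of_differentiable hd hw] with x hx
    refine (det_conjTranspose_mul_self_ne_zero_iff _).2 fun v hv => ?_
    refine Matrix.eq_zero_of_mulVec_eq_zero hx ?_
    rw [← Matrix.mulVec_mulVec, hv, Matrix.mulVec_zero]
  have h1 : ∀ᵐ y ∂((AddCircle.haarAddCircle (T := (1 : ℝ))).prod (volume : Measure ℝ)),
      ((zakMatrix P b p q y.2 y.1).conjTranspose * zakMatrix P b p q y.2 y.1).det ≠ 0 :=
    (Measure.ae_prod_iff_ae_ae hmeas).2 (.of_forall hall)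
  have h2 := Measure.ae_ae_of_ae_prod
    ((Measure.measurePreserving_swap (μ := (volume : Measure ℝ))
      (ν := AddCircle.haarAddCircle (T := (1 : ℝ)))).quasiMeasurePreserving.ae h1)
  filter_upwards [h2] with x hx
  filter_upwards [hx] with ξ hξ
  exact (det_conjTranspose_mul_self_ne_zero_iff _).1 hξ

end GaborHermite

namespace GaborHermite
open Set

/-! ### Periodization -/

lemma summable_mul_and_norm_tsum_sq_le {a c : ℤ → ℂ} (ha : Summable fun j => ‖a j‖ ^ 2)
    (hc : Summable fun j => ‖c j‖ ^ 2) :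
    Summable (fun j => a j * c j) ∧
      ‖∑' j, a j * c j‖ ^ 2 ≤ (∑' j, ‖a j‖ ^ 2) * ∑' j, ‖c j‖ ^ 2 := by
  have h := Real.summable_and_inner_le_Lp_mul_Lq_tsum_of_nonneg Real.HolderConjugate.two_two
    (f := fun j => ‖a j‖) (g := fun j => ‖c j‖) (fun _ => norm_nonneg _) (fun _ => norm_nonneg _)
    (by simpa using ha) (by simpa using hc)
  simp only [Real.rpow_two, ← norm_mul] at h
  refine ⟨h.1.of_norm, ?_⟩
  have h1 := (norm_tsum_le_tsum_norm h.1).trans h.2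
  have hA : 0 ≤ ∑' j, ‖a j‖ ^ 2 := tsum_nonneg fun _ => by positivity
  have hC : 0 ≤ ∑' j, ‖c j‖ ^ 2 := tsum_nonneg fun _ => by positivity
  calc _ ≤ ((∑' j, ‖a j‖ ^ 2) ^ (1 / 2 : ℝ) * (∑' j, ‖c j‖ ^ 2) ^ (1 / 2 : ℝ)) ^ 2 := by gcongr
    _ = _ := by
      rw [← Real.sqrt_eq_rpow, ← Real.sqrt_eq_rpow, mul_pow, Real.sq_sqrt hA, Real.sq_sqrt hC]

lemma lintegral_tsum_enorm_comp_add_int_ne_top {g : ℝ → ℂ} (hg : Integrable g) :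
    ∫⁻ t in Ioc (0 : ℝ) 1, ∑' j : ℤ, ‖g (t + j)‖ₑ ≠ ⊤ := by
  rw [lintegral_tsum fun j : ℤ => ((hg.comp_add_right (j : ℝ)).1.enorm).restrict]
  have h := hg.norm.hasSum_intervalIntegral_comp_add_int.summable
  have (j : ℤ) : ∫⁻ t in Ioc (0 : ℝ) 1, ‖g (t + j)‖ₑ =
      ENNReal.ofReal (∫ t in (0 : ℝ)..1, ‖g (t + j)‖) := by
    rw [intervalIntegral.integral_of_le zero_le_one,
      ofReal_integral_norm_eq_lintegral_enorm (hg.comp_add_right (j : ℝ)).integrableOn]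
  simp_rw [this]
  exact h.tsum_ofReal_ne_top

lemma ae_summable_comp_add_int {g : ℝ → ℂ} (hg : Integrable g) :
    ∀ᵐ t ∂volume.restrict (Ioc (0 : ℝ) 1), Summable fun j : ℤ => ‖g (t + j)‖ := by
  have h1 : AEMeasurable (fun t : ℝ => ∑' j : ℤ, ‖g (t + j)‖ₑ) (volume.restrict (Ioc (0 : ℝ) 1)) :=
    AEMeasurable.tsum fun j => ((hg.comp_add_right (j : ℝ)).1.enorm).restrict
  filter_upwards [ae_lt_top' h1 (lintegral_tsum_enorm_comp_add_int_ne_top hg)] with t ht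
  exact NNReal.summable_coe.2 (ENNReal.tsum_coe_ne_top_iff_summable.1 ht.ne)

lemma integrable_tsum_norm_comp_add_int {g : ℝ → ℂ} (hg : Integrable g) :
    Integrable (fun t : ℝ => ∑' j : ℤ, ‖g (t + j)‖) (volume.restrict (Ioc (0 : ℝ) 1)) := by
  have h1 : AEMeasurable (fun t : ℝ => ∑' j : ℤ, ‖g (t + j)‖ₑ) (volume.restrict (Ioc (0 : ℝ) 1)) :=
    AEMeasurable.tsum fun j => ((hg.comp_add_right (j : ℝ)).1.enorm).restrict
  refine (integrable_toReal_of_lintegral_ne_top h1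
    (lintegral_tsum_enorm_comp_add_int_ne_top hg)).congr (.of_forall fun t => ?_)
  simp only [ENNReal.tsum_toReal_eq (fun j => enorm_ne_top), toReal_enorm]

lemma aestronglyMeasurable_tsum_comp_add_int {g : ℝ → ℂ} (hg : Integrable g) :
    AEStronglyMeasurable (fun t : ℝ => ∑' j : ℤ, g (t + j)) (volume.restrict (Ioc (0 : ℝ) 1)) := by
  refine aestronglyMeasurable_of_tendsto_ae (Filter.atTop : Filter (Finset ℤ))
    (f := fun s t => ∑ j ∈ s, g (t + j)) (fun s => ?_) ?_
  · exact Finset.aestronglyMeasurable_fun_sum s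
      fun j _ => (hg.comp_add_right (j : ℝ)).1.restrict
  · filter_upwards [ae_summable_comp_add_int hg] with t ht
    exact ht.of_norm.hasSum

lemma intervalIntegral_tsum_comp_add_int {g : ℝ → ℂ} (hg : Integrable g) :
    ∫ t in (0 : ℝ)..1, ∑' j : ℤ, g (t + j) = ∫ t, g t := by
  rw [intervalIntegral.integral_of_le zero_le_one]
  have h := hg.norm.hasSum_intervalIntegral_comp_add_int.summable
  have h2 := hg.hasSum_intervalIntegral_comp_add_int
  simp_rw [intervalIntegral.integral_of_le zero_le_one] at h h2
  exact (hasSum_integral_of_summable_integral_norm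
    (fun j : ℤ => (hg.comp_add_right (j : ℝ)).integrableOn) h).unique h2

/-- If all integer frequencies of `u` vanish, so does its periodization. -/
lemma ae_tsum_comp_add_int_eq_zero {u : ℝ → ℂ} (hu : Integrable u)
    (hU : MemLp (fun t : ℝ => ∑' j : ℤ, u (t + j)) 2 (volume.restrict (Ioc (0 : ℝ) 1)))
    (h0 : ∀ l : ℤ, ∫ t : ℝ, u t * Complex.exp (2 * Real.pi * Complex.I * l * t) = 0) :
    ∀ᵐ t ∂volume.restrict (Ioc (0 : ℝ) 1), ∑' j : ℤ, u (t + j) = 0 := by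
  -- Unfolding: the Fourier coefficients of the periodization are the integer frequencies of `u`.
  -- Parseval then finishes.
  have hc : ∀ l : ℤ, fourierCoeffOn (zero_lt_one' ℝ) (fun t : ℝ => ∑' j : ℤ, u (t + j)) l = 0 := by
    intro l
    have hper : ∀ (t : ℝ) (j : ℤ), Complex.exp (2 * Real.pi * Complex.I * (-l : ℤ) * (t + j : ℝ)) =
        Complex.exp (2 * Real.pi * Complex.I * (-l : ℤ) * t) := fun t j => by
      rw [Complex.exp_eq_exp_iff_exists_int]
      exact ⟨-l * j, by push_cast; ring⟩
    have hv : Integrable fun t : ℝ =>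
        u t * Complex.exp (2 * Real.pi * Complex.I * (-l : ℤ) * t) := by
      refine hu.mul_bdd (c := 1) (Continuous.aestronglyMeasurable (by fun_prop))
        (.of_forall fun t => ?_)
      rw [Complex.norm_exp]
      simp
    rw [fourierCoeffOn_eq_integral, sub_zero, div_one, one_smul, ← h0 (-l),
      ← intervalIntegral_tsum_comp_add_int hv]
    refine intervalIntegral.integral_congr fun t _ => ?_
    simp only [hper, tsum_mul_right, smul_eq_mul]
    rw [mul_comm, fourier_coe_apply]
    congr 2
    push_cast
    ring
  have h1 := hasSum_sq_fourierCoeffOn (zero_lt_one' ℝ) hU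
  simp only [hc, norm_zero, sub_zero, inv_one, one_smul, ne_eq, OfNat.ofNat_ne_zero,
    not_false_eq_true, zero_pow] at h1
  have h2 := h1.unique hasSum_zero
  rw [intervalIntegral.integral_of_le zero_le_one, integral_eq_zero_iff_of_nonneg
    (fun _ => by positivity) hU.integrable_norm_pow'] at h2
  filter_upwards [h2] with t ht
  simpa using ht

end GaborHermite

namespace GaborHermite
open Set AddCircle

/-! ### Convolution systems on `ℓ²(ℤ)` -/

lemma fourierCoeff_tsum_mul {G : ℤ → ℂ} (hG : Summable fun m => ‖G m‖) {C : UnitAddCircle → ℂ}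
    (hC : Integrable C (haarAddCircle (T := (1 : ℝ)))) (k : ℤ) :
    fourierCoeff (fun ξ => (∑' m, G m * fourier m ξ) * C ξ) k =
      ∑' m, G m * fourierCoeff C (k - m) := by
  have hint : ∀ m, Integrable (fun ξ : UnitAddCircle => G m * (fourier (-(k - m)) ξ * C ξ))
      (haarAddCircle (T := (1 : ℝ))) := fun m =>
    (hC.fourier_smul _).const_mul _
  have hnorm : Summable fun m => ∫ ξ : UnitAddCircle, ‖G m * (fourier (-(k - m)) ξ * C ξ)‖
      ∂(haarAddCircle (T := (1 : ℝ))) := by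
    simp_rw [norm_mul, norm_fourier_apply, one_mul, integral_const_mul]
    exact hG.mul_right _
  have h := hasSum_integral_of_summable_integral_norm hint hnorm
  simp_rw [integral_const_mul] at h
  refine (integral_congr_ae (.of_forall fun ξ => ?_)).trans h.tsum_eq.symm
  simp only [smul_eq_mul]
  rw [← tsum_mul_right, ← tsum_mul_left]
  refine tsum_congr fun m => ?_
  rw [neg_sub, sub_eq_neg_add, fourier_add]
  ring

lemma ae_eq_zero_of_fourierCoeff_eq_zero {f : UnitAddCircle → ℂ}
    (hf : MemLp f 2 (haarAddCircle (T := (1 : ℝ)))) (h : ∀ k, fourierCoeff f k = 0) :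
    f =ᵐ[haarAddCircle (T := (1 : ℝ))] 0 := by
  have h1 : hf.toLp = 0 := by
    refine fourierBasis.repr.injective ?_
    ext k
    rw [fourierBasis_repr, fourierCoeff_congr_ae hf.coeFn_toLp, h, map_zero]
    rfl
  exact hf.coeFn_toLp.symm.trans (h1 ▸ Lp.coeFn_zero _ _ _)

lemma exists_fourierCoeff_eq {c : ℤ → ℂ} (hc : Summable fun m => ‖c m‖ ^ 2) :
    ∃ C : UnitAddCircle → ℂ, MemLp C 2 (haarAddCircle (T := (1 : ℝ))) ∧
      ∀ k, fourierCoeff C k = c k := by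
  have hm : Memℓp c 2 := memℓp_gen (by simpa using hc)
  refine ⟨fourierBasis.repr.symm ⟨c, hm⟩, Lp.memLp _, fun k => ?_⟩
  rw [← fourierBasis_repr, LinearIsometryEquiv.apply_symm_apply]

lemma continuous_tsum_mul_fourier {G : ℤ → ℂ} (hG : Summable fun m => ‖G m‖) :
    Continuous fun ξ : UnitAddCircle => ∑' m, G m * fourier m ξ := by
  refine continuous_tsum (fun m => by fun_prop) hG fun m ξ => ?_
  rw [norm_mul, norm_fourier_apply, mul_one]

lemma memLp_tsum_mul_fourier_mul {G : ℤ → ℂ} (hG : Summable fun m => ‖G m‖)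
    {C : UnitAddCircle → ℂ} (hC : MemLp C 2 (haarAddCircle (T := (1 : ℝ)))) :
    MemLp (fun ξ => (∑' m, G m * fourier m ξ) * C ξ) 2 (haarAddCircle (T := (1 : ℝ))) := by
  refine hC.of_le_mul (c := ∑' m, ‖G m‖)
    ((continuous_tsum_mul_fourier hG).aestronglyMeasurable.mul hC.1) (.of_forall fun ξ => ?_)
  have hb : ∀ m, ‖G m * fourier m ξ‖ = ‖G m‖ := fun m => by
    rw [norm_mul, norm_fourier_apply, mul_one]
  rw [norm_mul]
  gcongr
  refine (norm_tsum_le_tsum_norm (by simpa only [hb] using hG)).trans_eq ?_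
  simp only [hb]

/-- A system of discrete convolution equations whose symbol is injective almost everywhere has
only the trivial square summable solution. -/
lemma eq_zero_of_convolution_system {p q : ℕ} {G : Fin q → Fin p → ℤ → ℂ}
    (hG : ∀ r s, Summable fun m => ‖G r s m‖) {c : Fin p → ℤ → ℂ}
    (hc : ∀ s, Summable fun m => ‖c s m‖ ^ 2)
    (h : ∀ r (k : ℤ), ∑ s, ∑' m, G r s m * c s (m + k) = 0)
    (hinj : ∀ᵐ ξ ∂(haarAddCircle (T := (1 : ℝ))), ∀ v : Fin p → ℂ,
      (∀ r, ∑ s, (∑' m, G r s m * fourier m ξ) * v s = 0) → v = 0) (s : Fin p) (m : ℤ) :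
    c s m = 0 := by
  -- The system involves `m + k`, a correlation; reflecting `c` turns it into a convolution, that
  -- is, a product of Fourier series.
  have hc' : ∀ s, Summable fun m => ‖c s (-m)‖ ^ 2 := fun s =>
    (Equiv.neg ℤ).summable_iff.2 (hc s)
  choose C hC hCc using fun s => exists_fourierCoeff_eq (hc' s)
  have hzero : ∀ r, (∑ s, fun ξ => (∑' m, G r s m * fourier m ξ) * C s ξ)
      =ᵐ[haarAddCircle (T := (1 : ℝ))] 0 := fun r => by
    refine ae_eq_zero_of_fourierCoeff_eq_zero
      (memLp_finsetSum' _ fun s _ => memLp_tsum_mul_fourier_mul (hG r s) (hC s)) fun k => ?_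
    rw [fourierCoeff.sum _ _ fun s _ => (memLp_tsum_mul_fourier_mul (hG r s) (hC s)).integrable
      (by norm_num), Finset.sum_apply, ← h r (-k)]
    refine Finset.sum_congr rfl fun s _ => ?_
    rw [fourierCoeff_tsum_mul (hG r s) ((hC s).integrable (by norm_num))]
    refine tsum_congr fun m => ?_
    rw [hCc, neg_sub, sub_eq_add_neg]
  have hCz : C s =ᵐ[haarAddCircle (T := (1 : ℝ))] 0 := by
    filter_upwards [hinj, ae_all_iff.2 hzero] with ξ h1 h2
    refine congrFun (h1 (fun s => C s ξ) fun r => ?_) s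
    have := h2 r
    rwa [Finset.sum_apply] at this
  have h3 := hCc s (-m)
  rw [fourierCoeff_congr_ae hCz, neg_neg] at h3
  rw [← h3, fourierCoeff]
  simp

end GaborHermite

namespace GaborHermite
open Set AddCircle

/-! ### Rational lattices -/

lemma norm_hermiteFun_add_le (n : ℕ) (R : ℝ) : ∃ C : ℝ, 0 < C ∧ ∀ x τ : ℝ, |x| ≤ R →
    ‖hermiteFun n (x + τ)‖ ≤ C * Real.exp (-(Real.pi / 4) * τ ^ 2) := by
  obtain ⟨C, hC, h⟩ := norm_eval_mul_gaussian_le (hermiteC n) R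
  refine ⟨C, hC, fun x τ hx => ?_⟩
  have := h x τ (by simpa using hx)
  rw [hermiteFun_eq]
  exact_mod_cast this

lemma quasiMeasurePreserving_mul_left {b : ℝ} (hb : b ≠ 0) :
    Measure.QuasiMeasurePreserving (fun t : ℝ => b * t) volume volume := by
  refine ⟨measurable_const_mul b, ?_⟩
  rw [Real.map_volume_mul_left hb]
  exact Measure.smul_absolutelyContinuous

/-- Cauchy–Schwarz in `j`: the periodization of `‖f(b ·)‖²` is integrable over a period, and the
window sum is bounded uniformly in `t`. This is what allows Parseval for the periodization. -/
lemma memLp_tsum_mul_hermiteFun {f : ℝ → ℂ} (hf : MemLp f 2 volume) {b : ℝ} (hb : b ≠ 0) (n : ℕ)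
    (x : ℝ) :
    MemLp (fun t : ℝ => ∑' j : ℤ, f (b * (t + j)) * hermiteFun n (b * (t + j) - x)) 2
      (volume.restrict (Ioc (0 : ℝ) 1)) := by
  have hmeas := aestronglyMeasurable_tsum_comp_add_int
    ((integrable_mul_hermite hf n x).comp_mul_left' hb)
  have hsq : Integrable fun t : ℝ => ((‖f (b * t)‖ ^ 2 : ℝ) : ℂ) :=
    (((memLp_two_iff_integrable_sq_norm hf.1).1 hf).ofReal (𝕜 := ℂ)).comp_mul_left' hb
  obtain ⟨C, hC, h⟩ := norm_hermiteFun_add_le n (|b| + |x|)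
  rw [memLp_two_iff_integrable_sq_norm hmeas]
  refine ((integrable_tsum_norm_comp_add_int hsq).mul_const
    (∑' j : ℤ, (C * Real.exp (-(Real.pi / 4) * (b * j) ^ 2)) ^ 2)).mono' (hmeas.norm.pow 2) ?_
  filter_upwards [ae_summable_comp_add_int hsq, ae_restrict_mem measurableSet_Ioc] with t ht ht1
  have hn : ∀ j : ℤ, ‖((‖f (b * (t + j))‖ ^ 2 : ℝ) : ℂ)‖ = ‖f (b * (t + j))‖ ^ 2 := fun j => by
    rw [Complex.norm_real, Real.norm_of_nonneg (by positivity)]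
  simp only [hn] at ht ⊢
  have hbd : ∀ j : ℤ, ‖hermiteFun n (b * (t + j) - x)‖ ≤
      C * Real.exp (-(Real.pi / 4) * (b * j) ^ 2) := fun j => by
    have e : b * (t + j) - x = (b * t - x) + b * j := by ring
    rw [e]
    refine h _ _ ((abs_sub _ _).trans ?_)
    rw [abs_mul, abs_of_pos ht1.1]
    have := mul_le_mul_of_nonneg_left ht1.2 (abs_nonneg b)
    linarith
  have hsum : Summable fun j : ℤ => (C * Real.exp (-(Real.pi / 4) * (b * j) ^ 2)) ^ 2 := by
    refine ((summable_exp_affine (a := Real.pi / 2) (by positivity) hb 0).mul_left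
      (C ^ 2)).congr fun j => ?_
    rw [mul_pow, ← Real.exp_nat_mul]
    push_cast
    ring_nf
  have hle : ∀ j : ℤ, ‖hermiteFun n (b * (t + j) - x)‖ ^ 2 ≤
      (C * Real.exp (-(Real.pi / 4) * (b * j) ^ 2)) ^ 2 := fun j => by
    gcongr
    exact hbd j
  have hsumh : Summable fun j : ℤ => ‖hermiteFun n (b * (t + j) - x)‖ ^ 2 :=
    hsum.of_nonneg_of_le (fun _ => by positivity) hle
  rw [Real.norm_of_nonneg (by positivity)]
  refine (summable_mul_and_norm_tsum_sq_le ht hsumh).2.trans ?_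
  exact mul_le_mul_of_nonneg_left (hsumh.tsum_le_tsum hle hsum)
    (tsum_nonneg fun _ => by positivity)

/-- The frequencies `l / b` are dual to the period `b`; after rescaling by `b` they become the
integer frequencies. -/
lemma ae_tsum_mul_hermiteFun_eq_zero {f : ℝ → ℂ} (hf : MemLp f 2 volume) {b : ℝ} (hb : b ≠ 0)
    (n : ℕ) (x : ℝ) (h0 : ∀ l : ℤ, hermiteSTFT n f x (l / b) = 0) :
    ∀ᵐ t ∂volume.restrict (Ioc (0 : ℝ) 1),
      ∑' j : ℤ, f (b * (t + j)) * hermiteFun n (b * (t + j) - x) = 0 := by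
  refine ae_tsum_comp_add_int_eq_zero ((integrable_mul_hermite hf n x).comp_mul_left' hb)
    (memLp_tsum_mul_hermiteFun hf hb n x) fun l => ?_
  have h1 := Measure.integral_comp_mul_left (fun s : ℝ => f s * hermiteFun n (s - x) *
    Complex.exp (2 * Real.pi * Complex.I * ((l / b : ℝ) : ℂ) * s)) b
  rw [show (∫ y, _) = hermiteSTFT n f x (l / b) from rfl, h0, smul_zero] at h1
  rw [← h1]
  refine integral_congr_ae (.of_forall fun t => ?_)
  have hb' : (b : ℂ) ≠ 0 := by exact_mod_cast hb
  simp only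
  congr 2
  push_cast
  field_simp

/-- The pointwise step: a square summable sequence annihilated by all lattice translates of the
window vanishes whenever the Zak matrix is injective. -/
lemma eq_zero_of_tsum_mul_hermiteFun {c : ℤ → ℂ} (hc : Summable fun j => ‖c j‖ ^ 2) {b x : ℝ}
    (hb : b ≠ 0) {p q : ℕ} (hp : p ≠ 0) (hq : q ≠ 0) (n : ℕ)
    (h0 : ∀ k : ℤ, ∑' j : ℤ, c j * hermiteFun n (x + b * j - b * p / q * k) = 0)
    (hinj : ∀ᵐ ξ ∂(haarAddCircle (T := (1 : ℝ))),
      ∀ v, (zakMatrix (hermiteC n) b p q x ξ).mulVec v = 0 → v = 0) : c = 0 := by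
  have : NeZero p := ⟨hp⟩
  have hq' : (q : ℝ) ≠ 0 := by exact_mod_cast hq
  obtain ⟨C, hC, h⟩ := norm_hermiteFun_add_le n |x|
  have hinjp : ∀ s : Fin p, Function.Injective fun m : ℤ => m * p + (s : ℕ) := fun s m m' hm => by
    have hp' : (p : ℤ) ≠ 0 := by exact_mod_cast hp
    exact mul_right_cancel₀ hp' (add_right_cancel hm)
  have hG : ∀ (r : Fin q) (s : Fin p),
      Summable fun m => ‖hermiteFun n (x + zakNode b p q r s m)‖ := fun r s =>
    ((summable_zakNode hb (c := Real.pi / 4) (by positivity) hp q r s).mul_left C).of_nonneg_of_le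
      (fun _ => norm_nonneg _) fun m => h _ _ le_rfl
  have hsum : ∀ k : ℤ, Summable fun j : ℤ => c j * hermiteFun n (x + b * j - b * p / q * k) := by
    intro k
    refine (summable_mul_and_norm_tsum_sq_le hc ?_).1
    refine ((summable_exp_affine (a := Real.pi / 2) (by positivity) hb
      (-(b * p / q * k))).mul_left (C ^ 2)).of_nonneg_of_le (fun _ => by positivity) fun j => ?_
    have h2 := h x (b * j + -(b * p / q * k)) le_rfl
    rw [← add_assoc, ← sub_eq_add_neg] at h2
    refine (pow_le_pow_left₀ (norm_nonneg _) h2 2).trans_eq ?_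
    rw [mul_pow, ← Real.exp_nat_mul]
    push_cast
    ring_nf
  have key := eq_zero_of_convolution_system hG
    (c := fun s m => c (m * p + (s : ℕ))) (fun s => hc.comp_injective (hinjp s)) (fun r k => ?_) ?_
  · ext j
    have h1 := key ((Int.divModEquiv p) j).2 ((Int.divModEquiv p) j).1
    rwa [show ((Int.divModEquiv p) j).1 * p + (((Int.divModEquiv p) j).2 : ℕ) = j from
      (Int.divModEquiv p).symm_apply_apply j] at h1
  -- Moving the window by index `q k` is a shift by `b p k`, which moves `j` by `k p` and so
  -- preserves residues modulo `p`.
  · have h1 := h0 (q * k + (r : ℕ))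
    rw [← (Equiv.addRight (k * (p : ℤ))).tsum_eq, tsum_int_eq_sum_fin p] at h1
    · rw [← h1]
      refine Finset.sum_congr rfl fun s _ => tsum_congr fun m => ?_
      have e1 : (Equiv.addRight (k * (p : ℤ))) (m * p + (s : ℕ)) = (m + k) * p + (s : ℕ) := by
        simp only [Equiv.coe_addRight]; ring
      rw [e1, mul_comm]
      congr 2
      rw [zakNode]
      push_cast
      field_simp
      ring
    · exact (Equiv.addRight (k * (p : ℤ))).summable_iff.2 (hsum (q * k + (r : ℕ)))
  · filter_upwards [hinj] with ξ hξ v hv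
    refine hξ v (funext fun r => ?_)
    rw [Pi.zero_apply, ← hv r, Matrix.mulVec, dotProduct]
    refine Finset.sum_congr rfl fun s _ => ?_
    rw [zakMatrix]
    congr 1
    refine tsum_congr fun m => ?_
    rw [hermiteFun_eq, Complex.ofReal_add]

/-- Argue on fibres: for almost every `t` the samples `f(b(t + j))` are square summable, satisfy all
window equations and meet an injective Zak symbol, so they vanish. Periodizing `‖f(b ·)‖²`
reassembles the fibres. -/
lemma ae_eq_zero_of_hermiteSTFT_eq_zero {f : ℝ → ℂ} (hf : MemLp f 2 volume) (n : ℕ) {b : ℝ}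
    (hb : b ≠ 0) {p q : ℕ} (hp : p ≠ 0) (hpq : p ≤ q)
    (h0 : ∀ k l : ℤ, hermiteSTFT n f (b * p / q * k) (l / b) = 0) : f =ᵐ[volume] 0 := by
  have hsq : Integrable fun t : ℝ => ((‖f (b * t)‖ ^ 2 : ℝ) : ℂ) :=
    (((memLp_two_iff_integrable_sq_norm hf.1).1 hf).ofReal (𝕜 := ℂ)).comp_mul_left' hb
  have hn : ∀ t : ℝ, ‖((‖f (b * t)‖ ^ 2 : ℝ) : ℂ)‖ = ‖f (b * t)‖ ^ 2 := fun t => by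
    rw [Complex.norm_real, Real.norm_of_nonneg (by positivity)]
  have hzak := (quasiMeasurePreserving_mul_left hb).ae
    (ae_ae_zakMatrix_injective (hermiteC_natDegree_le n) (hermiteC_coeff_ne_zero n) hb hp hpq)
  have hae : ∀ᵐ t ∂volume.restrict (Ioc (0 : ℝ) 1), ∀ j : ℤ, f (b * (t + j)) = 0 := by
    filter_upwards [ae_summable_comp_add_int hsq, ae_restrict_of_ae hzak,
      ae_all_iff.2 fun k => ae_tsum_mul_hermiteFun_eq_zero hf hb n _ (h0 k)] with t h1 h2 h3
    simp only [hn] at h1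
    refine congrFun (eq_zero_of_tsum_mul_hermiteFun (c := fun j => f (b * (t + j))) h1 hb hp
      (by omega) n (fun k => ?_) h2)
    simpa only [mul_add] using h3 k
  have hint : ∫ t : ℝ, ((‖f (b * t)‖ ^ 2 : ℝ) : ℂ) = 0 := by
    rw [← intervalIntegral_tsum_comp_add_int hsq, intervalIntegral.integral_of_le zero_le_one]
    refine integral_eq_zero_of_ae ?_
    filter_upwards [hae] with t ht
    simp [ht]
  rw [integral_complex_ofReal, Complex.ofReal_eq_zero,
    Measure.integral_comp_mul_left (fun s => ‖f s‖ ^ 2) b, smul_eq_zero] at hint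
  have h4 := hint.resolve_left (by simpa using hb)
  rw [integral_eq_zero_iff_of_nonneg (fun _ => by positivity)
    ((memLp_two_iff_integrable_sq_norm hf.1).1 hf)] at h4
  filter_upwards [h4] with t ht
  simpa using ht

theorem isCompleteL2_of_rational (n : ℕ) {α β : ℝ} (hα : 0 < α) (hβ : 0 < β) {r : ℚ}
    (hr : α * β = r) (hle : α * β ≤ 1) : IsCompleteL2 (gaborSystem (hermiteFun n) α β) := by
  refine (isCompleteL2_iff n α β).2 fun f hf hz => ?_
  have hr0 : 0 < r := by
    have : 0 < α * β := by positivity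
    rw [hr] at this
    exact_mod_cast this
  have hr1 : r ≤ 1 := by
    rw [hr] at hle
    exact_mod_cast hle
  have hnum := Rat.num_pos.2 hr0
  obtain ⟨p, hp⟩ : ∃ p : ℕ, r.num = p := ⟨r.num.toNat, by omega⟩
  have hrp : (r : ℝ) = p / r.den := by
    rw [Rat.cast_def, hp, Int.cast_natCast]
  have hpq : p ≤ r.den := by
    have := Rat.num_le_denom_iff.2 hr1
    omega
  -- With period `b = 1 / β` the frequencies `l / b` are `β l`, and `αβ = p / q` makes the
  -- translation step `b p / q` equal to `α`.
  refine ae_eq_zero_of_hermiteSTFT_eq_zero hf n (b := 1 / β) (by positivity) (p := p) (by omega)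
    hpq fun k l => ?_
  have h1 := (polyBargmann_eq_zero_iff n f _).1 (hz _ ⟨k, l, rfl⟩)
  have hαr : α = 1 / β * p / r.den := by
    rw [mul_div_assoc, ← hrp, ← hr]
    field_simp
  rw [← hαr, div_div_eq_mul_div, div_one, mul_comm (l : ℝ)]
  simpa using h1

end GaborHermite

theorem corollary3p2 (n : ℕ) (α β : ℝ) (hα : 0 < α) (hβ : 0 < β) :
    ((∃ r : ℚ, α * β = (r : ℝ)) → α * β ≤ 1 →
      GaborHermite.IsCompleteL2
          (GaborHermite.gaborSystem (GaborHermite.hermiteFun n) α β) ∧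
        GaborHermite.IsUniquenessSet (GaborHermite.rectLattice α β)
          (GaborHermite.truePolyFock (n + 1))) ∧
    (GaborHermite.IsCompleteL2
        (GaborHermite.gaborSystem (GaborHermite.hermiteFun n) α β) ↔
      GaborHermite.IsUniquenessSet (GaborHermite.rectLattice α β)
        (GaborHermite.truePolyFock (n + 1))) := by
  have hiff := GaborHermite.isCompleteL2_iff_isUniquenessSet n α β
  refine ⟨fun ⟨r, hr⟩ hle => ?_, hiff⟩
  have hcomplete := GaborHermite.isCompleteL2_of_rational n hα hβ hr hle
  exact ⟨hcomplete, hiff.1 hcomplete⟩
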